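/- **Definitions.** For a cone $C\subset\mathbb C^m$ which is a smooth $m$-dimensional submanifold away from an isolated singularity at $0$ let $\Sigma=C\cap\mathcal S^{2m-1}$ be its link, with the metric induced from the Euclidean metric of $\mathbb C^m$, and let $\Delta=\mathrm d^*\mathrm d$ be the Laplacian on smooth real functions. The *number of ends* of $C$ is the number of connected components $\Sigma_1,\dots,\Sigma_k$ of $\Sigma$. The *Legendrian index* $\text{l-ind}(C)$ is the number of eigenvalues of $\Delta$ on $\Sigma$ in $(0,2m)$, counted with multiplicity. The cone $C$ is *rigid* if for each $j$ the eigenspace of $\Delta$ on $\Sigma_j$ with eigenvalue $2m$ has dimension $\dim \mathrm{SU}(m)-\dim G_j$, where $G_j\subset\mathrm{SU}(m)$ is the Lie subgroup preserving $\Sigma_j$. For $\boldsymbol\phi=(\phi_1,\phi_2,\phi_3)$ with $\phi_k\in(0,\pi)$ and $\phi_1+\phi_2+\phi_3=\pi$, let $\Pi_0=\mathbb R^3\subset\mathbb C^3$ and $\Pi_{\boldsymbol\phi}=\{(e^{i\phi_1}x_1,e^{i\phi_2}x_2,e^{i\phi_3}x_3):x_j\in\mathbb R\}$. For $a_1,a_2,a_3>0$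 let $P(x)=\bigl((1+a_1x^2)(1+a_2x^2)(1+a_3x^2)-1\bigr)/x^2$ and $$\psi_k(y)=a_k\int_{-\infty}^y\frac{\mathrm dx}{(1+a_kx^2)\sqrt{P(x)}},\qquad \phi_k=a_k\int_{-\infty}^\infty\frac{\mathrm dx}{(1+a_kx^2)\sqrt{P(x)}},\qquad A=\tfrac{4\pi}{3}(a_1a_2a_3)^{-1/2},$$ let $z_k(y)=e^{i\psi_k(y)}\sqrt{a_k^{-1}+y^2}$, and define Lawlor's neck $$K_{\boldsymbol\phi,A}=\{(z_1(y)x_1,z_2(y)x_2,z_3(y)x_3): y\in\mathbb R,\ x_k\in\mathbb R,\ x_1^2+x_2^2+x_3^2=1\}\subset\mathbb C^3 .$$ **Lemma 5.2.** (a) Let $\phi_k\in(0,\pi)$ with $\phi_1+\phi_2+\phi_3=\pi$, and let $C=\Pi_0\cup\Pi_{\boldsymbol\phi}$. The connected components of the link of $C$ are $\Pi_0\cap\mathcal S^5$ and $\Pi_{\boldsymbol\phi}\cap\mathcal S^5$, so $C$ has exactly $k=2$ ends. Each component $\Sigma_j$ is isometric to the unit sphere $\mathcal S^2\subset\mathbb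 R^3$; on it the only eigenvalue of $\Delta$ in $(0,6)$ is $2$, with multiplicity $3$, and the eigenvalue $6$ has multiplicity $5$; the subgroup $G_j$ of $\mathrm{SU}(3)$ preserving $\Sigma_j$ is isomorphic (as a topological group) to $\mathrm{SO}(3)$ and has dimension $3$, while $\dim\mathrm{SU}(3)=8$. Consequently $\text{l-ind}(C)=6$, and $C$ is rigid, as $5=8-3$. (b) For all $a_1,a_2,a_3>0$, the numbers $\phi_k$ defined above lie in $(0,\pi)$ and satisfy $\phi_1+\phi_2+\phi_3=\pi$ (so (a) applies to them), $A>0$, the set $K_{\boldsymbol\phi,A}$ is diffeomorphic to $\mathcal S^2\times\mathbb R$, and its first Betti number is $b^1(K_{\boldsymbol\phi,A})=0$. -/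

import Mathlib

open scoped ContDiff

noncomputable section

namespace SLCone

section Submanifold

variable {E : Type*} [NormedAddCommGroup E] [InnerProductSpace ℝ E] [FiniteDimensional ℝ E]

/-- The tangent space at `x` of a subset `S` of a Euclidean space: the span of the tangent cone.
If `S` is an embedded smooth submanifold this is the usual tangent space `T_x S`. -/
def tangentSpan (S : Set E) (x : E) : Submodule ℝ E :=
  Submodule.span ℝ (tangentConeAt ℝ S x)

/-- The tangential trace `∑ i, ⟪A eᵢ, eᵢ⟫` of a linear map `A`, where `eᵢ` is an orthonormal
basis of the tangent space `T_x S`. If `A` is the derivative along `S` of a tangent vector field,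
this is its divergence at `x` (the Levi-Civita connection of the induced metric is the tangential
part of the ordinary derivative). -/
def tangentialTrace (S : Set E) (x : E) (A : E →L[ℝ] E) : ℝ :=
  ∑ i, inner ℝ (A (stdOrthonormalBasis ℝ (tangentSpan S x) i : E))
    (stdOrthonormalBasis ℝ (tangentSpan S x) i : E)

/-- `IsLaplacian S u w`: the function `u` on the submanifold `S` of a Euclidean space is smooth
(it is the restriction of some `f` which is smooth along `S`), and `w = d^* d u = - div (grad u)`
for the metric on `S` induced from the Euclidean metric. Here `X` is the gradient vector field
of `u`: it is tangent to `S`, and `du(v) = ⟪X, v⟫` for tangent vectors `v`.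
(Derivatives within `S` are determined by `u` and `X` on tangent vectors.) -/
def IsLaplacian (S : Set E) (u w : S → ℝ) : Prop :=
  ∃ (f : E → ℝ) (X : E → E), (∀ x : S, f x = u x) ∧ ContDiffOn ℝ ∞ f S ∧
    ∀ x : S, X x ∈ tangentSpan S (x : E) ∧
      (∃ f' : E →L[ℝ] ℝ, HasFDerivWithinAt f f' S x ∧
        ∀ v ∈ tangentSpan S (x : E), f' v = inner ℝ (X x) v) ∧
      (∃ X' : E →L[ℝ] E, HasFDerivWithinAt X X' S x ∧ w x = - tangentialTrace S x X')

/-- The space of smooth functions `u` on `S` with `Δ u = c u`, where `Δ = d^* d`. -/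
def eigenspace (S : Set E) (c : ℝ) : Submodule ℝ (S → ℝ) where
  carrier := {u | IsLaplacian S u (c • u)}
  zero_mem' := by
    refine ⟨0, 0, fun _ => rfl, contDiffOn_const, fun x => ⟨Submodule.zero_mem _,
      ⟨0, hasFDerivWithinAt_const _ _ _, by simp⟩,
      ⟨0, hasFDerivWithinAt_const _ _ _, by simp [tangentialTrace]⟩⟩⟩
  add_mem' := by
    rintro u v ⟨f, X, hf, hfs, h⟩ ⟨g, Y, hg, hgs, k⟩
    refine ⟨f + g, X + Y, fun x => by simp [hf, hg], hfs.add hgs, fun x => ?_⟩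
    obtain ⟨h1, ⟨f', h2, h3⟩, ⟨X', h4, h5⟩⟩ := h x
    obtain ⟨k1, ⟨g', k2, k3⟩, ⟨Y', k4, k5⟩⟩ := k x
    refine ⟨Submodule.add_mem _ h1 k1, ⟨f' + g', h2.add k2, fun v hv => ?_⟩,
      ⟨X' + Y', h4.add k4, ?_⟩⟩
    · simp [h3 v hv, k3 v hv, inner_add_left]
    · have h5' : c * u x = - tangentialTrace S x X' := h5
      have k5' : c * v x = - tangentialTrace S x Y' := k5
      have : tangentialTrace S x (X' + Y') = tangentialTrace S x X' + tangentialTrace S x Y' := by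
        simp [tangentialTrace, inner_add_left, Finset.sum_add_distrib]
      simp only [Pi.smul_apply, Pi.add_apply, smul_eq_mul, this]
      linarith
  smul_mem' := by
    rintro r u ⟨f, X, hf, hfs, h⟩
    refine ⟨r • f, r • X, fun x => by simp [hf], hfs.const_smul r, fun x => ?_⟩
    obtain ⟨h1, ⟨f', h2, h3⟩, ⟨X', h4, h5⟩⟩ := h x
    refine ⟨Submodule.smul_mem _ _ h1, ⟨r • f', h2.const_smul r, fun v hv => ?_⟩,
      ⟨r • X', h4.const_smul r, ?_⟩⟩
    · simp [h3 v hv, inner_smul_left]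
    · have h5' : c * u x = - tangentialTrace S x X' := h5
      have : tangentialTrace S x (r • X') = r * tangentialTrace S x X' := by
        simp [tangentialTrace, inner_smul_left, Finset.mul_sum]
      simp only [Pi.smul_apply, smul_eq_mul, this]
      linear_combination r * h5'

/-- `c` is an eigenvalue of the Laplacian `d^* d` on functions on `S`. -/
def IsEigenvalue (S : Set E) (c : ℝ) : Prop := eigenspace S c ≠ ⊥

/-- The multiplicity of `c` as an eigenvalue of the Laplacian on `S`: the dimension of the
eigenspace (`⊤` if it is infinite). It is `0` if `c` is not an eigenvalue. -/
def multiplicity (S : Set E) (c : ℝ) : ℕ∞ := Cardinal.toENat (Module.rank ℝ (eigenspace S c))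

/-- The set of connected components of a subset `S`, as subsets of the ambient space. -/
def components (S : Set E) : Set (Set E) := {T | ∃ x ∈ S, T = connectedComponentIn S x}

end Submanifold

/-- Two embedded submanifolds (given as subsets of finite-dimensional vector spaces) are
diffeomorphic: there are mutually inverse maps between them which are smooth along them. If `S` is
an embedded submanifold, this implies that `T` is one too. -/
def AreDiffeomorphic {E F : Type*} [NormedAddCommGroup E] [NormedSpace ℝ E]
    [NormedAddCommGroup F] [NormedSpace ℝ F] (S : Set E) (T : Set F) : Prop :=
  ∃ (f : E → F) (g : F → E), ContDiffOn ℝ ∞ f S ∧ ContDiffOn ℝ ∞ g T ∧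
    Set.MapsTo f S T ∧ Set.MapsTo g T S ∧ Set.InvOn g f S T

/-- The first Betti number of a topological space: the dimension of `H_1(X; ℝ)`,
singular homology with real coefficients (`⊤` if it is infinite). -/
def firstBetti (X : Type) [TopologicalSpace X] : ℕ∞ :=
  Cardinal.toENat (Module.rank ℝ
    (((AlgebraicTopology.singularHomologyFunctor (ModuleCat.{0} ℝ) 1).obj
      (ModuleCat.of ℝ ℝ)).obj (TopCat.of X)))

section Cones

variable {m : ℕ}

/-- The link `Σ = C ∩ S^{2m-1}` of a cone `C` in `ℂ^m`. -/
def link (C : Set (EuclideanSpace ℂ (Fin m))) : Set (EuclideanSpace ℂ (Fin m)) :=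
  C ∩ Metric.sphere 0 1

/-- The number of ends at infinity of a cone: the number of connected components of its link. -/
def numEnds (C : Set (EuclideanSpace ℂ (Fin m))) : ℕ∞ := (components (link C)).encard

/-- The Legendrian index of a cone in `ℂ^m`: the number of eigenvalues in `(0, 2m)` of the
Laplacian on the link, counted with multiplicity. -/
def legendrianIndex (C : Set (EuclideanSpace ℂ (Fin m))) : ℕ∞ :=
  ∑' c : Set.Ioo (0 : ℝ) (2 * m), multiplicity (link C) (c : ℝ)

/-- The subgroup of `SU(m)` of the elements which map the subset `S` of `ℂ^m` onto itself. -/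
def stabilizerSU (S : Set (EuclideanSpace ℂ (Fin m))) :
    Subgroup (Matrix.specialUnitaryGroup (Fin m) ℂ) where
  carrier := {g | Matrix.toEuclideanLin (g : Matrix (Fin m) (Fin m) ℂ) '' S = S}
  one_mem' := by simp
  mul_mem' := by
    intro g h hg hh
    have : ∀ x : EuclideanSpace ℂ (Fin m),
        Matrix.toEuclideanLin ((g * h : Matrix.specialUnitaryGroup (Fin m) ℂ) :
          Matrix (Fin m) (Fin m) ℂ) x =
        Matrix.toEuclideanLin (g : Matrix (Fin m) (Fin m) ℂ)
          (Matrix.toEuclideanLin (h : Matrix (Fin m) (Fin m) ℂ) x) := fun x => by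
      simp [Matrix.toLpLin_apply, Matrix.mulVec_mulVec]
    simp only [Set.mem_ofPred_eq] at *
    rw [Set.image_congr (fun x _ => this x), ← Set.image_image
      (fun x => Matrix.toEuclideanLin (g : Matrix (Fin m) (Fin m) ℂ) x), hh, hg]
  inv_mem' := by
    intro g hg
    have key : ∀ x : EuclideanSpace ℂ (Fin m),
        Matrix.toEuclideanLin ((g⁻¹ : Matrix.specialUnitaryGroup (Fin m) ℂ) :
          Matrix (Fin m) (Fin m) ℂ)
          (Matrix.toEuclideanLin (g : Matrix (Fin m) (Fin m) ℂ) x) = x := fun x => by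
      have h1 : ((g⁻¹ : Matrix.specialUnitaryGroup (Fin m) ℂ) : Matrix (Fin m) (Fin m) ℂ) *
          (g : Matrix (Fin m) (Fin m) ℂ) = 1 := by
        rw [← Submonoid.coe_mul, inv_mul_cancel, Submonoid.coe_one]
      simp [Matrix.toLpLin_apply, Matrix.mulVec_mulVec, h1]
    simp only [Set.mem_ofPred_eq] at *
    conv_lhs => rw [← hg]
    rw [Set.image_image, Set.image_congr (fun x _ => key x), Set.image_id']

/-- The dimension of a (closed) matrix group `G ⊆ GL(m, ℂ)` as a real Lie group: the dimension of
its Lie algebra `{X | exp (t X) ∈ G for all t ∈ ℝ}` (for a closed subgroup this set is already a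
real vector space). -/
def lieDim (G : Set (Matrix (Fin m) (Fin m) ℂ)) : ℕ :=
  Module.finrank ℝ (Submodule.span ℝ
    {X : Matrix (Fin m) (Fin m) ℂ | ∀ t : ℝ, NormedSpace.exp (t • X) ∈ G})

/-- The dimension of `SU(m)`. -/
def dimSU (m : ℕ) : ℕ :=
  lieDim (Matrix.specialUnitaryGroup (Fin m) ℂ : Set (Matrix (Fin m) (Fin m) ℂ))

/-- The dimension of the subgroup of `SU(m)` preserving `S`. -/
def dimStabilizerSU (S : Set (EuclideanSpace ℂ (Fin m))) : ℕ :=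
  lieDim ((fun g : Matrix.specialUnitaryGroup (Fin m) ℂ => (g : Matrix (Fin m) (Fin m) ℂ)) ''
    (stabilizerSU S : Set (Matrix.specialUnitaryGroup (Fin m) ℂ)))

/-- A cone `C` in `ℂ^m` is rigid if, for each connected component `Σ_j` of its link, the eigenspace
of the Laplacian on `Σ_j` with eigenvalue `2m` has dimension `dim SU(m) - dim G_j`, where `G_j` is
the subgroup of `SU(m)` preserving `Σ_j`. -/
def IsRigid (C : Set (EuclideanSpace ℂ (Fin m))) : Prop :=
  ∀ S ∈ components (link C),
    multiplicity S (2 * m : ℝ) + (dimStabilizerSU S : ℕ∞) = (dimSU m : ℕ∞)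

end Cones

section Lawlor

/-- The real `3`-plane `Π_φ = {(e^{iφ₁} x₁, e^{iφ₂} x₂, e^{iφ₃} x₃) : x_j ∈ ℝ}` in `ℂ^3`. -/
def slPlane (φ : Fin 3 → ℝ) : Set (EuclideanSpace ℂ (Fin 3)) :=
  {z | ∃ x : Fin 3 → ℝ, ∀ k, z k = Complex.exp (φ k * Complex.I) * x k}

/-- The cone `Π_0 ∪ Π_φ`, where `Π_0` is `ℝ^3 ⊆ ℂ^3`. -/
def planePair (φ : Fin 3 → ℝ) : Set (EuclideanSpace ℂ (Fin 3)) := slPlane 0 ∪ slPlane φ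

/-- `φ_k ∈ (0, π)` and `φ₁ + φ₂ + φ₃ = π`. -/
def IsAngleTriple (φ : Fin 3 → ℝ) : Prop :=
  (∀ k, φ k ∈ Set.Ioo 0 Real.pi) ∧ ∑ k, φ k = Real.pi

/-- The polynomial `p(x) = (1 + a₁x²)(1 + a₂x²)(1 + a₃x²) - 1`. -/
def lawlorp (a : Fin 3 → ℝ) (x : ℝ) : ℝ := ∏ k, (1 + a k * x ^ 2) - 1

/-- The polynomial `P(x) = p(x) / x²`. -/
def lawlorP (a : Fin 3 → ℝ) (x : ℝ) : ℝ :=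
  (a 0 + a 1 + a 2) + (a 0 * a 1 + a 1 * a 2 + a 2 * a 0) * x ^ 2 + a 0 * a 1 * a 2 * x ^ 4

theorem lawlorP_eq (a : Fin 3 → ℝ) {x : ℝ} (hx : x ≠ 0) :
    lawlorP a x = lawlorp a x / x ^ 2 := by
  rw [eq_div_iff (pow_ne_zero 2 hx)]
  simp only [lawlorP, lawlorp, Fin.prod_univ_three]
  ring

/-- The angle `φ_k = a_k ∫_{-∞}^∞ dx / ((1 + a_k x²) √P(x))`. -/
def lawlorAngle (a : Fin 3 → ℝ) (k : Fin 3) : ℝ :=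
  a k * ∫ x : ℝ, 1 / ((1 + a k * x ^ 2) * √(lawlorP a x))

/-- The constant `A = (4π/3) (a₁a₂a₃)^{-1/2}`. -/
def lawlorArea (a : Fin 3 → ℝ) : ℝ := 4 * Real.pi / 3 * (√(a 0 * a 1 * a 2))⁻¹

/-- The function `ψ_k(y) = a_k ∫_{-∞}^y dx / ((1 + a_k x²) √P(x))`. -/
def lawlorPsi (a : Fin 3 → ℝ) (k : Fin 3) (y : ℝ) : ℝ :=
  a k * ∫ x in Set.Iic y, 1 / ((1 + a k * x ^ 2) * √(lawlorP a x))

/-- The function `z_k(y) = e^{iψ_k(y)} √(a_k⁻¹ + y²)`. -/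
def lawlorZ (a : Fin 3 → ℝ) (k : Fin 3) (y : ℝ) : ℂ :=
  Complex.exp (lawlorPsi a k y * Complex.I) * (√((a k)⁻¹ + y ^ 2) : ℝ)

/-- Lawlor's neck `K_{φ,A}`, for `φ = lawlorAngle a` and `A = lawlorArea a`. -/
def lawlorNeck (a : Fin 3 → ℝ) : Set (EuclideanSpace ℂ (Fin 3)) :=
  {z | ∃ (y : ℝ) (x : Fin 3 → ℝ), ∑ k, x k ^ 2 = 1 ∧ ∀ k, z k = lawlorZ a k y * x k}

end Lawlor

end SLCone

end

/-! Each component of the link of the plane pair is the image of the unit sphere of ℝ³ under a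
linear isometry. Part (a) thus reduces to the spectrum and the stabilizer of one round sphere, plus
additivity of multiplicities over disjoint closed pieces (`multiplicity_union`).

Spectrum: a harmonic homogeneous polynomial of degree d restricts to an eigenfunction with
eigenvalue d(d+1) (`polyFun_mem_eigenspace`), which bounds multiplicities from below. For the upper
bound, extend an eigenfunction with eigenvalue c to a function U on ℝ³ minus the origin, homogeneous
of degree 0, and let M(q) be the integral of U times q(x/|x|) against a radial weight. Green's
identity gives (d(d+1) - c) M(q) = M(Δq) for q homogeneous of degree d (`sphereMoment_rec`). By
induction on the degree all moments vanish unless c = d(d+1) for some d; for c = 2 and c = 6 they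
vanish as soon as those against 3, respectively 5, explicit harmonic polynomials do. A function
without moments is zero by Stone–Weierstrass (`eq_zero_of_sphereMoment`).

Symmetry: conjugation by diag(e^{iφ_k}) carries SO(3) onto the stabilizer in SU(3) of the sphere in
Π_φ. The Lie algebras, found by differentiating one-parameter groups, have dimensions 3 and 8.

Part (b), angles and topology: since 1 + x²P(x) = ∏(1 + a_k x²), the integrands of the three angles
add up to the derivative of arctan(x√P(x)), so the angles add up to π. Each ψ_k takes values in (0,
π) and is strictly increasing, so the ratio Re/Im = cot ψ_k(y) of any non-real coordinate of a point
of the neck recovers y smoothly, and then x (`areDiffeomorphic_lawlorNeck`).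

Betti number: S² × ℝ is homeomorphic to ℝ³ minus the origin. There a closed singular 1-cochain with
values in any abelian group is exact (`exists_potential`): a path is cut into pieces lying in convex
sets that miss the origin, the pieces are straightened, and the resulting polygon is coned off from
a point in general position, which exists in dimension at least 3. Applied to a tautological
cochain, this gives H₁ = 0 (`isZero_singularHomology_one`). -/

open scoped ContDiff

set_option linter.unusedSectionVars false

noncomputable section

namespace SLCone

/-! ### Tangent spaces and tangential traces of isometrically embedded unit spheres. -/

section SphereGeometry

variable {V E : Type*} [NormedAddCommGroup V] [InnerProductSpace ℝ V] [FiniteDimensional ℝ V]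
  [NormedAddCommGroup E] [InnerProductSpace ℝ E] [FiniteDimensional ℝ E]

/-- The image of the unit sphere under a linear isometry. -/
def sphereImage (ι : V →ₗᵢ[ℝ] E) : Set E := ι '' Metric.sphere 0 1

/-- The adjoint of a linear isometry, i.e. the orthogonal projection onto its range. -/
def coproj (ι : V →ₗᵢ[ℝ] E) : E →L[ℝ] V := ContinuousLinearMap.adjoint ι.toContinuousLinearMap

theorem inner_coproj_left (ι : V →ₗᵢ[ℝ] E) (z : E) (v : V) :
    inner ℝ (coproj ι z) v = inner ℝ z (ι v) :=
  ContinuousLinearMap.adjoint_inner_left _ _ _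

theorem inner_coproj_right (ι : V →ₗᵢ[ℝ] E) (z : E) (v : V) :
    inner ℝ v (coproj ι z) = inner ℝ (ι v) z :=
  ContinuousLinearMap.adjoint_inner_right _ _ _

@[simp] theorem coproj_apply (ι : V →ₗᵢ[ℝ] E) (v : V) : coproj ι (ι v) = v := by
  refine ext_inner_right ℝ fun w => ?_
  rw [inner_coproj_left, ι.inner_map_map]

theorem mem_sphereImage {ι : V →ₗᵢ[ℝ] E} {z : E} :
    z ∈ sphereImage ι ↔ ∃ x : V, ‖x‖ = 1 ∧ ι x = z := by
  simp [sphereImage]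

theorem map_mem_sphereImage (ι : V →ₗᵢ[ℝ] E) {x : V} (hx : ‖x‖ = 1) : ι x ∈ sphereImage ι :=
  mem_sphereImage.2 ⟨x, hx, rfl⟩

/-- On the sphere the functions z - ι(ι*z) and ⟪z, z⟫ are constant, so their derivatives kill the
tangent cone; this forces tangent vectors into ι(x^⊥). Conversely, great circles through x realize
every unit vector of x^⊥. -/
theorem mem_tangentSpan_sphereImage (ι : V →ₗᵢ[ℝ] E) {x : V} (hx : ‖x‖ = 1) {v : E} :
    v ∈ tangentSpan (sphereImage ι) (ι x) ↔ ∃ w : V, inner ℝ x w = 0 ∧ ι w = v := by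
  constructor
  · have hle : tangentSpan (sphereImage ι) (ι x) ≤
        ((ℝ ∙ x)ᗮ).map ι.toLinearMap := by
      refine Submodule.span_le.2 fun y hy => ?_
      have h1 : HasFDerivWithinAt (fun z : E => z - ι (coproj ι z))
          (ContinuousLinearMap.id ℝ E - ι.toContinuousLinearMap.comp (coproj ι))
          (sphereImage ι) (ι x) :=
        ((ContinuousLinearMap.id ℝ E) -
          ι.toContinuousLinearMap.comp (coproj ι)).hasFDerivWithinAt
      have h1' : HasFDerivWithinAt (fun z : E => z - ι (coproj ι z)) (0 : E →L[ℝ] E)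
          (sphereImage ι) (ι x) := by
        refine (hasFDerivWithinAt_const (0 : E) (ι x) _).congr ?_ (by simp)
        rintro z hz
        obtain ⟨w, -, rfl⟩ := mem_sphereImage.1 hz
        simp
      have h2 : HasFDerivWithinAt (fun z : E => inner ℝ z z)
          ((innerSL ℝ (ι x)) + (innerSL ℝ (ι x))) (sphereImage ι) (ι x) := by
        have := ((hasFDerivAt_id (𝕜 := ℝ) (ι x)).inner ℝ (hasFDerivAt_id (ι x))).hasFDerivWithinAt
          (s := sphereImage ι)
        refine this.congr_fderiv ?_
        ext w
        simp [real_inner_comm]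
      have h2' : HasFDerivWithinAt (fun z : E => inner ℝ z z) (0 : E →L[ℝ] ℝ)
          (sphereImage ι) (ι x) := by
        refine (hasFDerivWithinAt_const (1 : ℝ) (ι x) _).congr ?_ (by simp [hx])
        rintro z hz
        obtain ⟨w, hw, rfl⟩ := mem_sphereImage.1 hz
        simp [hw]
      have e1 := h1.unique_on h1' hy
      have e2 := h2.unique_on h2' hy
      simp only [sub_apply, ContinuousLinearMap.id_apply,
        ContinuousLinearMap.comp_apply, zero_apply, sub_eq_zero,
        add_apply, innerSL_apply_apply] at e1 e2
      refine ⟨coproj ι y, ?_, e1.symm⟩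
      rw [SetLike.mem_coe, Submodule.mem_orthogonal_singleton_iff_inner_right, inner_coproj_right]
      linarith
    intro hv
    obtain ⟨w, hw, rfl⟩ := hle hv
    exact ⟨w, Submodule.mem_orthogonal_singleton_iff_inner_right.1 hw, rfl⟩
  · rintro ⟨w, hw, rfl⟩
    by_cases hw0 : w = 0
    · subst hw0; rw [map_zero]; exact Submodule.zero_mem _
    set r := ‖w‖ with hr
    have hr0 : r ≠ 0 := norm_ne_zero_iff.2 hw0
    suffices h : ι (r⁻¹ • w) ∈ tangentConeAt ℝ (sphereImage ι) (ι x) by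
      have := Submodule.smul_mem _ r (Submodule.subset_span (R := ℝ) h)
      rwa [map_smul, smul_smul, mul_inv_cancel₀ hr0, one_smul] at this
    have hc : HasDerivAt (fun t : ℝ => ι (Real.cos t • x + Real.sin t • r⁻¹ • w))
        (ι (r⁻¹ • w)) 0 := by
      have h0 := ((Real.hasDerivAt_cos 0).smul_const x).add
        ((Real.hasDerivAt_sin 0).smul_const (r⁻¹ • w))
      refine (ι.toContinuousLinearMap.hasFDerivAt.comp_hasDerivAt (0 : ℝ) h0).congr_deriv ?_
      simp
    have := (hc.hasFDerivAt.hasFDerivWithinAt (s := Set.univ)).mapsTo_tangent_cone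
      (show (1 : ℝ) ∈ tangentConeAt ℝ Set.univ (0 : ℝ) by simp)
    simp only [Real.cos_zero, one_smul, Real.sin_zero, zero_smul, add_zero] at this
    refine tangentConeAt_mono ?_ (by simpa using this)
    rintro _ ⟨t, -, rfl⟩
    suffices h : ‖Real.cos t • x + Real.sin t • r⁻¹ • w‖ = 1 by
      simpa using map_mem_sphereImage ι h
    have hsq : ‖Real.cos t • x + Real.sin t • r⁻¹ • w‖ ^ 2 = 1 := by
      rw [norm_add_sq_real, inner_smul_left, inner_smul_right, inner_smul_right, hw, norm_smul,
        norm_smul, norm_smul, hx, ← hr]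
      simp only [norm_inv, Real.norm_eq_abs, mul_pow, sq_abs, inv_pow, one_pow]
      field_simp
      linear_combination r * Real.cos_sq_add_sin_sq t
    have := norm_nonneg (Real.cos t • x + Real.sin t • r⁻¹ • w)
    nlinarith

/-- As a trace, the sum depends only on the operator v ↦ ∑ ⟪cᵢ, v⟫ cᵢ, so families indexed by
different types can be compared. -/
theorem sum_inner_eq_trace (A : E →L[ℝ] E) {J : Type*} [Fintype J] (c : J → E) :
    ∑ i, inner ℝ (A (c i)) (c i) =
      LinearMap.trace ℝ E (∑ i, (innerₛₗ ℝ (c i)).smulRight (A (c i))) := by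
  rw [map_sum]
  refine Finset.sum_congr rfl fun i _ => ?_
  rw [LinearMap.trace_smulRight, innerₛₗ_apply_apply, real_inner_comm]

/-- The projection onto the tangent space is the projection onto the range of ι minus the projection
onto the line through ι x. This replaces the unspecified orthonormal basis of the tangent space by a
chosen basis of V. -/
theorem tangentialTrace_sphereImage (ι : V →ₗᵢ[ℝ] E) {x : V} (hx : ‖x‖ = 1) (A : E →L[ℝ] E)
    {κ : Type*} [Fintype κ] (e : OrthonormalBasis κ ℝ V) :
    tangentialTrace (sphereImage ι) (ι x) A =
      ∑ k, inner ℝ (A (ι (e k))) (ι (e k)) - inner ℝ (A (ι x)) (ι x) := by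
  set T := tangentSpan (sphereImage ι) (ι x) with hT
  set b := stdOrthonormalBasis ℝ T
  have hproj : ∀ v : E, ∑ i, inner ℝ (b i : E) v • (b i : E) =
      ∑ k, inner ℝ (ι (e k)) v • ι (e k) - inner ℝ (ι x) v • ι x := by
    intro v
    have h1 : ∑ k, inner ℝ (ι (e k)) v • ι (e k) = ι (coproj ι v) := by
      conv_rhs => rw [← e.sum_repr' (coproj ι v)]
      simp [inner_coproj_right]
    set w := coproj ι v - inner ℝ (ι x) v • x with hw
    have hwT : ι w ∈ T := (mem_tangentSpan_sphereImage ι hx).2 ⟨w, by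
      simp [hw, inner_sub_right, inner_smul_right, inner_coproj_right, hx], rfl⟩
    have h2 : ι (coproj ι v) - inner ℝ (ι x) v • ι x = ι w := by simp [hw]
    rw [h1, h2]
    have h3 := b.sum_repr' ⟨ι w, hwT⟩
    have h4 := congrArg (fun t : T => (t : E)) h3
    simp only [Submodule.coe_sum, Submodule.coe_smul, Submodule.coe_inner] at h4
    rw [← h4]
    refine Finset.sum_congr rfl fun i _ => ?_
    congr 1
    obtain ⟨y, hy, hyb⟩ := (mem_tangentSpan_sphereImage ι hx).1 (b i).2
    rw [← hyb, hw]
    simp only [map_sub, map_smul, inner_sub_right, inner_smul_right, ι.inner_map_map]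
    rw [real_inner_comm, ← inner_coproj_left, real_inner_comm x y, hy, mul_zero, sub_zero,
      real_inner_comm]
  have hx' : inner ℝ (A (ι x)) (ι x) =
      LinearMap.trace ℝ E ((innerₛₗ ℝ (ι x)).smulRight (A (ι x))) := by
    rw [LinearMap.trace_smulRight, innerₛₗ_apply_apply, real_inner_comm]
  rw [tangentialTrace, sum_inner_eq_trace A (fun i => (b i : E)), hx',
    sum_inner_eq_trace A (fun k => ι (e k)), ← map_sub]
  congr 1
  ext v
  have := congrArg A (hproj v)
  simpa [LinearMap.sum_apply] using this

end SphereGeometry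

/-! ### Harmonic homogeneous polynomials restrict to eigenfunctions of the sphere. -/

section Polynomials

open MvPolynomial

theorem hasFDerivAt_eval (p : MvPolynomial (Fin 3) ℝ) (x : EuclideanSpace ℝ (Fin 3)) :
    HasFDerivAt (fun y : EuclideanSpace ℝ (Fin 3) => eval y p)
      (∑ i, eval x (pderiv i p) • (EuclideanSpace.proj i : EuclideanSpace ℝ (Fin 3) →L[ℝ] ℝ)) x := by
  induction p using MvPolynomial.induction_on with
  | C a => simpa using hasFDerivAt_const a x
  | add p q hp hq =>
    simp only [map_add]
    refine (hp.add hq).congr_fderiv ?_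
    rw [← Finset.sum_add_distrib]
    exact Finset.sum_congr rfl fun i _ => (add_smul _ _ _).symm
  | mul_X p j hp =>
    have hj : HasFDerivAt (fun y : EuclideanSpace ℝ (Fin 3) => y j)
        (EuclideanSpace.proj j : EuclideanSpace ℝ (Fin 3) →L[ℝ] ℝ) x :=
      (EuclideanSpace.proj j : EuclideanSpace ℝ (Fin 3) →L[ℝ] ℝ).hasFDerivAt
    simp only [map_mul, eval_X]
    refine (hp.mul hj).congr_fderiv ?_
    ext v
    simp only [add_apply, smul_apply, sum_apply, Derivation.leibniz, smul_eq_mul, pderiv_X,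
      Pi.single_apply, PiLp.proj_apply, map_add, map_mul, eval_X, add_mul,
      Finset.sum_add_distrib, Finset.mul_sum]
    congr 1
    · rw [Finset.sum_eq_single j] <;> simp +contextual [eq_comm]
    · exact Finset.sum_congr rfl fun i _ => by ring

theorem contDiff_eval (p : MvPolynomial (Fin 3) ℝ) :
    ContDiff ℝ ∞ (fun y : EuclideanSpace ℝ (Fin 3) => eval y p) := by
  induction p using MvPolynomial.induction_on with
  | C a => simpa using contDiff_const
  | add p q hp hq => simpa using hp.add hq
  | mul_X p j hp =>
    simpa using hp.mul (EuclideanSpace.proj j : EuclideanSpace ℝ (Fin 3) →L[ℝ] ℝ).contDiff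

/-- The gradient of a polynomial. -/
def polyGrad (p : MvPolynomial (Fin 3) ℝ) (x : EuclideanSpace ℝ (Fin 3)) :
    EuclideanSpace ℝ (Fin 3) :=
  WithLp.toLp 2 fun i => eval x (pderiv i p)

@[simp] theorem polyGrad_apply (p : MvPolynomial (Fin 3) ℝ) (x : EuclideanSpace ℝ (Fin 3))
    (i : Fin 3) : polyGrad p x i = eval x (pderiv i p) := rfl

/-- The Hessian of a polynomial. -/
def polyHess (p : MvPolynomial (Fin 3) ℝ) (x : EuclideanSpace ℝ (Fin 3)) :
    EuclideanSpace ℝ (Fin 3) →L[ℝ] EuclideanSpace ℝ (Fin 3) :=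
  ((EuclideanSpace.equiv (Fin 3) ℝ).symm : (Fin 3 → ℝ) →L[ℝ] EuclideanSpace ℝ (Fin 3)).comp
    (ContinuousLinearMap.pi fun i => ∑ j, eval x (pderiv j (pderiv i p)) •
      (EuclideanSpace.proj j : EuclideanSpace ℝ (Fin 3) →L[ℝ] ℝ))

@[simp] theorem polyHess_apply (p : MvPolynomial (Fin 3) ℝ) (x v : EuclideanSpace ℝ (Fin 3))
    (i : Fin 3) : polyHess p x v i = ∑ j, eval x (pderiv j (pderiv i p)) * v j := by
  simp [polyHess]

theorem hasFDerivAt_polyGrad (p : MvPolynomial (Fin 3) ℝ) (x : EuclideanSpace ℝ (Fin 3)) :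
    HasFDerivAt (polyGrad p) (polyHess p x) x := by
  refine ((EuclideanSpace.equiv (Fin 3) ℝ).symm : (Fin 3 → ℝ) →L[ℝ]
    EuclideanSpace ℝ (Fin 3)).hasFDerivAt.comp x (g := (EuclideanSpace.equiv (Fin 3) ℝ).symm)
    (f := fun y : EuclideanSpace ℝ (Fin 3) => fun i => eval y (pderiv i p)) ?_
  exact hasFDerivAt_pi.2 fun i => hasFDerivAt_eval _ _

/-- The Laplacian `∑ i, ∂ᵢ∂ᵢ` on polynomials. -/
def polyLaplacian : MvPolynomial (Fin 3) ℝ →ₗ[ℝ] MvPolynomial (Fin 3) ℝ :=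
  ∑ i, (pderiv i).toLinearMap ∘ₗ (pderiv i).toLinearMap

theorem polyLaplacian_apply (p : MvPolynomial (Fin 3) ℝ) :
    polyLaplacian p = ∑ i, pderiv i (pderiv i p) := by
  simp [polyLaplacian]

theorem euler_eval {p : MvPolynomial (Fin 3) ℝ} {d : ℕ} (hp : p.IsHomogeneous d)
    (x : Fin 3 → ℝ) : ∑ i, x i * eval x (pderiv i p) = d * eval x p := by
  have := congrArg (eval x) hp.sum_X_mul_pderiv
  simpa using this

theorem euler_eval₂ {p : MvPolynomial (Fin 3) ℝ} {d : ℕ} (hp : p.IsHomogeneous d)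
    (x : Fin 3 → ℝ) :
    ∑ i, x i * ∑ j, eval x (pderiv j (pderiv i p)) * x j = d * (d - 1) * eval x p := by
  have h1 : ∀ i, ∑ j, eval x (pderiv j (pderiv i p)) * x j = (d - 1 : ℕ) * eval x (pderiv i p) :=
    fun i => by
      rw [← euler_eval (hp.pderiv (i := i)) x]
      exact Finset.sum_congr rfl fun j _ => mul_comm _ _
  simp only [h1]
  have h2 : ∑ i, x i * (((d - 1 : ℕ) : ℝ) * eval x (pderiv i p)) =
      ((d - 1 : ℕ) : ℝ) * ∑ i, x i * eval x (pderiv i p) := by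
    rw [Finset.mul_sum]; exact Finset.sum_congr rfl fun i _ => by ring
  rw [h2, euler_eval hp]
  -- The subtraction d - 1 is truncated; for d = 0 the factor d makes both sides vanish.
  rcases d with _ | d
  · simp
  · push_cast [Nat.add_sub_cancel]; ring

variable {E : Type*} [NormedAddCommGroup E] [InnerProductSpace ℝ E] [FiniteDimensional ℝ E]

/-- The function on the image of the unit sphere induced by a polynomial. -/
def polyFun (ι : EuclideanSpace ℝ (Fin 3) →ₗᵢ[ℝ] E) :
    MvPolynomial (Fin 3) ℝ →ₗ[ℝ] (sphereImage ι → ℝ) where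
  toFun p z := eval (coproj ι z) p
  map_add' p q := by ext; simp
  map_smul' c p := by ext; simp

theorem polyFun_apply (ι : EuclideanSpace ℝ (Fin 3) →ₗᵢ[ℝ] E) (p : MvPolynomial (Fin 3) ℝ)
    (z : sphereImage ι) : polyFun ι p z = eval (coproj ι z) p := rfl

/-- By Euler's identity the radial part of ∇p on the unit sphere is d p x, so the tangential
gradient is ∇p - d p x. In its divergence the Hessian contributes Δp - d(d-1)p with Δp = 0, and the
second term contributes -2dp, since the tangent plane has dimension 2. The total is -d(d+1)p. -/
theorem polyFun_mem_eigenspace (ι : EuclideanSpace ℝ (Fin 3) →ₗᵢ[ℝ] E)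
    {p : MvPolynomial (Fin 3) ℝ} {d : ℕ} (hp : p.IsHomogeneous d) (h0 : polyLaplacian p = 0) :
    polyFun ι p ∈ eigenspace (sphereImage ι) (d * (d + 1)) := by
  refine ⟨fun z => eval (coproj ι z) p,
    fun z => ι (polyGrad p (coproj ι z) - ((d : ℝ) * eval (coproj ι z) p) • coproj ι z),
    fun x => rfl, ((contDiff_eval p).comp (coproj ι).contDiff).contDiffOn, ?_⟩
  rintro ⟨z, hz⟩
  obtain ⟨x, hx, rfl⟩ := mem_sphereImage.1 hz
  have hxx : ∑ i, x i * x i = 1 := by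
    have := EuclideanSpace.norm_sq_eq x
    rw [hx] at this
    simpa [sq] using this.symm
  have hpf : HasFDerivAt (fun z => eval (coproj ι z) p)
      ((∑ i, eval x (pderiv i p) • (EuclideanSpace.proj i :
        EuclideanSpace ℝ (Fin 3) →L[ℝ] ℝ)).comp (coproj ι)) (ι x) := by
    refine HasFDerivAt.comp (ι x) (g := fun y : EuclideanSpace ℝ (Fin 3) => eval y p) ?_
      (coproj ι).hasFDerivAt
    simpa using hasFDerivAt_eval p x
  have hG : HasFDerivAt (fun z => polyGrad p (coproj ι z)) ((polyHess p x).comp (coproj ι))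
      (ι x) := by
    refine HasFDerivAt.comp (ι x) (g := polyGrad p) ?_ (coproj ι).hasFDerivAt
    simpa using hasFDerivAt_polyGrad p x
  refine ⟨?_, ⟨_, hpf.hasFDerivWithinAt, ?_⟩, ?_⟩
  · refine (mem_tangentSpan_sphereImage ι hx).2 ⟨_, ?_, rfl⟩
    simp only [coproj_apply, inner_sub_right, inner_smul_right, real_inner_self_eq_norm_sq, hx]
    have := euler_eval hp x
    simp only [PiLp.inner_apply, RCLike.inner_apply, conj_trivial, polyGrad_apply]
    simp only [mul_comm (eval _ _) (x.ofLp _), this]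
    ring
  · rintro _ hv
    obtain ⟨w, hw, rfl⟩ := (mem_tangentSpan_sphereImage ι hx).1 hv
    simp only [ContinuousLinearMap.comp_apply, coproj_apply, ι.inner_map_map, inner_sub_left,
      inner_smul_left, hw]
    simp [PiLp.inner_apply, sum_apply, mul_comm]
  · refine ⟨_, (ι.toContinuousLinearMap.hasFDerivAt.comp (ι x)
      (hG.sub ((hpf.const_mul (d : ℝ)).smul (coproj ι).hasFDerivAt))).hasFDerivWithinAt, ?_⟩
    rw [tangentialTrace_sphereImage ι hx _ (EuclideanSpace.basisFun (Fin 3) ℝ)]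
    have e2 := euler_eval₂ hp x
    have e3 : ∑ i, eval x (pderiv i (pderiv i p)) = 0 := by
      have := congrArg (eval x) h0
      simpa [polyLaplacian_apply] using this
    simp only [Pi.smul_apply, polyFun_apply, coproj_apply, smul_eq_mul]
    simp only [ContinuousLinearMap.comp_apply, LinearIsometry.coe_toContinuousLinearMap,
      ι.inner_map_map, sub_apply, coproj_apply, add_apply, smul_apply, inner_sub_left,
      inner_add_left, inner_smul_left, ContinuousLinearMap.smulRight_apply]
    simp only [PiLp.inner_apply, RCLike.inner_apply, conj_trivial, polyHess_apply, sum_apply,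
      smul_apply, PiLp.proj_apply, smul_eq_mul, EuclideanSpace.basisFun_apply]
    simp only [Fin.sum_univ_three] at *
    simp
    linear_combination -e2 + (d * eval x p + d * (eval x (pderiv 0 p) * x 0 +
      eval x (pderiv 1 p) * x 1 + eval x (pderiv 2 p) * x 2)) * hxx + e3

end Polynomials

/-! ### Green's identity for degree-0 extensions of eigenfunctions. -/

section Green

open MvPolynomial MeasureTheory

/-- This is the divergence theorem on the box [-R, R]³, on whose faces W vanishes. Outside the box W
vanishes locally, hence so does D. -/
theorem integral_eq_zero_of_divergence {D : EuclideanSpace ℝ (Fin 3) → ℝ}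
    {W : EuclideanSpace ℝ (Fin 3) → EuclideanSpace ℝ (Fin 3)}
    (hW : ∀ x, ∃ W' : EuclideanSpace ℝ (Fin 3) →L[ℝ] EuclideanSpace ℝ (Fin 3),
      HasFDerivAt W W' x ∧ ∑ i, W' (EuclideanSpace.single i 1) i = D x)
    (hD : Continuous D) {R : ℝ} (hR : 0 ≤ R) (hsupp : ∀ x, R ≤ ‖x‖ → W x = 0) :
    ∫ x, D x = 0 := by
  choose W' hW' hdiv using hW
  rw [← (EuclideanSpace.volume_preserving_symm_measurableEquiv_toLp (Fin 3)).symm.integral_comp'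
    (g := D)]
  set T : (Fin 3 → ℝ) →L[ℝ] EuclideanSpace ℝ (Fin 3) :=
    ((EuclideanSpace.equiv (Fin 3) ℝ).symm : (Fin 3 → ℝ) →L[ℝ] EuclideanSpace ℝ (Fin 3)) with hT
  set T' : EuclideanSpace ℝ (Fin 3) →L[ℝ] (Fin 3 → ℝ) :=
    ((EuclideanSpace.equiv (Fin 3) ℝ) : EuclideanSpace ℝ (Fin 3) →L[ℝ] (Fin 3 → ℝ)) with hT'
  have hnorm : ∀ (x : Fin 3 → ℝ) (i : Fin 3), |x i| ≤ ‖T x‖ := fun x i => by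
    have := PiLp.norm_apply_le (T x) i
    simpa [hT] using this
  set F : (Fin 3 → ℝ) → (Fin 3 → ℝ) := fun x => T' (W (T x)) with hF
  have hFd : ∀ x, HasFDerivAt F (T'.comp ((W' (T x)).comp T)) x := fun x =>
    T'.hasFDerivAt.comp x ((hW' (T x)).comp x T.hasFDerivAt)
  have hdivF : ∀ x, ∑ i, (T'.comp ((W' (T x)).comp T)) (Pi.single i 1) i = D (T x) := fun x => by
    rw [← hdiv]; rfl
  have hF0 : ∀ x i, R ≤ |x i| → F x = 0 := fun x i h => by
    simp [hF, hsupp _ (h.trans (hnorm x i))]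
  have hD0 : ∀ x, x ∉ Set.Icc (fun _ : Fin 3 => -R) (fun _ => R) → D (T x) = 0 := by
    intro x hx
    obtain ⟨i, hi⟩ : ∃ i, R < |x i| := by
      by_contra! h
      exact hx ⟨fun i => (abs_le.1 (h i)).1, fun i => (abs_le.1 (h i)).2⟩
    have h1 : F =ᶠ[nhds x] fun _ => 0 := by
      have : ∀ᶠ y : Fin 3 → ℝ in nhds x, R < |y i| :=
        (continuous_abs.comp (continuous_apply i)).continuousAt.eventually_const_lt hi
      filter_upwards [this] with y hy using hF0 y i hy.le
    rw [← hdivF, (hFd x).unique ((hasFDerivAt_const (0 : Fin 3 → ℝ) x).congr_of_eventuallyEq h1)]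
    simp
  have hcont : Continuous fun x => D (T x) := hD.comp T.continuous
  have key := integral_divergence_of_hasFDerivAt_off_countable (n := 2)
    (fun _ => -R) (fun _ => R) (fun i => by simp only; linarith) F
    (fun x => T'.comp ((W' (T x)).comp T)) ∅ Set.countable_empty
    (fun x _ => (hFd x).continuousAt.continuousWithinAt) (fun x _ => hFd x)
    (by simp only [hdivF]; exact hcont.continuousOn.integrableOn_compact isCompact_Icc)
  simp only [hdivF] at key
  have h2 : ∫ x, D (T x) = 0 := by
    rw [← setIntegral_eq_integral_of_forall_compl_eq_zero hD0, key]
    refine Finset.sum_eq_zero fun i _ => ?_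
    rw [sub_eq_zero]
    refine integral_congr_ae (Filter.Eventually.of_forall fun x => ?_)
    simp only
    rw [hF0 (i.insertNth R x) i (by simp [le_abs_self]), hF0 (i.insertNth (-R) x) i (by
      simp [le_abs_self])]
  exact h2

/-- `U` is (the degree `0` homogeneous extension of) an eigenfunction on the unit sphere of `ℝ³`
with eigenvalue `c`, and `G` is its gradient. -/
structure IsRadialEigenfunction (c : ℝ) (U : EuclideanSpace ℝ (Fin 3) → ℝ)
    (G : EuclideanSpace ℝ (Fin 3) → EuclideanSpace ℝ (Fin 3)) : Prop where
  grad : ∀ x ≠ 0, HasFDerivAt U (innerSL ℝ (G x)) x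
  div : ∀ x ≠ 0, ∃ G' : EuclideanSpace ℝ (Fin 3) →L[ℝ] EuclideanSpace ℝ (Fin 3),
    HasFDerivAt G G' x ∧ ∑ i, G' (EuclideanSpace.single i 1) i = -c * (‖x‖ ^ 2)⁻¹ * U x
  orth : ∀ x ≠ 0, inner ℝ (G x) x = 0

theorem continuous_of_zero_near {f : EuclideanSpace ℝ (Fin 3) → ℝ}
    (h : ∀ x ≠ 0, ContinuousAt f x) (h0 : ∀ x, ‖x‖ ^ 2 ≤ 1 → f x = 0) : Continuous f := by
  refine continuous_iff_continuousAt.2 fun x => ?_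
  by_cases hx : x = 0
  · subst hx
    have : ∀ᶠ y : EuclideanSpace ℝ (Fin 3) in nhds 0, ‖y‖ ^ 2 < 1 :=
      ((continuous_norm.pow 2).continuousAt (x := (0 : EuclideanSpace ℝ (Fin 3)))).eventually_lt_const
        (by simp)
    exact (continuousAt_const (y := (0 : ℝ))).congr (this.mono fun y hy => (h0 y hy.le).symm)
  · exact h x hx

/-- Green's field g(q∇U - U∇q) has divergence containing the unwanted term -2g'dqU. The radial field
g|x|⁻² d q U x cancels it and turns the coefficient of |x|⁻² g q U into d(d+1) - c. -/
theorem green {c : ℝ} {U : EuclideanSpace ℝ (Fin 3) → ℝ}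
    {G : EuclideanSpace ℝ (Fin 3) → EuclideanSpace ℝ (Fin 3)} (h : IsRadialEigenfunction c U G)
    {q : MvPolynomial (Fin 3) ℝ} {d : ℕ} (hq : q.IsHomogeneous d) {g : ℝ → ℝ}
    (hg : Differentiable ℝ g) (hg1 : ∀ s ≤ 1, g s = 0) (hg5 : ∀ s, 5 ≤ s → g s = 0) :
    ∫ x : EuclideanSpace ℝ (Fin 3), g (‖x‖ ^ 2) * ((‖x‖ ^ 2)⁻¹ * (d * (d + 1) - c) *
      (eval x q * U x) - U x * eval x (polyLaplacian q)) = 0 := by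
  refine integral_eq_zero_of_divergence (R := 3) (W := fun x =>
    ((g (‖x‖ ^ 2) * eval x q) • G x - (g (‖x‖ ^ 2) * U x) • polyGrad q x) +
      ((g (‖x‖ ^ 2) * (‖x‖ ^ 2)⁻¹) * (d * (eval x q * U x))) • x) ?_ ?_ (by norm_num) ?_
  · intro x
    -- The cutoff vanishes for |x|² ≤ 1, so the singularity of U at the origin is harmless.
    by_cases hx : x = 0
    · subst hx
      have : ∀ᶠ y : EuclideanSpace ℝ (Fin 3) in nhds 0, ‖y‖ ^ 2 < 1 :=
        ((continuous_norm.pow 2).continuousAt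
          (x := (0 : EuclideanSpace ℝ (Fin 3)))).eventually_lt_const (by simp)
      refine ⟨0, (hasFDerivAt_const (0 : EuclideanSpace ℝ (Fin 3)) _).congr_of_eventuallyEq
        (this.mono fun y hy => ?_), ?_⟩
      · simp [hg1 _ hy.le]
      · simp [hg1]
    have hs0 : ‖x‖ ^ 2 ≠ 0 := pow_ne_zero 2 (norm_ne_zero_iff.2 hx)
    obtain ⟨G', hG', hdiv⟩ := h.div x hx
    have hs : HasFDerivAt (fun y : EuclideanSpace ℝ (Fin 3) => ‖y‖ ^ 2) (2 • innerSL ℝ x) x :=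
      (hasStrictFDerivAt_norm_sq x).hasFDerivAt
    have hgs := (hg (‖x‖ ^ 2)).hasDerivAt.comp_hasFDerivAt x hs
    have hinv := (hasDerivAt_inv hs0).comp_hasFDerivAt x hs
    have hqx := hasFDerivAt_eval q x
    have hUx := h.grad x hx
    refine ⟨_, (((hgs.mul hqx).smul hG').sub ((hgs.mul hUx).smul (hasFDerivAt_polyGrad q x))).add
      (((hgs.mul hinv).mul ((hqx.mul hUx).const_mul (d : ℝ))).smul (hasFDerivAt_id x)), ?_⟩
    have horth := h.orth x hx
    have e1 := euler_eval hq x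
    have hsq : ‖x‖ ^ 2 = ∑ i, x i ^ 2 := by
      rw [EuclideanSpace.norm_sq_eq]; simp
    have e3 : eval x (polyLaplacian q) = ∑ i, eval x (pderiv i (pderiv i q)) := by
      rw [polyLaplacian_apply, map_sum]
    rw [e3]
    simp only [PiLp.inner_apply, RCLike.inner_apply, conj_trivial] at horth
    simp only [add_apply, sub_apply, smul_apply, ContinuousLinearMap.smulRight_apply, sum_apply,
      PiLp.add_apply, PiLp.sub_apply, PiLp.smul_apply, smul_eq_mul, polyHess_apply,
      PiLp.proj_apply, innerSL_apply_apply, Function.comp_apply, PiLp.inner_apply,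
      RCLike.inner_apply, conj_trivial, ContinuousLinearMap.id_apply, polyGrad_apply]
    simp only [Fin.sum_univ_three] at *
    simp only [PiLp.single_apply, Fin.reduceEq, if_true, if_false, mul_one, mul_zero, zero_add,
      add_zero, nsmul_eq_mul, Nat.cast_ofNat, Pi.mul_apply, Function.comp_apply,
      smul_eq_mul, one_mul]
    generalize deriv g (‖x‖ ^ 2) = g' at *
    generalize g (‖x‖ ^ 2) = g₀ at *
    generalize ‖x‖ ^ 2 = s at *
    have hst : s * s⁻¹ = 1 := mul_inv_cancel₀ hs0
    rw [← inv_pow]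
    generalize s⁻¹ = t at *
    set Q := eval x q
    set u := U x
    simp [← inv_pow]
    linear_combination g₀ * Q * hdiv + (2 * g' * Q + g₀ * t * d * Q) * horth +
      (-2 * g' * u + g₀ * t * d * u) * e1 - d * Q * u * (-2 * g₀ * t ^ 2 + 2 * t * g') * hsq +
      d * Q * u * (-2 * g₀ * t + 2 * g') * hst
  · refine continuous_of_zero_near (fun x hx => ?_) fun x hx => by simp [hg1 _ hx]
    have hs0 : ‖x‖ ^ 2 ≠ 0 := pow_ne_zero 2 (norm_ne_zero_iff.2 hx)
    have hsc : ContinuousAt (fun y : EuclideanSpace ℝ (Fin 3) => ‖y‖ ^ 2) x :=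
      (continuous_norm.pow 2).continuousAt
    have hUc : ContinuousAt U x := (h.grad x hx).continuousAt
    have hqc : ∀ p : MvPolynomial (Fin 3) ℝ,
        ContinuousAt (fun y : EuclideanSpace ℝ (Fin 3) => eval y p) x :=
      fun p => (contDiff_eval p).continuous.continuousAt
    exact (hg.continuous.continuousAt.comp (f := fun y : EuclideanSpace ℝ (Fin 3) => ‖y‖ ^ 2)
      hsc).mul ((((hsc.inv₀ hs0).mul continuousAt_const).mul ((hqc q).mul hUc)).sub
        (hUc.mul (hqc _)))
  · intro x hx
    have : (5 : ℝ) ≤ ‖x‖ ^ 2 := by nlinarith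
    simp [hg5 _ this]

end Green

/-! ### Moments against polynomials, their recursion, and completeness. -/

section Moments

open MvPolynomial MeasureTheory

theorem eval_smul_of_isHomogeneous {p : MvPolynomial (Fin 3) ℝ} {d : ℕ} (hp : p.IsHomogeneous d)
    (r : ℝ) (x : EuclideanSpace ℝ (Fin 3)) : eval (r • x) p = r ^ d * eval x p := by
  rw [eval_eq', eval_eq', Finset.mul_sum]
  refine Finset.sum_congr rfl fun m hm => ?_
  have hd : ∑ i, m i = d := by
    have := hp (mem_support_iff.1 hm)
    rw [← this, Finsupp.weight_apply, Finsupp.sum_fintype] <;> simp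
  simp only [WithLp.ofLp_smul, Pi.smul_apply, smul_eq_mul, mul_pow, Finset.prod_mul_distrib,
    Finset.prod_pow_eq_pow_sum, hd]
  ring

theorem polyLaplacian_eq_zero {p : MvPolynomial (Fin 3) ℝ} {d : ℕ} (hp : p.IsHomogeneous d)
    (hd : d < 2) : polyLaplacian p = 0 := by
  rw [polyLaplacian_apply]
  refine Finset.sum_eq_zero fun i _ => ?_
  have h : (pderiv i p).IsHomogeneous 0 := by
    have := hp.pderiv (i := i)
    rwa [Nat.sub_eq_zero_of_le (by omega)] at this
  rw [totalDegree_eq_zero_iff_eq_C.1 (Nat.le_zero.1 h.totalDegree_le), pderiv_C]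

theorem isHomogeneous_polyLaplacian {p : MvPolynomial (Fin 3) ℝ} {d : ℕ}
    (hp : p.IsHomogeneous d) : (polyLaplacian p).IsHomogeneous (d - 1 - 1) := by
  rw [polyLaplacian_apply]
  exact IsHomogeneous.sum _ _ _ fun i _ => hp.pderiv.pderiv

/-- A bump function on the line, positive exactly on `(1, 5)`. -/
def radialBump : ContDiffBump (3 : ℝ) := ⟨1, 2, one_pos, one_lt_two⟩

theorem radialBump_eq_zero {s : ℝ} (hs : s ≤ 1 ∨ 5 ≤ s) : radialBump s = 0 := by
  refine radialBump.zero_of_le_dist ?_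
  rw [Real.dist_eq, le_abs]
  rcases hs with h | h
  · right; simp only [radialBump]; linarith
  · left; simp only [radialBump]; linarith

/-- The weighted integral of a function against the degree `0` homogeneous extension of a
polynomial on the unit sphere. -/
def sphereMoment (U : EuclideanSpace ℝ (Fin 3) → ℝ) (p : MvPolynomial (Fin 3) ℝ) : ℝ :=
  ∫ x : EuclideanSpace ℝ (Fin 3),
    radialBump (‖x‖ ^ 2) * (‖x‖ ^ 2)⁻¹ * (U x * eval (‖x‖⁻¹ • x) p)

theorem continuous_radial {f : EuclideanSpace ℝ (Fin 3) → ℝ} (hf : ∀ x ≠ 0, ContinuousAt f x) :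
    Continuous fun x : EuclideanSpace ℝ (Fin 3) =>
      radialBump (‖x‖ ^ 2) * (‖x‖ ^ 2)⁻¹ * f x := by
  refine continuous_of_zero_near (fun x hx => ?_) fun x hx => by
    rw [radialBump_eq_zero (Or.inl hx)]; simp
  have hs0 : ‖x‖ ^ 2 ≠ 0 := pow_ne_zero 2 (norm_ne_zero_iff.2 hx)
  have hsc : ContinuousAt (fun y : EuclideanSpace ℝ (Fin 3) => ‖y‖ ^ 2) x :=
    (continuous_norm.pow 2).continuousAt
  exact ((radialBump.continuous.continuousAt.comp
    (f := fun y : EuclideanSpace ℝ (Fin 3) => ‖y‖ ^ 2) hsc).mul (hsc.inv₀ hs0)).mul (hf x hx)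

theorem hasCompactSupport_radial (f : EuclideanSpace ℝ (Fin 3) → ℝ) :
    HasCompactSupport fun x : EuclideanSpace ℝ (Fin 3) =>
      radialBump (‖x‖ ^ 2) * (‖x‖ ^ 2)⁻¹ * f x := by
  refine HasCompactSupport.intro (isCompact_closedBall 0 3) fun x hx => ?_
  rw [Metric.mem_closedBall, dist_zero_right, not_le] at hx
  rw [radialBump_eq_zero (Or.inr (by nlinarith))]; simp

theorem integrable_radial {f : EuclideanSpace ℝ (Fin 3) → ℝ} (hf : ∀ x ≠ 0, ContinuousAt f x) :
    Integrable fun x : EuclideanSpace ℝ (Fin 3) =>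
      radialBump (‖x‖ ^ 2) * (‖x‖ ^ 2)⁻¹ * f x :=
  (continuous_radial hf).integrable_of_hasCompactSupport (hasCompactSupport_radial f)

theorem continuousAt_mul_eval {U : EuclideanSpace ℝ (Fin 3) → ℝ}
    (hU : ∀ x ≠ 0, ContinuousAt U x) (p : MvPolynomial (Fin 3) ℝ) :
    ∀ x ≠ 0, ContinuousAt (fun x => U x * eval (‖x‖⁻¹ • x) p) x := fun x hx =>
  (hU x hx).mul ((contDiff_eval p).continuous.continuousAt.comp
    (f := fun x : EuclideanSpace ℝ (Fin 3) => ‖x‖⁻¹ • x)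
    ((continuous_norm.continuousAt.inv₀ (norm_ne_zero_iff.2 hx)).smul continuousAt_id))

theorem sphereMoment_add {U : EuclideanSpace ℝ (Fin 3) → ℝ} (hU : ∀ x ≠ 0, ContinuousAt U x)
    (p q : MvPolynomial (Fin 3) ℝ) :
    sphereMoment U (p + q) = sphereMoment U p + sphereMoment U q := by
  rw [sphereMoment, sphereMoment, sphereMoment,
    ← integral_add (integrable_radial (continuousAt_mul_eval hU p))
      (integrable_radial (continuousAt_mul_eval hU q))]
  refine integral_congr_ae (Filter.Eventually.of_forall fun x => ?_)
  simp only [map_add]; ring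

theorem sphereMoment_smul (U : EuclideanSpace ℝ (Fin 3) → ℝ)
    (r : ℝ) (p : MvPolynomial (Fin 3) ℝ) :
    sphereMoment U (r • p) = r * sphereMoment U p := by
  rw [sphereMoment, sphereMoment, ← integral_const_mul]
  refine integral_congr_ae (Filter.Eventually.of_forall fun x => ?_)
  simp only [smul_eval]; ring

/-- Green's identity is used with a cutoff that includes the factor |x|^(-d): it turns q(x) into
q(x/|x|). Since Δq has degree d - 2, the same factor turns Δq(x) into |x|⁻² Δq(x/|x|), so both sides
carry the same radial weight. -/
theorem sphereMoment_rec {c : ℝ} {U : EuclideanSpace ℝ (Fin 3) → ℝ}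
    {G : EuclideanSpace ℝ (Fin 3) → EuclideanSpace ℝ (Fin 3)} (h : IsRadialEigenfunction c U G)
    {q : MvPolynomial (Fin 3) ℝ} {d : ℕ} (hq : q.IsHomogeneous d) :
    (d * (d + 1) - c) * sphereMoment U q = sphereMoment U (polyLaplacian q) := by
  have hU : ∀ x ≠ 0, ContinuousAt U x := fun x hx => (h.grad x hx).continuousAt
  have hg : Differentiable ℝ fun s : ℝ => radialBump s * ((√s)⁻¹) ^ d := by
    intro s
    rcases lt_or_ge s 1 with hs | hs
    · refine (differentiableAt_const (0 : ℝ)).congr_of_eventuallyEq ?_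
      filter_upwards [eventually_lt_nhds hs] with t ht
      rw [radialBump_eq_zero (Or.inl ht.le), zero_mul]
    · have hs0 : s ≠ 0 := by linarith
      exact ((radialBump.contDiff (n := 1)).differentiable (by simp) s).mul
        (((Real.hasDerivAt_sqrt hs0).differentiableAt.inv (Real.sqrt_ne_zero'.2 (by linarith))).pow d)
  have key := green h hq hg (fun s hs => by rw [radialBump_eq_zero (Or.inl hs), zero_mul])
    (fun s hs => by rw [radialBump_eq_zero (Or.inr hs), zero_mul])
  rw [← sub_eq_zero, sphereMoment, sphereMoment, ← integral_const_mul, ← integral_sub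
    ((integrable_radial (continuousAt_mul_eval hU q)).const_mul _)
    (integrable_radial (continuousAt_mul_eval hU _)), ← key]
  refine integral_congr_ae (Filter.Eventually.of_forall fun x => ?_)
  simp only [Real.sqrt_sq (norm_nonneg x)]
  by_cases hx : x = 0
  · subst hx; simp [radialBump_eq_zero]
  have hn : ‖x‖ ≠ 0 := norm_ne_zero_iff.2 hx
  have hlap : (‖x‖ ^ 2)⁻¹ * eval (‖x‖⁻¹ • x) (polyLaplacian q) =
      ‖x‖⁻¹ ^ d * eval x (polyLaplacian q) := by
    rcases lt_or_ge d 2 with hd | hd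
    · simp [polyLaplacian_eq_zero hq hd]
    · rw [eval_smul_of_isHomogeneous (isHomogeneous_polyLaplacian hq)]
      obtain ⟨e, rfl⟩ := Nat.exists_eq_add_of_le hd
      rw [show 2 + e - 1 - 1 = e by omega, pow_add, inv_pow]
      ring
  rw [eval_smul_of_isHomogeneous hq]
  linear_combination -radialBump (‖x‖ ^ 2) * U x * hlap

/-- The recursion determines the moments of degree d from those of degree d - 2 except in a resonant
degree d(d+1) = c. There `h0` takes over, and it may use that all lower moments vanish. -/
theorem sphereMoment_eq_zero {c : ℝ} {U : EuclideanSpace ℝ (Fin 3) → ℝ}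
    {G : EuclideanSpace ℝ (Fin 3) → EuclideanSpace ℝ (Fin 3)} (h : IsRadialEigenfunction c U G)
    (h0 : ∀ d : ℕ, (d * (d + 1) : ℝ) = c → ∀ q : MvPolynomial (Fin 3) ℝ, q.IsHomogeneous d →
      (∀ e < d, ∀ q' : MvPolynomial (Fin 3) ℝ, q'.IsHomogeneous e → sphereMoment U q' = 0) →
      sphereMoment U q = 0)
    (p : MvPolynomial (Fin 3) ℝ) : sphereMoment U p = 0 := by
  have hU : ∀ x ≠ 0, ContinuousAt U x := fun x hx => (h.grad x hx).continuousAt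
  have hhom : ∀ d : ℕ, ∀ q : MvPolynomial (Fin 3) ℝ, q.IsHomogeneous d →
      sphereMoment U q = 0 := by
    intro d
    induction d using Nat.strong_induction_on with
    | _ d ih =>
      intro q hq
      by_cases hc : (d * (d + 1) : ℝ) = c
      · exact h0 d hc q hq ih
      · have := sphereMoment_rec h hq
        have hz : sphereMoment U (polyLaplacian q) = 0 := by
          rcases lt_or_ge d 2 with hd | hd
          · rw [polyLaplacian_eq_zero hq hd]; simp [sphereMoment]
          · exact ih (d - 1 - 1) (by omega) _ (isHomogeneous_polyLaplacian hq)
        rw [hz] at this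
        exact (mul_eq_zero.1 this).resolve_left (sub_ne_zero.2 hc)
  rw [← sum_homogeneousComponent p]
  have hsum : ∀ s : Finset ℕ, sphereMoment U (∑ i ∈ s, homogeneousComponent i p) = 0 := by
    intro s
    induction s using Finset.induction_on with
    | empty => simp [sphereMoment]
    | insert a s ha ih =>
      rw [Finset.sum_insert ha, sphereMoment_add hU, ih,
        hhom a _ (homogeneousComponent_isHomogeneous a p), add_zero]
  exact hsum _

theorem exists_polynomial_near (f : C(Metric.sphere (0 : EuclideanSpace ℝ (Fin 3)) 1, ℝ)) {ε : ℝ}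
    (hε : 0 < ε) : ∃ p : MvPolynomial (Fin 3) ℝ,
      ∀ y : Metric.sphere (0 : EuclideanSpace ℝ (Fin 3)) 1,
        |eval (y : EuclideanSpace ℝ (Fin 3)) p - f y| < ε := by
  set X : Fin 3 → C(Metric.sphere (0 : EuclideanSpace ℝ (Fin 3)) 1, ℝ) := fun i =>
    ⟨fun y => (y : EuclideanSpace ℝ (Fin 3)) i, by fun_prop⟩
  have hev : ∀ (p : MvPolynomial (Fin 3) ℝ) (y : Metric.sphere (0 : EuclideanSpace ℝ (Fin 3)) 1),
      aeval X p y = eval (y : EuclideanSpace ℝ (Fin 3)) p := by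
    intro p y
    induction p using MvPolynomial.induction_on with
    | C a => simp [_root_.algebraMap_apply]
    | add p q hp hq => simp [hp, hq]
    | mul_X p i hp => rw [map_mul, map_mul, ContinuousMap.mul_apply, hp, aeval_X, eval_X]; rfl
  obtain ⟨⟨_, p, rfl⟩, hp⟩ :=
    ContinuousMap.exists_mem_subalgebra_near_continuousMap_of_separatesPoints
      (aeval (R := ℝ) X).range (by
        intro y z hyz
        obtain ⟨i, hi⟩ : ∃ i, (y : EuclideanSpace ℝ (Fin 3)) i ≠ (z : EuclideanSpace ℝ (Fin 3)) i := by
          by_contra! hne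
          exact hyz (Subtype.ext (PiLp.ext hne))
        exact ⟨X i, ⟨X i, ⟨MvPolynomial.X i, by simp⟩, rfl⟩, hi⟩) f ε hε
  refine ⟨p, fun y => ?_⟩
  rw [← hev]
  exact ((ContinuousMap.norm_coe_le_norm _ y).trans_lt hp)

/-- With p uniformly ε-close to U on the sphere, the weighted integral of U² equals that of U(U -
p), which is at most ε times the weighted integral of |U|. Hence U² has integral zero. -/
theorem eq_zero_of_sphereMoment {U : EuclideanSpace ℝ (Fin 3) → ℝ}
    (hU : ∀ x ≠ 0, ContinuousAt U x) (hrad : ∀ x ≠ 0, U x = U (‖x‖⁻¹ • x))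
    (h0 : ∀ p, sphereMoment U p = 0) {x : EuclideanSpace ℝ (Fin 3)} (hx : x ≠ 0) : U x = 0 := by
  have hUU : ∀ x ≠ 0, ContinuousAt (fun x => U x * U x) x := fun x hx => (hU x hx).mul (hU x hx)
  have hUa : ∀ x ≠ 0, ContinuousAt (fun x => |U x|) x := fun x hx => (hU x hx).abs
  have hwnn : ∀ y : EuclideanSpace ℝ (Fin 3), 0 ≤ radialBump (‖y‖ ^ 2) * (‖y‖ ^ 2)⁻¹ := fun y =>
    mul_nonneg radialBump.nonneg (by positivity)
  set M := ∫ y : EuclideanSpace ℝ (Fin 3), radialBump (‖y‖ ^ 2) * (‖y‖ ^ 2)⁻¹ * |U y|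
  set f : C(Metric.sphere (0 : EuclideanSpace ℝ (Fin 3)) 1, ℝ) := ⟨fun y => U y, by
    refine continuous_iff_continuousAt.2 fun y => ?_
    exact (hU y (ne_zero_of_mem_unit_sphere y)).comp continuous_subtype_val.continuousAt⟩
  have hle : ∀ ε > 0, ∫ y : EuclideanSpace ℝ (Fin 3),
      radialBump (‖y‖ ^ 2) * (‖y‖ ^ 2)⁻¹ * (U y * U y) ≤ ε * M := by
    intro ε hε
    obtain ⟨p, hp⟩ := exists_polynomial_near f hε
    rw [← sub_zero (∫ y : EuclideanSpace ℝ (Fin 3), _), ← h0 p, sphereMoment,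
      ← integral_sub (integrable_radial hUU) (integrable_radial (continuousAt_mul_eval hU p)),
      ← integral_const_mul]
    refine integral_mono ((integrable_radial hUU).sub
      (integrable_radial (continuousAt_mul_eval hU p))) ((integrable_radial hUa).const_mul ε)
      fun y => ?_
    by_cases hy : y = 0
    · subst hy; simp
    have hn : ‖‖y‖⁻¹ • y‖ = 1 := by
      rw [norm_smul, norm_inv, norm_norm, inv_mul_cancel₀ (norm_ne_zero_iff.2 hy)]
    have h1 := hp ⟨‖y‖⁻¹ • y, by simpa using hn⟩
    simp only [f, ContinuousMap.coe_mk] at h1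
    rw [← hrad y hy, abs_sub_comm] at h1
    have h2 : U y * (U y - eval (‖y‖⁻¹ • y) p) ≤ |U y| * ε :=
      (le_abs_self _).trans (by
        rw [abs_mul]; exact mul_le_mul_of_nonneg_left h1.le (abs_nonneg _))
    have h3 := mul_le_mul_of_nonneg_left h2 (hwnn y)
    simp only
    linarith
  have hzero : ∫ y : EuclideanSpace ℝ (Fin 3),
      radialBump (‖y‖ ^ 2) * (‖y‖ ^ 2)⁻¹ * (U y * U y) ≤ 0 := by
    by_contra! hpos
    -- With this ε the bound is less than the integral itself.
    have h1 := hle _ (div_pos hpos (show (0 : ℝ) < 2 * (|M| + 1) by positivity))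
    have h2 : M ≤ |M| := le_abs_self M
    rw [div_mul_eq_mul_div, le_div_iff₀ (by positivity)] at h1
    nlinarith [abs_nonneg M]
  by_contra hne
  -- On the ray through x, the point with |z|² = 3 sits at the centre of the bump, where the weight
  -- is positive.
  set z : EuclideanSpace ℝ (Fin 3) := (√3 * ‖x‖⁻¹) • x with hz
  have hxn : ‖x‖ ≠ 0 := norm_ne_zero_iff.2 hx
  have hzn : ‖z‖ = √3 := by
    rw [hz, norm_smul, norm_mul, norm_inv, norm_norm, mul_assoc, inv_mul_cancel₀ hxn, mul_one,
      Real.norm_of_nonneg (Real.sqrt_nonneg _)]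
  have hz3 : ‖z‖ ^ 2 = 3 := by rw [hzn]; norm_num
  have hz0 : z ≠ 0 := fun h => by rw [h] at hz3; norm_num at hz3
  have hUz : U z = U x := by
    rw [hrad z hz0, hrad x hx, hzn, hz, smul_smul, ← mul_assoc,
      inv_mul_cancel₀ (Real.sqrt_ne_zero'.2 (by norm_num)), one_mul]
  refine hzero.not_gt (Continuous.integral_pos_of_hasCompactSupport_nonneg_nonzero (x := z)
    (continuous_radial hUU) (hasCompactSupport_radial _)
    (fun y => mul_nonneg (hwnn y) (mul_self_nonneg _)) ?_)
  rw [hUz, hz3]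
  refine mul_ne_zero (mul_ne_zero (radialBump.pos_of_mem_ball ?_).ne' (by norm_num))
    (mul_ne_zero hne hne)
  simp [radialBump]

end Moments

/-! ### Extension of eigenfunctions to ℝ³ minus the origin. -/

section Eigenfunctions

open MvPolynomial MeasureTheory

variable {E : Type*} [NormedAddCommGroup E] [InnerProductSpace ℝ E] [FiniteDimensional ℝ E]
  (ι : EuclideanSpace ℝ (Fin 3) →ₗᵢ[ℝ] E)

open Classical in
/-- The degree `0` homogeneous extension to `ℝ³` of a function on an embedded unit sphere. -/
def sphereLift (u : sphereImage ι → ℝ) (x : EuclideanSpace ℝ (Fin 3)) : ℝ :=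
  if h : ‖‖x‖⁻¹ • x‖ = 1 then u ⟨ι (‖x‖⁻¹ • x), map_mem_sphereImage ι h⟩ else 0

theorem norm_inv_norm_smul {V : Type*} [NormedAddCommGroup V] [NormedSpace ℝ V] {x : V}
    (hx : x ≠ 0) : ‖‖x‖⁻¹ • x‖ = 1 := by
  rw [norm_smul, norm_inv, norm_norm, inv_mul_cancel₀ (norm_ne_zero_iff.2 hx)]

theorem sphereLift_of_ne_zero (u : sphereImage ι → ℝ) {x : EuclideanSpace ℝ (Fin 3)}
    (hx : x ≠ 0) : sphereLift ι u x =
      u ⟨ι (‖x‖⁻¹ • x), map_mem_sphereImage ι (norm_inv_norm_smul hx)⟩ :=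
  dif_pos (norm_inv_norm_smul hx)

theorem sphereLift_smul (u : sphereImage ι → ℝ) {x : EuclideanSpace ℝ (Fin 3)} (hx : x ≠ 0) :
    sphereLift ι u x = sphereLift ι u (‖x‖⁻¹ • x) := by
  have h : ‖x‖⁻¹ • x ≠ 0 := norm_ne_zero_iff.1 (by rw [norm_inv_norm_smul hx]; exact one_ne_zero)
  rw [sphereLift_of_ne_zero ι u hx, sphereLift_of_ne_zero ι u h]
  simp only [norm_inv_norm_smul hx, inv_one, one_smul]

theorem hasFDerivAt_normalize {x : EuclideanSpace ℝ (Fin 3)} (hx : x ≠ 0) :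
    HasFDerivAt (fun y : EuclideanSpace ℝ (Fin 3) => ‖y‖⁻¹ • y)
      (‖x‖⁻¹ • ContinuousLinearMap.id ℝ _ - (‖x‖⁻¹ ^ 3 • innerSL ℝ x).smulRight x) x := by
  have hs0 : ‖x‖ ^ 2 ≠ 0 := pow_ne_zero 2 (norm_ne_zero_iff.2 hx)
  have hn0 : ‖x‖ ≠ 0 := norm_ne_zero_iff.2 hx
  have hs : HasFDerivAt (fun y : EuclideanSpace ℝ (Fin 3) => ‖y‖ ^ 2) (2 • innerSL ℝ x) x :=
    (hasStrictFDerivAt_norm_sq x).hasFDerivAt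
  have h1 : HasDerivAt (fun t : ℝ => (√t)⁻¹) (-(1 / (2 * √(‖x‖ ^ 2))) / √(‖x‖ ^ 2) ^ 2) (‖x‖ ^ 2) :=
    (Real.hasDerivAt_sqrt hs0).fun_inv (by rwa [Real.sqrt_sq (norm_nonneg x)])
  have h2 := (h1.comp_hasFDerivAt x hs).smul (hasFDerivAt_id x)
  simp only [Real.sqrt_sq (norm_nonneg _)] at h2
  refine (h2.congr_of_eventuallyEq (Filter.Eventually.of_forall fun y => ?_)).congr_fderiv ?_
  · simp [Real.sqrt_sq (norm_nonneg y)]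
  · ext v i
    simp [Real.sqrt_sq (norm_nonneg x)]
    field_simp
    ring

theorem hasFDerivAt_inv_norm {x : EuclideanSpace ℝ (Fin 3)} (hx : x ≠ 0) :
    HasFDerivAt (fun y : EuclideanSpace ℝ (Fin 3) => ‖y‖⁻¹) (-(‖x‖⁻¹ ^ 3 • innerSL ℝ x)) x := by
  have hs0 : ‖x‖ ^ 2 ≠ 0 := pow_ne_zero 2 (norm_ne_zero_iff.2 hx)
  have hn0 : ‖x‖ ≠ 0 := norm_ne_zero_iff.2 hx
  have hs : HasFDerivAt (fun y : EuclideanSpace ℝ (Fin 3) => ‖y‖ ^ 2) (2 • innerSL ℝ x) x :=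
    (hasStrictFDerivAt_norm_sq x).hasFDerivAt
  have h1 : HasDerivAt (fun t : ℝ => (√t)⁻¹) (-(1 / (2 * √(‖x‖ ^ 2))) / √(‖x‖ ^ 2) ^ 2) (‖x‖ ^ 2) :=
    (Real.hasDerivAt_sqrt hs0).fun_inv (by rwa [Real.sqrt_sq (norm_nonneg x)])
  have h2 := h1.comp_hasFDerivAt x hs
  refine (h2.congr_of_eventuallyEq (Filter.Eventually.of_forall fun y => ?_)).congr_fderiv ?_
  · simp [Real.sqrt_sq (norm_nonneg y)]
  · ext v
    simp [Real.sqrt_sq (norm_nonneg x)]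
    field_simp

/-- The gradient of the extension at x is |x|⁻¹ times the tangential gradient at x/|x|, pulled back
to ℝ³; another factor |x|⁻¹ in the divergence comes from differentiating x/|x|. -/
theorem exists_isRadialEigenfunction {u : sphereImage ι → ℝ} {c : ℝ}
    (hu : u ∈ eigenspace (sphereImage ι) c) :
    ∃ G, IsRadialEigenfunction c (sphereLift ι u) G := by
  obtain ⟨f, X, hf, -, hX⟩ := hu
  set π : EuclideanSpace ℝ (Fin 3) → EuclideanSpace ℝ (Fin 3) := fun x => ‖x‖⁻¹ • x with hπ
  have hπn : ∀ x ≠ 0, ‖π x‖ = 1 := fun x hx => norm_inv_norm_smul hx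
  set dπ : EuclideanSpace ℝ (Fin 3) → EuclideanSpace ℝ (Fin 3) →L[ℝ] EuclideanSpace ℝ (Fin 3) :=
    fun x => ‖x‖⁻¹ • ContinuousLinearMap.id ℝ _ - (‖x‖⁻¹ ^ 3 • innerSL ℝ x).smulRight x with hdπ
  have hdπ_apply : ∀ x v, dπ x v = ‖x‖⁻¹ • (v - inner ℝ (π x) v • π x) := fun x v => by
    simp only [hdπ, hπ, sub_apply, smul_apply, ContinuousLinearMap.smulRight_apply,
      innerSL_apply_apply, ContinuousLinearMap.id_apply, inner_smul_left, smul_sub, smul_smul,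
      smul_eq_mul, RCLike.conj_to_real]
    congr 2
    ring
  have hXπ : ∀ x ≠ 0, inner ℝ (π x) (coproj ι (X (ι (π x)))) = 0 := fun x hx => by
    obtain ⟨w, hw, hwX⟩ := (mem_tangentSpan_sphereImage ι (hπn x hx)).1
      (hX ⟨_, map_mem_sphereImage ι (hπn x hx)⟩).1
    simp only at hwX
    rw [← hwX, coproj_apply, hw]
  have hcompl : ∀ x : EuclideanSpace ℝ (Fin 3), x ≠ 0 → ∀ᶠ y in nhds x, y ≠ 0 := fun x hx =>
    isOpen_ne.mem_nhds hx
  -- The data are differentiable only within the sphere, but x ↦ ι(x/|x|) sends a neighbourhood of x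
  -- into it, so the composites have genuine derivatives.
  have hcomp : ∀ {F : Type _} [NormedAddCommGroup F] [NormedSpace ℝ F] (k : E → F) (k' : E →L[ℝ] F)
      (x : EuclideanSpace ℝ (Fin 3)), x ≠ 0 →
      HasFDerivWithinAt k k' (sphereImage ι) (ι (π x)) →
      HasFDerivAt (fun y => k (ι (π y))) (k'.comp (ι.toContinuousLinearMap.comp (dπ x))) x := by
    intro F _ _ k k' x hx hk
    have h1 : HasFDerivWithinAt (fun y => ι (π y)) (ι.toContinuousLinearMap.comp (dπ x))
        {y | y ≠ 0} x :=
      ((ι.toContinuousLinearMap.hasFDerivAt (x := π x)).comp x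
        (hasFDerivAt_normalize hx)).hasFDerivWithinAt
    exact (HasFDerivWithinAt.comp x hk h1 fun y hy => map_mem_sphereImage ι (hπn y hy)).hasFDerivAt
      (hcompl x hx)
  refine ⟨fun x => ‖x‖⁻¹ • coproj ι (X (ι (π x))), fun x hx => ?_, fun x hx => ?_, fun x hx => ?_⟩
  · obtain ⟨-, ⟨f', hf', hf'X⟩, -⟩ := hX ⟨_, map_mem_sphereImage ι (hπn x hx)⟩
    refine ((hcomp f f' x hx hf').congr_of_eventuallyEq ((hcompl x hx).mono fun y hy => ?_)).congr_fderiv ?_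
    · rw [sphereLift_of_ne_zero ι u hy, ← hf]
    · refine ContinuousLinearMap.ext fun v => ?_
      have hv : inner ℝ (π x) (dπ x v) = 0 := by
        rw [hdπ_apply, inner_smul_right, inner_sub_right, inner_smul_right,
          real_inner_self_eq_norm_sq, hπn x hx]; simp
      have := hf'X (ι (dπ x v)) ((mem_tangentSpan_sphereImage ι (hπn x hx)).2 ⟨_, hv, rfl⟩)
      simp only [ContinuousLinearMap.comp_apply, LinearIsometry.coe_toContinuousLinearMap, this,
        innerSL_apply_apply, inner_smul_left, ← inner_coproj_left, RCLike.conj_to_real]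
      rw [hdπ_apply, inner_smul_right, inner_sub_right, inner_smul_right,
        real_inner_comm (π x) (coproj ι (X (ι (π x)))), hXπ x hx, mul_zero, sub_zero]
  · obtain ⟨-, -, X', hX', hw⟩ := hX ⟨_, map_mem_sphereImage ι (hπn x hx)⟩
    have h1 := hcomp (fun z => coproj ι (X z)) ((coproj ι).comp X') x hx
      ((coproj ι).hasFDerivAt.comp_hasFDerivWithinAt _ hX')
    refine ⟨_, (hasFDerivAt_inv_norm hx).smul h1, ?_⟩
    rw [tangentialTrace_sphereImage ι (hπn x hx) X' (EuclideanSpace.basisFun (Fin 3) ℝ)] at hw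
    rw [sphereLift_of_ne_zero ι u hx]
    have hw' : c * u ⟨ι (‖x‖⁻¹ • x), map_mem_sphereImage ι (norm_inv_norm_smul hx)⟩ = _ := hw
    have e0 : ∀ (z : EuclideanSpace ℝ (Fin 3)) (i : Fin 3),
        z i = inner ℝ (EuclideanSpace.basisFun (Fin 3) ℝ i) z := fun z i => by
      simp [EuclideanSpace.inner_single_left]
    have hsum : ∑ i, inner ℝ (π x) (EuclideanSpace.basisFun (Fin 3) ℝ i) •
        EuclideanSpace.basisFun (Fin 3) ℝ i = π x := by
      conv_rhs => rw [← (EuclideanSpace.basisFun (Fin 3) ℝ).sum_repr' (π x)]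
      exact Finset.sum_congr rfl fun i _ => by rw [real_inner_comm]
    have e1 : inner ℝ (X' (ι (π x))) (ι (π x)) = ∑ i,
        inner ℝ (π x) (EuclideanSpace.basisFun (Fin 3) ℝ i) *
          inner ℝ (X' (ι (π x))) (ι (EuclideanSpace.basisFun (Fin 3) ℝ i)) := by
      nth_rewrite 2 [← hsum]
      simp [map_sum, inner_sum, inner_smul_right]
    -- Differentiating the factor |x|⁻¹ gives a multiple of ⟪π x, X⟫, which vanishes by tangency.
    have e2 : ∑ i, inner ℝ (π x) (EuclideanSpace.basisFun (Fin 3) ℝ i) *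
        (coproj ι (X (ι (π x)))) i = 0 := by
      rw [← hXπ x hx]
      nth_rewrite 3 [← hsum]
      simp only [sum_inner, inner_smul_left, RCLike.conj_to_real]
      exact Finset.sum_congr rfl fun i _ => by rw [e0]
    have hterm : ∀ i, ((‖x‖⁻¹ • ((coproj ι).comp X').comp (ι.toContinuousLinearMap.comp (dπ x)) +
        (-(‖x‖⁻¹ ^ 3 • innerSL ℝ x)).smulRight (coproj ι (X (ι (π x)))))
        (EuclideanSpace.single i 1)) i =
        (‖x‖ ^ 2)⁻¹ * (inner ℝ (X' (ι (EuclideanSpace.basisFun (Fin 3) ℝ i)))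
          (ι (EuclideanSpace.basisFun (Fin 3) ℝ i)) -
          inner ℝ (π x) (EuclideanSpace.basisFun (Fin 3) ℝ i) *
          inner ℝ (X' (ι (π x))) (ι (EuclideanSpace.basisFun (Fin 3) ℝ i)) -
          inner ℝ (π x) (EuclideanSpace.basisFun (Fin 3) ℝ i) *
            (coproj ι (X (ι (π x)))) i) := by
      intro i
      have hxπ : inner ℝ x (EuclideanSpace.basisFun (Fin 3) ℝ i) =
          ‖x‖ * inner ℝ (π x) (EuclideanSpace.basisFun (Fin 3) ℝ i) := by
        rw [hπ, inner_smul_left, RCLike.conj_to_real, ← mul_assoc,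
          mul_inv_cancel₀ (norm_ne_zero_iff.2 hx), one_mul]
      rw [← EuclideanSpace.basisFun_apply]
      simp only [add_apply, smul_apply, ContinuousLinearMap.smulRight_apply, neg_apply,
        ContinuousLinearMap.comp_apply, LinearIsometry.coe_toContinuousLinearMap,
        innerSL_apply_apply, PiLp.add_apply, PiLp.smul_apply, smul_eq_mul, hdπ_apply, map_smul,
        map_sub, PiLp.sub_apply, hxπ]
      rw [e0 (coproj ι (X' (ι (EuclideanSpace.basisFun (Fin 3) ℝ i)))), inner_coproj_right,
        e0 (coproj ι (X' (ι (π x)))), inner_coproj_right,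
        real_inner_comm _ (ι (EuclideanSpace.basisFun (Fin 3) ℝ i)),
        real_inner_comm _ (ι (EuclideanSpace.basisFun (Fin 3) ℝ i))]
      have hn : ‖x‖ ≠ 0 := norm_ne_zero_iff.2 hx
      field_simp
      ring
    refine (Finset.sum_congr rfl fun i _ => hterm i).trans ?_
    rw [← Finset.mul_sum, Finset.sum_sub_distrib, Finset.sum_sub_distrib, ← e1, e2]
    linear_combination (‖x‖ ^ 2)⁻¹ * hw'
  · rw [inner_smul_left, real_inner_comm, show inner ℝ x (coproj ι (X (ι (π x)))) =
      ‖x‖ * inner ℝ (π x) (coproj ι (X (ι (π x)))) by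
        rw [hπ, inner_smul_left, RCLike.conj_to_real, ← mul_assoc,
          mul_inv_cancel₀ (norm_ne_zero_iff.2 hx), one_mul], hXπ x hx]
    simp

end Eigenfunctions

/-! ### The eigenvalues of the unit sphere below 6 and the multiplicities of 2 and 6. -/

section Multiplicities

open MvPolynomial MeasureTheory

variable {E : Type*} [NormedAddCommGroup E] [InnerProductSpace ℝ E] [FiniteDimensional ℝ E]
  (ι : EuclideanSpace ℝ (Fin 3) →ₗᵢ[ℝ] E)

theorem sphereLift_add (u v : sphereImage ι → ℝ) (x : EuclideanSpace ℝ (Fin 3)) :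
    sphereLift ι (u + v) x = sphereLift ι u x + sphereLift ι v x := by
  unfold sphereLift; split_ifs <;> simp

theorem sphereLift_const_smul (r : ℝ) (u : sphereImage ι → ℝ) (x : EuclideanSpace ℝ (Fin 3)) :
    sphereLift ι (r • u) x = r * sphereLift ι u x := by
  unfold sphereLift; split_ifs <;> simp

theorem continuousAt_sphereLift {c : ℝ} {u : sphereImage ι → ℝ}
    (hu : u ∈ eigenspace (sphereImage ι) c) :
    ∀ x ≠ 0, ContinuousAt (sphereLift ι u) x := fun x hx => by
  obtain ⟨G, hG⟩ := exists_isRadialEigenfunction ι hu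
  exact (hG.grad x hx).continuousAt

/-- The moments of eigenfunctions with eigenvalue `c` against a family of polynomials. -/
def momentMap (c : ℝ) {n : ℕ} (P : Fin n → MvPolynomial (Fin 3) ℝ) :
    eigenspace (sphereImage ι) c →ₗ[ℝ] (Fin n → ℝ) where
  toFun u k := sphereMoment (sphereLift ι u) (P k)
  map_add' u v := by
    ext k
    simp only [sphereMoment, Pi.add_apply]
    rw [← integral_add (integrable_radial (continuousAt_mul_eval (continuousAt_sphereLift ι u.2) _))
      (integrable_radial (continuousAt_mul_eval (continuousAt_sphereLift ι v.2) _))]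
    refine integral_congr_ae (Filter.Eventually.of_forall fun x => ?_)
    simp only [Submodule.coe_add, sphereLift_add]; ring
  map_smul' r u := by
    ext k
    simp only [sphereMoment, Pi.smul_apply, RingHom.id_apply, smul_eq_mul]
    rw [← integral_const_mul]
    refine integral_congr_ae (Filter.Eventually.of_forall fun x => ?_)
    simp only [Submodule.coe_smul, sphereLift_const_smul]; ring

theorem eigenfunction_eq_zero {c : ℝ} {u : sphereImage ι → ℝ}
    (hu : u ∈ eigenspace (sphereImage ι) c)
    (h0 : ∀ d : ℕ, (d * (d + 1) : ℝ) = c → ∀ q : MvPolynomial (Fin 3) ℝ, q.IsHomogeneous d →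
      (∀ e < d, ∀ q' : MvPolynomial (Fin 3) ℝ, q'.IsHomogeneous e →
        sphereMoment (sphereLift ι u) q' = 0) →
      sphereMoment (sphereLift ι u) q = 0) : u = 0 := by
  obtain ⟨G, hG⟩ := exists_isRadialEigenfunction ι hu
  funext ⟨z, hz⟩
  obtain ⟨x, hx, rfl⟩ := mem_sphereImage.1 hz
  have hx0 : x ≠ 0 := norm_ne_zero_iff.1 (by rw [hx]; exact one_ne_zero)
  have := eq_zero_of_sphereMoment (continuousAt_sphereLift ι hu)
    (fun x hx => sphereLift_smul ι u hx) (sphereMoment_eq_zero hG h0) hx0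
  rw [sphereLift_of_ne_zero ι u hx0] at this
  simpa [hx] using this

/-- The upper bound comes from the injective map sending u to its n moments, the lower bound from
the n independent eigenfunctions. -/
theorem rank_eigenspace {c : ℝ} {n : ℕ} (P : Fin n → MvPolynomial (Fin 3) ℝ)
    (hP : ∀ k, polyFun ι (P k) ∈ eigenspace (sphereImage ι) c)
    (hli : LinearIndependent ℝ fun k => polyFun ι (P k))
    (h0 : ∀ u ∈ eigenspace (sphereImage ι) c, (∀ k, sphereMoment (sphereLift ι u) (P k) = 0) →
      u = 0) : Module.rank ℝ (eigenspace (sphereImage ι) c) = n := by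
  refine le_antisymm ?_ ?_
  · have hinj : Function.Injective (momentMap ι c P) := by
      refine (injective_iff_map_eq_zero _).2 fun u hu => Subtype.ext (h0 u u.2 fun k => ?_)
      exact congrFun hu k
    simpa using LinearMap.lift_rank_le_of_injective _ hinj
  · have : LinearIndependent ℝ fun k => (⟨polyFun ι (P k), hP k⟩ : eigenspace (sphereImage ι) c) :=
      LinearIndependent.of_comp (eigenspace (sphereImage ι) c).subtype hli
    simpa using this.cardinal_lift_le_rank

theorem sphereMoment_sum_monomials {U : EuclideanSpace ℝ (Fin 3) → ℝ}
    (hU : ∀ x ≠ 0, ContinuousAt U x) {q : MvPolynomial (Fin 3) ℝ} {d : ℕ} (hq : q.IsHomogeneous d)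
    (h : ∀ i j k : ℕ, i + j + k = d → sphereMoment U (X 0 ^ i * X 1 ^ j * X 2 ^ k) = 0) :
    sphereMoment U q = 0 := by
  let L : MvPolynomial (Fin 3) ℝ →ₗ[ℝ] ℝ :=
    { toFun := sphereMoment U
      map_add' := sphereMoment_add hU
      map_smul' := sphereMoment_smul U }
  change L q = 0
  rw [q.as_sum, map_sum]
  refine Finset.sum_eq_zero fun m hm => ?_
  have hd : m 0 + m 1 + m 2 = d := by
    have := hq (mem_support_iff.1 hm)
    rw [← this, Finsupp.weight_apply, Finsupp.sum_fintype] <;> simp [Fin.sum_univ_three]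
  rw [monomial_eq, Finsupp.prod_fintype _ _ (by simp), Fin.prod_univ_three, C_mul', map_smul]
  rw [show L _ = 0 from h _ _ _ hd, smul_zero]

theorem eigenspace_eq_bot {c : ℝ} (hc : ∀ d : ℕ, (d * (d + 1) : ℝ) ≠ c) :
    eigenspace (sphereImage ι) c = ⊥ :=
  (Submodule.eq_bot_iff _).2 fun _ hu => eigenfunction_eq_zero ι hu fun d hd => absurd hd (hc d)

theorem nat_mul_succ_ne {c : ℝ} (hc : c ∈ Set.Ioo (0 : ℝ) 6) (h2 : c ≠ 2) (d : ℕ) :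
    (d * (d + 1) : ℝ) ≠ c := by
  rintro rfl
  rcases d with _ | _ | d
  · simp at hc
  · norm_num at h2
  · have := hc.2
    push_cast at this
    nlinarith [(Nat.cast_nonneg d : (0 : ℝ) ≤ d)]

theorem polyFun_mem_eigenspace_of_eq {p : MvPolynomial (Fin 3) ℝ} {c : ℝ} (d : ℕ)
    (hp : p.IsHomogeneous d) (h0 : polyLaplacian p = 0) (hc : (d * (d + 1) : ℝ) = c) :
    polyFun ι p ∈ eigenspace (sphereImage ι) c := by
  rw [← hc]; exact polyFun_mem_eigenspace ι hp h0

theorem polyFun_apply_map (p : MvPolynomial (Fin 3) ℝ) {x : EuclideanSpace ℝ (Fin 3)}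
    (hx : ‖x‖ = 1) : polyFun ι p ⟨ι x, map_mem_sphereImage ι hx⟩ = eval x p := by
  rw [polyFun_apply, coproj_apply]

theorem rank_eigenspace_two : Module.rank ℝ (eigenspace (sphereImage ι) 2) = 3 := by
  refine rank_eigenspace (n := 3) ι (fun k => X k) (fun k => ?_) ?_ fun u hu h => ?_
  · refine polyFun_mem_eigenspace_of_eq ι 1 (isHomogeneous_X _ _)
      (polyLaplacian_eq_zero (isHomogeneous_X _ _) one_lt_two) (by norm_num)
  · refine Fintype.linearIndependent_iff.2 fun g hg k => ?_
    have h1 : ‖EuclideanSpace.single k (1 : ℝ)‖ = 1 := by simp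
    have := congrFun hg ⟨_, map_mem_sphereImage ι h1⟩
    simpa [Finset.sum_apply, polyFun_apply_map, Pi.single_apply] using this
  · refine eigenfunction_eq_zero ι hu fun d hd q hq _ => ?_
    have hd1 : d = 1 := by
      have : d * (d + 1) = 2 := by exact_mod_cast hd
      nlinarith
    subst hd1
    refine sphereMoment_sum_monomials (continuousAt_sphereLift ι hu) hq fun i j k hijk => ?_
    obtain ⟨rfl, rfl, rfl⟩ | ⟨rfl, rfl, rfl⟩ | ⟨rfl, rfl, rfl⟩ :
        (i = 1 ∧ j = 0 ∧ k = 0) ∨ (i = 0 ∧ j = 1 ∧ k = 0) ∨ (i = 0 ∧ j = 0 ∧ k = 1) := by omega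
    · simpa using h 0
    · simpa using h 1
    · simpa using h 2

/-- The moment sees polynomials only through their values on the unit sphere. In degree 2 this
supplies the one relation not covered by the five harmonic polynomials. -/
theorem sphereMoment_sum_sq (U : EuclideanSpace ℝ (Fin 3) → ℝ) :
    sphereMoment U (X 0 ^ 2 + X 1 ^ 2 + X 2 ^ 2) = sphereMoment U 1 := by
  refine integral_congr_ae (Filter.Eventually.of_forall fun x => ?_)
  simp only
  by_cases hx : x = 0
  · subst hx; simp
  have h := EuclideanSpace.norm_sq_eq (‖x‖⁻¹ • x)
  rw [norm_inv_norm_smul hx, Fin.sum_univ_three] at h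
  congr 2
  simpa [mul_pow] using h.symm

/-- A basis of the harmonic homogeneous polynomials of degree `2`. -/
def quadraticHarmonics : Fin 5 → MvPolynomial (Fin 3) ℝ :=
  ![X 0 * X 1, X 1 * X 2, X 0 * X 2, X 0 ^ 2 - X 1 ^ 2, X 1 ^ 2 - X 2 ^ 2]

theorem isHomogeneous_quadraticHarmonics (k : Fin 5) :
    (quadraticHarmonics k).IsHomogeneous 2 := by
  have h1 : ∀ i j : Fin 3, (X i * X j : MvPolynomial (Fin 3) ℝ).IsHomogeneous 2 := fun i j =>
    (isHomogeneous_X _ i).mul (isHomogeneous_X _ j)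
  have h2 : ∀ i : Fin 3, (X i ^ 2 : MvPolynomial (Fin 3) ℝ).IsHomogeneous 2 := fun i => by
    rw [sq]; exact h1 i i
  fin_cases k
  · exact h1 0 1
  · exact h1 1 2
  · exact h1 0 2
  · exact (h2 0).sub (h2 1)
  · exact (h2 1).sub (h2 2)

theorem polyLaplacian_quadraticHarmonics (k : Fin 5) :
    polyLaplacian (quadraticHarmonics k) = 0 := by
  rw [polyLaplacian_apply]
  fin_cases k <;>
    simp [quadraticHarmonics, Fin.sum_univ_three, pderiv_X, Pi.single_apply, sq]

theorem rank_eigenspace_six : Module.rank ℝ (eigenspace (sphereImage ι) 6) = 5 := by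
  refine rank_eigenspace (n := 5) ι quadraticHarmonics (fun k => ?_) ?_ fun u hu h => ?_
  · exact polyFun_mem_eigenspace_of_eq ι 2 (isHomogeneous_quadraticHarmonics k)
      (polyLaplacian_quadraticHarmonics k) (by norm_num)
  · refine Fintype.linearIndependent_iff.2 fun g hg => ?_
    have key : ∀ x : EuclideanSpace ℝ (Fin 3), ‖x‖ = 1 →
        g 0 * (x 0 * x 1) + g 1 * (x 1 * x 2) + g 2 * (x 0 * x 2) + g 3 * (x 0 ^ 2 - x 1 ^ 2) +
          g 4 * (x 1 ^ 2 - x 2 ^ 2) = 0 := fun x hx => by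
      have := congrFun hg ⟨_, map_mem_sphereImage ι hx⟩
      simpa [Finset.sum_apply, polyFun_apply_map ι _ hx, Fin.sum_univ_five, quadraticHarmonics] using this
    have key' : ∀ a b c : ℝ, a ^ 2 + b ^ 2 + c ^ 2 = 1 →
        g 0 * (a * b) + g 1 * (b * c) + g 2 * (a * c) + g 3 * (a ^ 2 - b ^ 2) +
          g 4 * (b ^ 2 - c ^ 2) = 0 := fun a b c habc => by
      have := key !₂[a, b, c] (by
        rw [EuclideanSpace.norm_eq]; simp [Fin.sum_univ_three, habc])
      simpa using this
    -- Two coordinate vectors isolate the square coefficients; rational points from the triple 3, 4,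
    -- 5 then isolate the mixed ones.
    have h3 := key' 1 0 0 (by norm_num)
    have h4 := key' 0 0 1 (by norm_num)
    have h0 := key' (3 / 5) (4 / 5) 0 (by norm_num)
    have h1 := key' 0 (3 / 5) (4 / 5) (by norm_num)
    have h2 := key' (3 / 5) 0 (4 / 5) (by norm_num)
    intro k
    fin_cases k <;> simp only [Fin.reduceFinMk] <;> linarith
  · refine eigenfunction_eq_zero ι hu fun d hd q hq hlow => ?_
    have hd2 : d = 2 := by
      have : d * (d + 1) = 6 := by exact_mod_cast hd
      nlinarith
    subst hd2
    have hU := continuousAt_sphereLift ι hu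
    have hsub : ∀ a b, sphereMoment (sphereLift ι u) (a - b) =
        sphereMoment (sphereLift ι u) a - sphereMoment (sphereLift ι u) b := fun a b => by
      rw [sub_eq_add_neg, sphereMoment_add hU, ← neg_one_smul ℝ, sphereMoment_smul]; ring
    have h01 : sphereMoment (sphereLift ι u) (X 0 * X 1) = 0 := h 0
    have h12 : sphereMoment (sphereLift ι u) (X 1 * X 2) = 0 := h 1
    have h02 : sphereMoment (sphereLift ι u) (X 0 * X 2) = 0 := h 2
    have hs1 : sphereMoment (sphereLift ι u) (X 0 ^ 2 - X 1 ^ 2) = 0 := h 3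
    have hs2 : sphereMoment (sphereLift ι u) (X 1 ^ 2 - X 2 ^ 2) = 0 := h 4
    have hs := sphereMoment_sum_sq (sphereLift ι u)
    -- The degree-0 moment vanishes, so the moments of the three squares add up to zero; as they are
    -- all equal, each vanishes.
    rw [hlow 0 two_pos 1 (isHomogeneous_one _ _), sphereMoment_add hU, sphereMoment_add hU] at hs
    rw [hsub] at hs1 hs2
    refine sphereMoment_sum_monomials hU hq fun i j k hijk => ?_
    obtain ⟨rfl, rfl, rfl⟩ | ⟨rfl, rfl, rfl⟩ | ⟨rfl, rfl, rfl⟩ | ⟨rfl, rfl, rfl⟩ |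
        ⟨rfl, rfl, rfl⟩ | ⟨rfl, rfl, rfl⟩ :
        (i = 1 ∧ j = 1 ∧ k = 0) ∨ (i = 0 ∧ j = 1 ∧ k = 1) ∨ (i = 1 ∧ j = 0 ∧ k = 1) ∨
        (i = 2 ∧ j = 0 ∧ k = 0) ∨ (i = 0 ∧ j = 2 ∧ k = 0) ∨ (i = 0 ∧ j = 0 ∧ k = 2) := by omega
    all_goals simp only [pow_one, pow_zero, one_mul, mul_one]
    all_goals first | assumption | linarith

theorem multiplicity_two : multiplicity (sphereImage ι) 2 = 3 := by
  rw [multiplicity, rank_eigenspace_two]; simp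

theorem multiplicity_six : multiplicity (sphereImage ι) 6 = 5 := by
  rw [multiplicity, rank_eigenspace_six]; simp

theorem isEigenvalue_iff {c : ℝ} (hc : c ∈ Set.Ioo (0 : ℝ) 6) :
    IsEigenvalue (sphereImage ι) c ↔ c = 2 := by
  constructor
  · intro h
    by_contra h2
    exact h (eigenspace_eq_bot ι (nat_mul_succ_ne hc h2))
  · rintro rfl h
    have := rank_eigenspace_two ι
    rw [h, rank_bot] at this
    norm_num at this

end Multiplicities

/-! ### Locality of the Laplacian; eigenspaces and components of a disjoint union. -/

section Union

variable {E : Type*} [NormedAddCommGroup E] [InnerProductSpace ℝ E] [FiniteDimensional ℝ E]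

theorem tangentialTrace_congr {S T : Set E} {x : E} (h : tangentSpan S x = tangentSpan T x)
    (A : E →L[ℝ] E) : tangentialTrace S x A = tangentialTrace T x A := by
  have key : ∀ P Q : Submodule ℝ E, P = Q →
      ∑ i, inner ℝ (A (stdOrthonormalBasis ℝ P i : E)) (stdOrthonormalBasis ℝ P i : E) =
        ∑ i, inner ℝ (A (stdOrthonormalBasis ℝ Q i : E)) (stdOrthonormalBasis ℝ Q i : E) := by
    rintro P _ rfl; rfl
  exact key _ _ h

/-- The conditions on `f` and `X` at a point `x` in the definition of `IsLaplacian`. -/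
def LaplacianDataAt (S : Set E) (f : E → ℝ) (X : E → E) (x : E) (c : ℝ) : Prop :=
  ContDiffWithinAt ℝ ∞ f S x ∧ X x ∈ tangentSpan S x ∧
    (∃ f' : E →L[ℝ] ℝ, HasFDerivWithinAt f f' S x ∧
      ∀ v ∈ tangentSpan S x, f' v = inner ℝ (X x) v) ∧
    (∃ X' : E →L[ℝ] E, HasFDerivWithinAt X X' S x ∧ c = - tangentialTrace S x X')

/-- Tangent cones and derivatives within a set depend only on its germ at x, which makes it possible
to glue and restrict Laplacian data. -/
theorem LaplacianDataAt.congr {S T : Set E} {f g : E → ℝ} {X Y : E → E} {x : E} {c : ℝ}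
    (h : LaplacianDataAt S f X x c) (hxS : x ∈ S) (hn : nhdsWithin x T = nhdsWithin x S)
    (hfg : Set.EqOn g f S) (hXY : Set.EqOn Y X S) : LaplacianDataAt T g Y x c := by
  obtain ⟨h0, h1, ⟨f', h2, h3⟩, ⟨X', h4, h5⟩⟩ := h
  have ht : tangentSpan T x = tangentSpan S x := by
    rw [tangentSpan, tangentSpan, tangentConeAt_congr hn]
  have hmem : S ∈ nhdsWithin x T := by rw [hn]; exact self_mem_nhdsWithin
  refine ⟨(h0.congr (fun y hy => hfg hy) (hfg hxS)).mono_of_mem_nhdsWithin hmem, ?_,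
    ⟨f', (h2.congr (fun y hy => hfg hy) (hfg hxS)).mono_of_mem_nhdsWithin hmem, fun v hv => ?_⟩,
    ⟨X', (h4.congr (fun y hy => hXY hy) (hXY hxS)).mono_of_mem_nhdsWithin hmem, ?_⟩⟩
  · rw [ht, hXY hxS]; exact h1
  · rw [hXY hxS]; exact h3 v (ht ▸ hv)
  · rw [tangentialTrace_congr ht]; exact h5

theorem isLaplacian_iff {S : Set E} {u w : S → ℝ} : IsLaplacian S u w ↔
    ∃ (f : E → ℝ) (X : E → E), (∀ x : S, f x = u x) ∧ ∀ x : S, LaplacianDataAt S f X x (w x) := by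
  refine exists_congr fun f => exists_congr fun X => and_congr_right fun _ => ?_
  exact ⟨fun h x => ⟨h.1 x x.2, h.2 x⟩, fun h => ⟨fun x hx => (h ⟨x, hx⟩).1, fun x => (h x).2⟩⟩

theorem nhdsWithin_union_of_notMem {S T : Set E} (hT : IsClosed T) {x : E} (hx : x ∉ T) :
    nhdsWithin x (S ∪ T) = nhdsWithin x S := by
  rw [nhdsWithin_union, show nhdsWithin x T = ⊥ from notMem_closure_iff_nhdsWithin_eq_bot.1
    (by rwa [hT.closure_eq]), sup_bot_eq]

theorem IsLaplacian.restrict {S T : Set E} (hST : S ⊆ T)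
    (hn : ∀ x ∈ S, nhdsWithin x T = nhdsWithin x S) {u w : T → ℝ} (h : IsLaplacian T u w) :
    IsLaplacian S (u ∘ Set.inclusion hST) (w ∘ Set.inclusion hST) := by
  obtain ⟨f, X, hf, hX⟩ := isLaplacian_iff.1 h
  refine isLaplacian_iff.2 ⟨f, X, fun x => hf ⟨x, hST x.2⟩, fun x => ?_⟩
  obtain ⟨h0, h1, ⟨f', h2, h3⟩, ⟨X', h4, h5⟩⟩ := hX ⟨x, hST x.2⟩
  have ht : tangentSpan T (x : E) = tangentSpan S (x : E) := by
    rw [tangentSpan, tangentSpan, tangentConeAt_congr (hn x x.2)]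
  exact ⟨h0.mono hST, ht ▸ h1, ⟨f', h2.mono hST, fun v hv => h3 v (ht ▸ hv)⟩,
    ⟨X', h4.mono hST, h5.trans (by rw [tangentialTrace_congr ht])⟩⟩

open Classical in
theorem isLaplacian_union {S T : Set E} (hS : IsClosed S) (hT : IsClosed T) (hd : Disjoint S T)
    {u w : ↥(S ∪ T) → ℝ}
    (h : IsLaplacian S (u ∘ Set.inclusion Set.subset_union_left)
      (w ∘ Set.inclusion Set.subset_union_left))
    (k : IsLaplacian T (u ∘ Set.inclusion Set.subset_union_right)
      (w ∘ Set.inclusion Set.subset_union_right)) :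
    IsLaplacian (S ∪ T) u w := by
  obtain ⟨f, X, hf, hX⟩ := isLaplacian_iff.1 h
  obtain ⟨g, Y, hg, hY⟩ := isLaplacian_iff.1 k
  refine isLaplacian_iff.2
    ⟨fun z => if z ∈ S then f z else g z, fun z => if z ∈ S then X z else Y z, ?_, ?_⟩
  · rintro ⟨x, hx | hx⟩
    · simpa [hx] using hf ⟨x, hx⟩
    · simpa [Set.disjoint_right.1 hd hx] using hg ⟨x, hx⟩
  · rintro ⟨x, hx | hx⟩
    · exact (hX ⟨x, hx⟩).congr hx (nhdsWithin_union_of_notMem hT (Set.disjoint_left.1 hd hx))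
        (fun z hz => if_pos hz) fun z hz => if_pos hz
    · exact (hY ⟨x, hx⟩).congr hx (by
        rw [Set.union_comm]; exact nhdsWithin_union_of_notMem hS (Set.disjoint_right.1 hd hx))
        (fun z hz => if_neg (Set.disjoint_right.1 hd hz))
        fun z hz => if_neg (Set.disjoint_right.1 hd hz)

/-- Restriction of eigenfunctions to the two parts of a disjoint union. -/
def restrictEigenspace {S T : Set E} (hS : IsClosed S) (hT : IsClosed T) (hd : Disjoint S T)
    (c : ℝ) : eigenspace (S ∪ T) c →ₗ[ℝ] eigenspace S c × eigenspace T c where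
  toFun u := (⟨u.1 ∘ Set.inclusion Set.subset_union_left, u.2.restrict Set.subset_union_left
      fun _ hx => nhdsWithin_union_of_notMem hT (Set.disjoint_left.1 hd hx)⟩,
    ⟨u.1 ∘ Set.inclusion Set.subset_union_right, u.2.restrict Set.subset_union_right
      fun _ hx => by
        rw [Set.union_comm]
        exact nhdsWithin_union_of_notMem hS (Set.disjoint_right.1 hd hx)⟩)
  map_add' _ _ := rfl
  map_smul' _ _ := rfl

open Classical in
-- Since the two pieces are closed and disjoint, eigenfunctions on the union are arbitrary pairs of
-- eigenfunctions on the pieces.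
theorem multiplicity_union {S T : Set E} (hS : IsClosed S) (hT : IsClosed T) (hd : Disjoint S T)
    (c : ℝ) : multiplicity (S ∪ T) c = multiplicity S c + multiplicity T c := by
  have hbij : Function.Bijective (restrictEigenspace hS hT hd c) := by
    constructor
    · intro u v huv
      have h1 := congrArg (fun p => (p.1 : S → ℝ)) huv
      have h2 := congrArg (fun p => (p.2 : T → ℝ)) huv
      refine Subtype.ext (funext ?_)
      rintro ⟨x, hx | hx⟩
      · exact congrFun h1 ⟨x, hx⟩
      · exact congrFun h2 ⟨x, hx⟩
    · rintro ⟨⟨u, hu⟩, ⟨v, hv⟩⟩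
      set g : ↥(S ∪ T) → ℝ := fun x =>
        if hx : (x : E) ∈ S then u ⟨x, hx⟩ else if hx' : (x : E) ∈ T then v ⟨x, hx'⟩ else 0
      have hgu : g ∘ Set.inclusion Set.subset_union_left = u := by
        funext x; simp [g]
      have hgv : g ∘ Set.inclusion Set.subset_union_right = v := by
        funext x; simp [g, Set.disjoint_right.1 hd x.2]
      have hg : g ∈ eigenspace (S ∪ T) c := by
        refine isLaplacian_union hS hT hd ?_ ?_
        · have : (c • g) ∘ Set.inclusion (Set.subset_union_left (s := S) (t := T)) = c • u := by
            rw [← hgu]; rfl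
          rw [this, hgu]; exact hu
        · have : (c • g) ∘ Set.inclusion (Set.subset_union_right (s := S) (t := T)) = c • v := by
            rw [← hgv]; rfl
          rw [this, hgv]; exact hv
      exact ⟨⟨g, hg⟩, Prod.ext (Subtype.ext hgu) (Subtype.ext hgv)⟩
  rw [multiplicity, (LinearEquiv.ofBijective _ hbij).rank_eq, rank_prod', map_add]
  rfl

theorem components_union {S T : Set E} (hS : IsClosed S) (hT : IsClosed T) (hd : Disjoint S T)
    (hSc : IsConnected S) (hTc : IsConnected T) : components (S ∪ T) = {S, T} := by
  have key : ∀ {S T : Set E}, IsClosed S → IsClosed T → Disjoint S T → IsConnected S →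
      ∀ x ∈ S, connectedComponentIn (S ∪ T) x = S := by
    intro S T hS hT hd hSc x hx
    refine Set.Subset.antisymm ?_
      (hSc.isPreconnected.subset_connectedComponentIn hx Set.subset_union_left)
    have hmem := mem_connectedComponentIn (F := S ∪ T) (Or.inl hx)
    rcases isPreconnected_iff_subset_of_disjoint_closed.1
      (isPreconnected_connectedComponentIn (F := S ∪ T) (x := x)) S T hS hT
      (connectedComponentIn_subset _ _) (by rw [hd.inter_eq, Set.inter_empty]) with h | h
    · exact h
    · exact absurd (h hmem) (Set.disjoint_left.1 hd hx)
  ext U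
  simp only [components, Set.mem_ofPred_eq, Set.mem_insert_iff, Set.mem_singleton_iff]
  constructor
  · rintro ⟨x, hx | hx, rfl⟩
    · exact Or.inl (key hS hT hd hSc x hx)
    · right; rw [Set.union_comm]; exact key hT hS hd.symm hTc x hx
  · rintro (rfl | rfl)
    · obtain ⟨x, hx⟩ := hSc.nonempty
      exact ⟨x, Or.inl hx, (key hS hT hd hSc x hx).symm⟩
    · obtain ⟨x, hx⟩ := hTc.nonempty
      exact ⟨x, Or.inr hx, by rw [Set.union_comm]; exact (key hT hS hd.symm hTc x hx).symm⟩

end Union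

/-! ### The link of the plane pair: two disjoint round spheres. -/

section Planes

/-- The isometric embedding of `ℝ³` onto the plane `Π_φ`. -/
def planeEmbedding (φ : Fin 3 → ℝ) : EuclideanSpace ℝ (Fin 3) →ₗᵢ[ℝ] EuclideanSpace ℂ (Fin 3) where
  toFun x := WithLp.toLp 2 fun k => Complex.exp (φ k * Complex.I) * x k
  map_add' x y := by ext k; simp [mul_add]
  map_smul' r x := by ext k; simp; ring
  norm_map' x := by
    simp [EuclideanSpace.norm_eq]

@[simp] theorem planeEmbedding_apply (φ : Fin 3 → ℝ) (x : EuclideanSpace ℝ (Fin 3)) (k : Fin 3) :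
    planeEmbedding φ x k = Complex.exp (φ k * Complex.I) * x k := rfl

theorem link_slPlane (φ : Fin 3 → ℝ) : link (slPlane φ) = sphereImage (planeEmbedding φ) := by
  ext z
  simp only [link, slPlane, Set.mem_inter_iff, Set.mem_ofPred_eq, mem_sphereImage,
    mem_sphere_zero_iff_norm]
  constructor
  · rintro ⟨⟨x, hx⟩, hz⟩
    have : planeEmbedding φ (WithLp.toLp 2 x) = z := by
      ext k; simp [hx]
    exact ⟨WithLp.toLp 2 x, by rw [← (planeEmbedding φ).norm_map, this, hz], this⟩
  · rintro ⟨x, hx, rfl⟩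
    exact ⟨⟨x, fun k => rfl⟩, by rw [(planeEmbedding φ).norm_map, hx]⟩

theorem link_planePair (φ : Fin 3 → ℝ) : link (planePair φ) =
    sphereImage (planeEmbedding 0) ∪ sphereImage (planeEmbedding φ) := by
  rw [← link_slPlane, ← link_slPlane]
  exact Set.union_inter_distrib_right _ _ _

variable {E : Type*} [NormedAddCommGroup E] [InnerProductSpace ℝ E] [FiniteDimensional ℝ E]

theorem isClosed_sphereImage (ι : EuclideanSpace ℝ (Fin 3) →ₗᵢ[ℝ] E) :
    IsClosed (sphereImage ι) :=
  ((isCompact_sphere _ _).image ι.continuous).isClosed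

theorem isConnected_sphereImage (ι : EuclideanSpace ℝ (Fin 3) →ₗᵢ[ℝ] E) :
    IsConnected (sphereImage ι) :=
  (isConnected_sphere (by simp [← Module.finrank_eq_rank]) _ zero_le_one).image _
    ι.continuous.continuousOn

theorem nonempty_isometryEquiv_sphereImage (ι : EuclideanSpace ℝ (Fin 3) →ₗᵢ[ℝ] E) :
    Nonempty (sphereImage ι ≃ᵢ Metric.sphere (0 : EuclideanSpace ℝ (Fin 3)) 1) := by
  refine ⟨(IsometryEquiv.mk (Equiv.Set.image ι (Metric.sphere 0 1) ι.injective) ?_).symm⟩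
  exact fun x y => ι.isometry x y

/-- A common point has imaginary parts y_k sin φ_k = 0, and sin φ_k > 0. -/
theorem disjoint_planes {φ : Fin 3 → ℝ} (hφ : ∀ k, φ k ∈ Set.Ioo 0 Real.pi) :
    Disjoint (sphereImage (planeEmbedding 0)) (sphereImage (planeEmbedding φ)) := by
  rw [Set.disjoint_left]
  rintro z hz hz'
  obtain ⟨x, hx, rfl⟩ := mem_sphereImage.1 hz
  obtain ⟨y, hy, hxy⟩ := mem_sphereImage.1 hz'
  have hy0 : y = 0 := by
    ext k
    have h1 : planeEmbedding φ y k = planeEmbedding 0 x k := by rw [hxy]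
    have h2 := congrArg Complex.im h1
    simp [Complex.exp_im, Complex.exp_re] at h2
    rcases h2 with h2 | h2
    · exact absurd h2 (Real.sin_pos_of_mem_Ioo (hφ k)).ne'
    · simpa using h2
  rw [hy0] at hy
  simp at hy

theorem sphereImage_ne {φ : Fin 3 → ℝ} (hφ : ∀ k, φ k ∈ Set.Ioo 0 Real.pi) :
    sphereImage (planeEmbedding 0) ≠ sphereImage (planeEmbedding φ) := fun h => by
  have hd := disjoint_planes hφ
  rw [← h, disjoint_self] at hd
  exact (isConnected_sphereImage (planeEmbedding 0)).nonempty.ne_empty hd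

theorem components_planePair {φ : Fin 3 → ℝ} (hφ : ∀ k, φ k ∈ Set.Ioo 0 Real.pi) :
    components (link (planePair φ)) =
      {sphereImage (planeEmbedding 0), sphereImage (planeEmbedding φ)} := by
  rw [link_planePair]
  exact components_union (isClosed_sphereImage _) (isClosed_sphereImage _) (disjoint_planes hφ)
    (isConnected_sphereImage _) (isConnected_sphereImage _)

theorem numEnds_planePair {φ : Fin 3 → ℝ} (hφ : ∀ k, φ k ∈ Set.Ioo 0 Real.pi) :
    numEnds (planePair φ) = 2 := by
  rw [numEnds, components_planePair hφ, Set.encard_pair (sphereImage_ne hφ)]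

theorem legendrianIndex_planePair {φ : Fin 3 → ℝ} (hφ : ∀ k, φ k ∈ Set.Ioo 0 Real.pi) :
    legendrianIndex (planePair φ) = 6 := by
  have hm : ∀ c, multiplicity (link (planePair φ)) c =
      multiplicity (sphereImage (planeEmbedding 0)) c +
        multiplicity (sphereImage (planeEmbedding φ)) c := fun c => by
    rw [link_planePair]
    exact multiplicity_union (isClosed_sphereImage _) (isClosed_sphereImage _)
      (disjoint_planes hφ) c
  have h2 : (2 : ℝ) ∈ Set.Ioo (0 : ℝ) (2 * (3 : ℕ)) := by norm_num
  -- Only the eigenvalue 2 contributes, three times from each sphere.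
  rw [legendrianIndex, tsum_eq_single ⟨2, h2⟩]
  · rw [hm, multiplicity_two, multiplicity_two]; norm_num
  · rintro ⟨c, hc⟩ hne
    have hc2 : c ≠ 2 := fun h => hne (Subtype.ext h)
    have hc6 : c ∈ Set.Ioo (0 : ℝ) 6 := by norm_num at hc; exact hc
    have h0 : ∀ ι : EuclideanSpace ℝ (Fin 3) →ₗᵢ[ℝ] EuclideanSpace ℂ (Fin 3),
        multiplicity (sphereImage ι) c = 0 := fun ι => by
      rw [multiplicity, eigenspace_eq_bot ι (nat_mul_succ_ne hc6 hc2)]; simp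
    simp only [hm, h0, add_zero]

end Planes

/-! ### The stabilizer in SU(3) of the unit sphere of Π_φ is a conjugate of SO(3). -/

section Stabilizer

open Matrix

/-- The diagonal matrix with entries `e^{iφ_k}`. -/
def phaseMatrix (φ : Fin 3 → ℝ) : Matrix (Fin 3) (Fin 3) ℂ :=
  diagonal fun k => Complex.exp (φ k * Complex.I)

theorem phaseMatrix_mul_conjTranspose (φ : Fin 3 → ℝ) :
    phaseMatrix φ * (phaseMatrix φ)ᴴ = 1 := by
  rw [phaseMatrix, diagonal_conjTranspose, diagonal_mul_diagonal, ← diagonal_one]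
  congr 1
  funext k
  simp only [Pi.star_apply, RCLike.star_def, Complex.mul_conj, Complex.normSq_eq_norm_sq,
    Complex.norm_exp_ofReal_mul_I]
  norm_num

theorem conjTranspose_mul_phaseMatrix (φ : Fin 3 → ℝ) :
    (phaseMatrix φ)ᴴ * phaseMatrix φ = 1 :=
  mul_eq_one_comm.1 (phaseMatrix_mul_conjTranspose φ)

/-- The embedding of real matrices as the operators preserving the plane `Π_φ`. -/
def phaseHom (φ : Fin 3 → ℝ) : Matrix (Fin 3) (Fin 3) ℝ →ₐ[ℝ] Matrix (Fin 3) (Fin 3) ℂ :=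
  AlgHom.ofLinearMap
    { toFun := fun A => phaseMatrix φ * A.map Complex.ofReal * (phaseMatrix φ)ᴴ
      map_add' := fun A B => by
        rw [Matrix.map_add _ Complex.ofReal_add, mul_add, add_mul]
      map_smul' := fun r A => by
        have : (r • A).map Complex.ofReal = r • A.map Complex.ofReal := by ext; simp
        simp [this] }
    (by
      simp only [LinearMap.coe_mk, AddHom.coe_mk]
      rw [Matrix.map_one _ Complex.ofReal_zero Complex.ofReal_one, mul_one,
        phaseMatrix_mul_conjTranspose])
    (fun A B => by
      simp only [LinearMap.coe_mk, AddHom.coe_mk]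
      have : (A * B).map Complex.ofReal = A.map Complex.ofReal * B.map Complex.ofReal :=
        Matrix.map_mul (f := Complex.ofRealHom)
      rw [this]
      simp only [mul_assoc]
      rw [← mul_assoc (phaseMatrix φ)ᴴ, conjTranspose_mul_phaseMatrix, one_mul])

theorem phaseHom_apply (φ : Fin 3 → ℝ) (A : Matrix (Fin 3) (Fin 3) ℝ) :
    phaseHom φ A = phaseMatrix φ * A.map Complex.ofReal * (phaseMatrix φ)ᴴ := rfl

/-- The left inverse of `phaseHom`. -/
def phaseInv (φ : Fin 3 → ℝ) (M : Matrix (Fin 3) (Fin 3) ℂ) : Matrix (Fin 3) (Fin 3) ℝ :=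
  ((phaseMatrix φ)ᴴ * M * phaseMatrix φ).map Complex.re

theorem phaseInv_phaseHom (φ : Fin 3 → ℝ) (A : Matrix (Fin 3) (Fin 3) ℝ) :
    phaseInv φ (phaseHom φ A) = A := by
  rw [phaseInv, phaseHom_apply, mul_assoc, mul_assoc, mul_assoc, conjTranspose_mul_phaseMatrix,
    mul_one, ← mul_assoc, conjTranspose_mul_phaseMatrix, one_mul]
  ext i j
  simp

theorem phaseHom_injective (φ : Fin 3 → ℝ) : Function.Injective (phaseHom φ) :=
  Function.LeftInverse.injective (phaseInv_phaseHom φ)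

theorem continuous_phaseHom (φ : Fin 3 → ℝ) : Continuous (phaseHom φ) :=
  (phaseHom φ).toLinearMap.continuous_of_finiteDimensional

theorem continuous_phaseInv (φ : Fin 3 → ℝ) : Continuous (phaseInv φ) :=
  ((continuous_const.matrix_mul continuous_id).matrix_mul continuous_const).matrix_map
    Complex.continuous_re

theorem phaseHom_transpose (φ : Fin 3 → ℝ) (A : Matrix (Fin 3) (Fin 3) ℝ) :
    phaseHom φ Aᵀ = (phaseHom φ A)ᴴ := by
  have : Aᵀ.map Complex.ofReal = (A.map Complex.ofReal)ᴴ := by ext; simp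
  rw [phaseHom_apply, phaseHom_apply, conjTranspose_mul, conjTranspose_mul,
    conjTranspose_conjTranspose, this, mul_assoc]

theorem det_phaseHom (φ : Fin 3 → ℝ) (A : Matrix (Fin 3) (Fin 3) ℝ) :
    (phaseHom φ A).det = (A.det : ℂ) := by
  rw [phaseHom_apply, det_mul, det_mul, mul_right_comm, ← det_mul, phaseMatrix_mul_conjTranspose,
    det_one, one_mul]
  exact (RingHom.map_det Complex.ofRealHom A).symm

theorem phaseHom_mem_iff (φ : Fin 3 → ℝ) (A : Matrix (Fin 3) (Fin 3) ℝ) :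
    phaseHom φ A ∈ specialUnitaryGroup (Fin 3) ℂ ↔ A ∈ specialOrthogonalGroup (Fin 3) ℝ := by
  rw [mem_specialUnitaryGroup_iff, mem_specialOrthogonalGroup_iff, mem_unitaryGroup_iff,
    mem_orthogonalGroup_iff, det_phaseHom, star_eq_conjTranspose,
    ← phaseHom_transpose, ← map_mul]
  refine and_congr ?_ (by norm_cast)
  rw [← (phaseHom_injective φ).eq_iff (b := 1), map_one]

theorem phaseHom_mulVec (φ : Fin 3 → ℝ) (A : Matrix (Fin 3) (Fin 3) ℝ)
    (x : EuclideanSpace ℝ (Fin 3)) : toEuclideanLin (phaseHom φ A) (planeEmbedding φ x) =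
      planeEmbedding φ (toEuclideanLin A x) := by
  have hx : planeEmbedding φ x = toEuclideanLin (phaseMatrix φ)
      (WithLp.toLp 2 fun k => (x k : ℂ)) := by
    ext k
    simp [phaseMatrix, toLpLin_apply, mulVec_diagonal]
  rw [hx, phaseHom_apply]
  simp only [toLpLin_apply, mulVec_mulVec]
  rw [mul_assoc, conjTranspose_mul_phaseMatrix, mul_one, ← mulVec_mulVec]
  ext k
  simp [phaseMatrix, mulVec, dotProduct, diagonal_apply]

theorem norm_toEuclideanLin_orthogonal {A : Matrix (Fin 3) (Fin 3) ℝ}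
    (hA : A ∈ orthogonalGroup (Fin 3) ℝ) (x : EuclideanSpace ℝ (Fin 3)) :
    ‖toEuclideanLin A x‖ = ‖x‖ := by
  have h1 : ∀ y : EuclideanSpace ℝ (Fin 3), ‖y‖ ^ 2 = y.ofLp ⬝ᵥ y.ofLp := fun y => by
    rw [EuclideanSpace.norm_sq_eq]; simp [dotProduct, sq]
  have h2 : ‖toEuclideanLin A x‖ ^ 2 = ‖x‖ ^ 2 := by
    rw [h1, h1, toLpLin_apply]
    simp only
    rw [dotProduct_mulVec, vecMul_mulVec, (mem_orthogonalGroup_iff' _ _).1 hA,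
      vecMul_one]
  exact (pow_left_inj₀ (norm_nonneg _) (norm_nonneg _) two_ne_zero).1 h2

theorem mem_stabilizer_phaseHom (φ : Fin 3 → ℝ) {A : Matrix (Fin 3) (Fin 3) ℝ}
    (hA : A ∈ specialOrthogonalGroup (Fin 3) ℝ) :
    (⟨phaseHom φ A, (phaseHom_mem_iff φ A).2 hA⟩ : specialUnitaryGroup (Fin 3) ℂ) ∈
      stabilizerSU (sphereImage (planeEmbedding φ)) := by
  have hA' := (mem_specialOrthogonalGroup_iff.1 hA).1
  change toEuclideanLin (phaseHom φ A) '' _ = _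
  refine Set.Subset.antisymm ?_ ?_
  · rintro _ ⟨z, hz, rfl⟩
    obtain ⟨x, hx, rfl⟩ := mem_sphereImage.1 hz
    rw [phaseHom_mulVec]
    exact map_mem_sphereImage _ (by rw [norm_toEuclideanLin_orthogonal hA', hx])
  · intro z hz
    obtain ⟨x, hx, rfl⟩ := mem_sphereImage.1 hz
    have hAT : Aᵀ ∈ orthogonalGroup (Fin 3) ℝ := by
      rw [mem_orthogonalGroup_iff, transpose_transpose]; exact (mem_orthogonalGroup_iff' _ _).1 hA'
    refine ⟨planeEmbedding φ (toEuclideanLin Aᵀ x), map_mem_sphereImage _ (by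
      rw [norm_toEuclideanLin_orthogonal hAT, hx]), ?_⟩
    rw [phaseHom_mulVec]
    congr 1
    simp only [toLpLin_apply, mulVec_mulVec]
    rw [(mem_orthogonalGroup_iff _ _).1 hA', one_mulVec]

/-- The images of the three basis vectors of the plane lie in the plane again; their real
coordinates are the columns of the required matrix. -/
theorem exists_phaseHom_of_mem_stabilizer (φ : Fin 3 → ℝ)
    {g : specialUnitaryGroup (Fin 3) ℂ} (hg : g ∈ stabilizerSU (sphereImage (planeEmbedding φ))) :
    ∃ A ∈ specialOrthogonalGroup (Fin 3) ℝ, phaseHom φ A = g := by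
  have h1 : ∀ j : Fin 3, ∃ a : EuclideanSpace ℝ (Fin 3),
      planeEmbedding φ a = toEuclideanLin (g : Matrix (Fin 3) (Fin 3) ℂ)
        (planeEmbedding φ (EuclideanSpace.single j 1)) := fun j => by
    have : toEuclideanLin (g : Matrix (Fin 3) (Fin 3) ℂ)
        (planeEmbedding φ (EuclideanSpace.single j 1)) ∈ sphereImage (planeEmbedding φ) := by
      have hg' : toEuclideanLin (g : Matrix (Fin 3) (Fin 3) ℂ) '' sphereImage (planeEmbedding φ) =
        sphereImage (planeEmbedding φ) := hg
      exact hg'.subset ⟨_, map_mem_sphereImage _ (by simp), rfl⟩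
    obtain ⟨a, -, ha⟩ := mem_sphereImage.1 this
    exact ⟨a, ha⟩
  choose a ha using h1
  set A : Matrix (Fin 3) (Fin 3) ℝ := of fun i j => a j i with hA
  have hAg : phaseHom φ A = g := by
    have h2 : phaseMatrix φ * A.map Complex.ofReal =
        (g : Matrix (Fin 3) (Fin 3) ℂ) * phaseMatrix φ := by
      ext i j
      have := congrArg (fun z : EuclideanSpace ℂ (Fin 3) => z i) (ha j)
      simp only [planeEmbedding_apply, toLpLin_apply, mulVec, dotProduct] at this
      rw [phaseMatrix, diagonal_mul, mul_diagonal, map_apply, hA, of_apply, this,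
        Finset.sum_eq_single j]
      · simp
      · intro k _ hk; simp [hk]
      · simp
    rw [phaseHom_apply, h2, mul_assoc, phaseMatrix_mul_conjTranspose, mul_one]
  refine ⟨A, (phaseHom_mem_iff φ A).1 ?_, hAg⟩
  rw [hAg]; exact g.2

/-- The homomorphism from `SO(3)` to the stabilizer of the unit sphere of `Π_φ`. -/
def stabilizerHom (φ : Fin 3 → ℝ) :
    specialOrthogonalGroup (Fin 3) ℝ →* stabilizerSU (sphereImage (planeEmbedding φ)) where
  toFun A := ⟨⟨phaseHom φ A, (phaseHom_mem_iff φ A).2 A.2⟩, mem_stabilizer_phaseHom φ A.2⟩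
  map_one' := Subtype.ext (Subtype.ext (map_one (phaseHom φ)))
  map_mul' A B := Subtype.ext (Subtype.ext (map_mul (phaseHom φ) A.1 B.1))

theorem stabilizerHom_bijective (φ : Fin 3 → ℝ) : Function.Bijective (stabilizerHom φ) := by
  constructor
  · intro A B h
    exact Subtype.ext (phaseHom_injective φ (congrArg (fun g => (g.1.1 : Matrix (Fin 3) (Fin 3) ℂ)) h))
  · rintro ⟨g, hg⟩
    obtain ⟨A, hA, hAg⟩ := exists_phaseHom_of_mem_stabilizer φ hg
    exact ⟨⟨A, hA⟩, Subtype.ext (Subtype.ext hAg)⟩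

theorem nonempty_stabilizer_equiv (φ : Fin 3 → ℝ) :
    Nonempty (stabilizerSU (sphereImage (planeEmbedding φ)) ≃ₜ*
      specialOrthogonalGroup (Fin 3) ℝ) := by
  set e := MulEquiv.ofBijective _ (stabilizerHom_bijective φ)
  have he : ∀ A, ((e A).1 : Matrix (Fin 3) (Fin 3) ℂ) = phaseHom φ A := fun A => rfl
  refine ⟨ContinuousMulEquiv.symm { e with
    continuous_toFun := ?_
    continuous_invFun := ?_ }⟩
  · exact Continuous.subtype_mk (Continuous.subtype_mk
      ((continuous_phaseHom φ).comp continuous_subtype_val) _) _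
  · refine continuous_induced_rng.2 ?_
    have : (Subtype.val ∘ e.symm : _ → Matrix (Fin 3) (Fin 3) ℝ) =
        fun g => phaseInv φ (g.1 : Matrix (Fin 3) (Fin 3) ℂ) := by
      funext g
      obtain ⟨A, rfl⟩ := e.surjective g
      simp [he, phaseInv_phaseHom]
    have hc := (continuous_phaseInv φ).comp ((continuous_subtype_val (p := fun g => g ∈
      specialUnitaryGroup (Fin 3) ℂ)).comp (continuous_subtype_val (p := fun g => g ∈
      stabilizerSU (sphereImage (planeEmbedding φ)))))
    exact this ▸ hc

end Stabilizer

/-! ### Lie algebras and dimensions of SU(3) and of the stabilizer. -/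

section LieAlgebras

open Matrix

section Exponential

open scoped Matrix.Norms.Operator

theorem hasDerivAt_exp_smul_zero {n : ℕ} (X : Matrix (Fin n) (Fin n) ℂ) :
    HasDerivAt (fun t : ℝ => NormedSpace.exp (t • X)) X 0 := by
  have h := hasDerivAt_exp_smul_const (𝕂 := ℝ) X 0
  rw [zero_smul, NormedSpace.exp_zero, one_mul] at h
  exact h

theorem eq_of_exp_smul_eq {n : ℕ} {X Y : Matrix (Fin n) (Fin n) ℂ}
    (h : ∀ t : ℝ, NormedSpace.exp (t • X) = NormedSpace.exp (t • Y)) : X = Y :=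
  (hasDerivAt_exp_smul_zero X).unique
    ((hasDerivAt_exp_smul_zero Y).congr_of_eventuallyEq (Filter.Eventually.of_forall h))

theorem phaseHom_exp (φ : Fin 3 → ℝ) (Y : Matrix (Fin 3) (Fin 3) ℝ) :
    phaseHom φ (NormedSpace.exp Y) = NormedSpace.exp (phaseHom φ Y) :=
  NormedSpace.map_exp (phaseHom φ) (continuous_phaseHom φ) Y

/-- X is the limit of difference quotients of exp(tX) at 0. These stay in the range, a linear
subspace that is closed by finite dimensionality. -/
theorem exists_phaseHom_of_exp {φ : Fin 3 → ℝ} {X : Matrix (Fin 3) (Fin 3) ℂ}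
    (h : ∀ t : ℝ, NormedSpace.exp (t • X) ∈ Set.range (phaseHom φ)) :
    X ∈ Set.range (phaseHom φ) := by
  have hcl : IsClosed ((phaseHom φ).toLinearMap.range : Set (Matrix (Fin 3) (Fin 3) ℂ)) :=
    Submodule.closed_of_finiteDimensional _
  have hd := (hasDerivAt_exp_smul_zero X).tendsto_slope_zero
  have : X ∈ (phaseHom φ).toLinearMap.range := by
    refine hcl.mem_of_tendsto hd (Filter.Eventually.of_forall fun t => ?_)
    refine Submodule.smul_mem _ _ (Submodule.sub_mem _ ?_ ?_)
    · exact h _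
    · exact h _
  exact this

end Exponential

theorem conjTranspose_eq_neg_of_exp {n : ℕ} {X : Matrix (Fin n) (Fin n) ℂ}
    (h : ∀ t : ℝ, NormedSpace.exp (t • X) ∈ unitaryGroup (Fin n) ℂ) : Xᴴ = -X := by
  refine eq_of_exp_smul_eq fun t => ?_
  have h1 := mem_unitaryGroup_iff'.1 (h t)
  rw [smul_neg, Matrix.exp_neg, inv_eq_left_inv h1, star_eq_conjTranspose,
    ← Matrix.exp_conjTranspose, conjTranspose_smul, star_trivial]

theorem exp_mem_unitaryGroup {n : ℕ} {X : Matrix (Fin n) (Fin n) ℂ} (hX : Xᴴ = -X) :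
    NormedSpace.exp X ∈ unitaryGroup (Fin n) ℂ := by
  rw [mem_unitaryGroup_iff', star_eq_conjTranspose, ← Matrix.exp_conjTranspose, hX,
    Matrix.exp_neg]
  exact nonsing_inv_mul _ ((isUnit_iff_isUnit_det _).1 (Matrix.isUnit_exp X))

/-- The matrix iX is Hermitian, so the spectral theorem diagonalizes X and reduces the claim to
diagonal matrices. -/
theorem det_exp_of_conjTranspose_eq_neg {n : ℕ} {X : Matrix (Fin n) (Fin n) ℂ} (hX : Xᴴ = -X) :
    (NormedSpace.exp X).det = Complex.exp X.trace := by
  have hH : (Complex.I • X).IsHermitian := by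
    rw [IsHermitian, conjTranspose_smul, hX]; simp
  set U : Matrix (Fin n) (Fin n) ℂ := hH.eigenvectorUnitary.1 with hU
  set v : Fin n → ℂ := fun i => -Complex.I * (hH.eigenvalues i : ℂ) with hv
  have hUU : U * Uᴴ = 1 := mem_unitaryGroup_iff.1 hH.eigenvectorUnitary.2
  have hinv : U⁻¹ = Uᴴ := inv_eq_right_inv hUU
  have hXd : X = U * diagonal v * U⁻¹ := by
    have h1 : X = -Complex.I • (Complex.I • X) := by rw [smul_smul]; simp
    have h2 : diagonal v = -Complex.I • diagonal (RCLike.ofReal ∘ hH.eigenvalues) := by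
      ext i j
      by_cases hij : i = j
      · subst hij; simp [hv]
      · simp [hij]
    rw [h1, hH.spectral_theorem, Unitary.conjStarAlgAut_apply, hinv, h2]
    simp [hU, star_eq_conjTranspose]
  have hUu : IsUnit U := IsUnit.of_mul_eq_one _ hUU
  have hdet : ∀ M : Matrix (Fin n) (Fin n) ℂ, (U * M * U⁻¹).det = M.det := fun M => by
    rw [det_mul, det_mul, mul_right_comm, ← det_mul, hinv, hUU, det_one, one_mul]
  have htr : X.trace = ∑ i, v i := by
    conv_lhs => rw [hXd]
    rw [trace_mul_comm, ← mul_assoc, hinv, mul_eq_one_comm.1 hUU, one_mul, trace_diagonal]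
  rw [htr, Complex.exp_sum]
  conv_lhs => rw [hXd]
  rw [Matrix.exp_conj _ _ hUu, hdet, Matrix.exp_diagonal, det_diagonal]
  refine Finset.prod_congr rfl fun i _ => ?_
  rw [Pi.coe_exp, Complex.exp_eq_exp_ℂ]

/-- A single t would give tr X only up to a multiple of 2πi; hence exp(t tr X) = 1 is differentiated
at t = 0. -/
theorem trace_eq_zero_of_exp {n : ℕ} {X : Matrix (Fin n) (Fin n) ℂ} (hX : Xᴴ = -X)
    (h : ∀ t : ℝ, (NormedSpace.exp (t • X)).det = 1) : X.trace = 0 := by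
  have h1 : ∀ t : ℝ, Complex.exp ((t : ℂ) * X.trace) = 1 := fun t => by
    have h2 : (t • X)ᴴ = -(t • X) := by rw [conjTranspose_smul, hX]; simp
    rw [← h t, det_exp_of_conjTranspose_eq_neg h2, trace_smul, Complex.real_smul]
  have hd : HasDerivAt (fun t : ℝ => Complex.exp ((t : ℂ) * X.trace)) X.trace 0 := by
    have := ((Complex.ofRealCLM.hasDerivAt (x := (0 : ℝ))).mul_const X.trace).cexp
    simpa using this
  exact hd.unique ((hasDerivAt_const (0 : ℝ) (1 : ℂ)).congr_of_eventuallyEq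
    (Filter.Eventually.of_forall h1))

/-- The traceless skew-Hermitian matrices. -/
def skewTraceless (n : ℕ) : Submodule ℝ (Matrix (Fin n) (Fin n) ℂ) where
  carrier := {X | Xᴴ = -X ∧ X.trace = 0}
  zero_mem' := by simp
  add_mem' := by
    rintro X Y ⟨h1, h2⟩ ⟨h3, h4⟩
    exact ⟨by rw [conjTranspose_add, h1, h3, neg_add], by rw [trace_add, h2, h4, add_zero]⟩
  smul_mem' := by
    rintro r X ⟨h1, h2⟩
    exact ⟨by rw [conjTranspose_smul, h1]; simp, by rw [trace_smul, h2, smul_zero]⟩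

theorem exp_mem_specialUnitaryGroup_iff {n : ℕ} {X : Matrix (Fin n) (Fin n) ℂ} :
    (∀ t : ℝ, NormedSpace.exp (t • X) ∈ specialUnitaryGroup (Fin n) ℂ) ↔ X ∈ skewTraceless n := by
  constructor
  · intro h
    have hX := conjTranspose_eq_neg_of_exp fun t => (mem_specialUnitaryGroup_iff.1 (h t)).1
    exact ⟨hX, trace_eq_zero_of_exp hX fun t => (mem_specialUnitaryGroup_iff.1 (h t)).2⟩
  · intro hX t
    obtain ⟨h1, h2⟩ := (skewTraceless n).smul_mem t hX
    exact mem_specialUnitaryGroup_iff.2 ⟨exp_mem_unitaryGroup h1, by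
      rw [det_exp_of_conjTranspose_eq_neg h1, h2, Complex.exp_zero]⟩

/-- The entries above the diagonal and the first two diagonal entries of a traceless
skew-Hermitian matrix of size `3`. -/
def skewTracelessCoords : skewTraceless 3 →ₗ[ℝ] (ℂ × ℂ × ℂ × ℝ × ℝ) where
  toFun X := (X.1 0 1, X.1 0 2, X.1 1 2, (X.1 0 0).im, (X.1 1 1).im)
  map_add' X Y := by simp
  map_smul' r X := by simp

theorem skewTracelessCoords_apply (X : skewTraceless 3) : skewTracelessCoords X =
    (X.1 0 1, X.1 0 2, X.1 1 2, (X.1 0 0).im, (X.1 1 1).im) := rfl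

theorem skewTracelessCoords_injective : Function.Injective skewTracelessCoords := by
  refine (injective_iff_map_eq_zero _).2 ?_
  rintro ⟨X, hX, htr⟩ h
  have hsk : ∀ i j, X j i = -star (X i j) := fun i j => by
    have := congrFun (congrFun hX j) i
    rw [conjTranspose_apply, neg_apply] at this
    rw [this, neg_neg]
  have hre : ∀ i, (X i i).re = 0 := fun i => by
    have := congrArg Complex.re (hsk i i)
    simp at this
    linarith
  have htr' : X 0 0 + X 1 1 + X 2 2 = 0 := (trace_fin_three X).symm.trans htr
  simp only [skewTracelessCoords_apply, Prod.mk_eq_zero] at h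
  obtain ⟨h01, h02, h12, h0, h1⟩ := h
  have h00 : X 0 0 = 0 := Complex.ext (hre 0) h0
  have h11 : X 1 1 = 0 := Complex.ext (hre 1) h1
  have h22 : X 2 2 = 0 := by simpa [h00, h11] using htr'
  have h10 : X 1 0 = 0 := by rw [hsk 0 1, h01]; simp
  have h20 : X 2 0 = 0 := by rw [hsk 0 2, h02]; simp
  have h21 : X 2 1 = 0 := by rw [hsk 1 2, h12]; simp
  refine Subtype.ext (Matrix.ext fun i j => ?_)
  fin_cases i <;> fin_cases j <;> assumption

theorem skewTracelessCoords_surjective : Function.Surjective skewTracelessCoords := by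
  rintro ⟨u, v, w, a, b⟩
  refine ⟨⟨!![a * Complex.I, u, v; -star u, b * Complex.I, w;
    -star v, -star w, ((-a - b : ℝ) : ℂ) * Complex.I], ?_, ?_⟩, ?_⟩
  · ext i j
    fin_cases i <;> fin_cases j <;> simp [conjTranspose_apply]
  · rw [trace_fin_three]
    simp
    ring
  · rw [skewTracelessCoords_apply]; simp

theorem finrank_skewTraceless_three : Module.finrank ℝ (skewTraceless 3) = 8 := by
  rw [(LinearEquiv.ofBijective skewTracelessCoords
    ⟨skewTracelessCoords_injective, skewTracelessCoords_surjective⟩).finrank_eq]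
  simp [Module.finrank_prod, Complex.finrank_real_complex]

theorem dimSU_three : dimSU 3 = 8 := by
  rw [dimSU, lieDim, ← finrank_skewTraceless_three]
  have : {X : Matrix (Fin 3) (Fin 3) ℂ | ∀ t : ℝ, NormedSpace.exp (t • X) ∈
      (specialUnitaryGroup (Fin 3) ℂ : Set (Matrix (Fin 3) (Fin 3) ℂ))} = skewTraceless 3 :=
    Set.ext fun X => exp_mem_specialUnitaryGroup_iff
  rw [this, Submodule.span_eq]

/-- The real skew-symmetric matrices. -/
def skewSymmetric : Submodule ℝ (Matrix (Fin 3) (Fin 3) ℝ) where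
  carrier := {Y | Yᵀ = -Y}
  zero_mem' := by simp
  add_mem' := by
    intro X Y (h1 : Xᵀ = -X) (h3 : Yᵀ = -Y)
    change (X + Y)ᵀ = -(X + Y)
    rw [transpose_add, h1, h3, neg_add]
  smul_mem' := by
    intro r X (h1 : Xᵀ = -X)
    change (r • X)ᵀ = -(r • X)
    rw [transpose_smul, h1, smul_neg]

theorem finrank_skewSymmetric : Module.finrank ℝ skewSymmetric = 3 := by
  let f : skewSymmetric →ₗ[ℝ] (Fin 3 → ℝ) :=
    { toFun := fun X => ![X.1 0 1, X.1 0 2, X.1 1 2]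
      map_add' := fun X Y => by ext i; fin_cases i <;> simp
      map_smul' := fun r X => by ext i; fin_cases i <;> simp }
  have hf : Function.Bijective f := by
    constructor
    · refine (injective_iff_map_eq_zero f).2 ?_
      rintro ⟨X, hX⟩ h
      have hsk : ∀ i j, X j i = -X i j := fun i j => congrFun (congrFun hX i) j
      have h0 : X 0 1 = 0 := congrFun h 0
      have h1 : X 0 2 = 0 := congrFun h 1
      have h2 : X 1 2 = 0 := congrFun h 2
      refine Subtype.ext (Matrix.ext fun i j => ?_)
      have r00 := hsk 0 0
      have r11 := hsk 1 1
      have r22 := hsk 2 2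
      have r10 := hsk 0 1
      have r20 := hsk 0 2
      have r21 := hsk 1 2
      fin_cases i <;> fin_cases j <;> simp <;> linarith
    · intro c
      refine ⟨⟨!![0, c 0, c 1; -c 0, 0, c 2; -c 1, -c 2, 0], ?_⟩, ?_⟩
      · change _ᵀ = -_
        ext i j
        fin_cases i <;> fin_cases j <;> simp
      · ext i
        fin_cases i <;> simp [f]
  rw [(LinearEquiv.ofBijective f hf).finrank_eq]
  simp

/-- The Lie algebra of the stabilizer is the conjugated copy of so(3): membership of exp(tX) makes X
both skew-Hermitian and conjugate to a real matrix. -/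
theorem exp_mem_stabilizer_iff (φ : Fin 3 → ℝ) {X : Matrix (Fin 3) (Fin 3) ℂ} :
    (∀ t : ℝ, NormedSpace.exp (t • X) ∈
      ((fun g : specialUnitaryGroup (Fin 3) ℂ => (g : Matrix (Fin 3) (Fin 3) ℂ)) ''
      (stabilizerSU (sphereImage (planeEmbedding φ)) : Set (specialUnitaryGroup (Fin 3) ℂ)))) ↔
      X ∈ skewSymmetric.map (phaseHom φ).toLinearMap := by
  constructor
  · intro h
    have hsu : X ∈ skewTraceless 3 := exp_mem_specialUnitaryGroup_iff.1 fun t => by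
      obtain ⟨g, -, hgX⟩ := h t
      rw [← hgX]; exact g.2
    obtain ⟨Y, rfl⟩ := exists_phaseHom_of_exp (φ := φ) fun t => by
      obtain ⟨g, hg, hgX⟩ := h t
      obtain ⟨A, -, hA⟩ := exists_phaseHom_of_mem_stabilizer φ hg
      exact ⟨A, hA.trans hgX⟩
    refine ⟨Y, ?_, rfl⟩
    refine phaseHom_injective φ ?_
    rw [phaseHom_transpose, map_neg]
    exact hsu.1
  · rintro ⟨Y, hY, rfl⟩ t
    have hYs : (phaseHom φ Y) ∈ skewTraceless 3 := by
      have hY' : Yᵀ = -Y := hY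
      refine ⟨by rw [← phaseHom_transpose, hY', map_neg], ?_⟩
      have h0 : Y.trace = 0 := by
        have := congrArg trace hY'
        rw [trace_transpose, trace_neg] at this
        linarith
      rw [phaseHom_apply, trace_mul_comm, ← mul_assoc, conjTranspose_mul_phaseMatrix, one_mul]
      have := congrArg Complex.ofReal h0
      simpa [trace] using this
    have hexp : NormedSpace.exp (t • phaseHom φ Y) = phaseHom φ (NormedSpace.exp (t • Y)) := by
      rw [phaseHom_exp, map_smul]
    have hmem : NormedSpace.exp (t • Y) ∈ specialOrthogonalGroup (Fin 3) ℝ := by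
      rw [← phaseHom_mem_iff φ, ← hexp]
      exact exp_mem_specialUnitaryGroup_iff.2 hYs t
    exact ⟨_, mem_stabilizer_phaseHom φ hmem, hexp.symm⟩

theorem dimStabilizerSU_sphereImage (φ : Fin 3 → ℝ) :
    dimStabilizerSU (sphereImage (planeEmbedding φ)) = 3 := by
  rw [dimStabilizerSU, lieDim, Set.ext (fun X => exp_mem_stabilizer_iff φ (X := X))]
  have h1 := Submodule.span_eq (skewSymmetric.map (phaseHom φ).toLinearMap)
  have h2 := LinearMap.finrank_range_of_inj
    (f := (phaseHom φ).toLinearMap ∘ₗ skewSymmetric.subtype)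
    ((phaseHom_injective φ).comp Subtype.val_injective)
  rw [LinearMap.range_comp, Submodule.range_subtype, finrank_skewSymmetric] at h2
  exact (congrArg (fun W : Submodule ℝ _ => Module.finrank ℝ W) h1).trans h2

end LieAlgebras

/-! ### The angles of Lawlor's neck and the functions ψ_k. -/

section LawlorAngles

open MeasureTheory Filter Topology

variable {a : Fin 3 → ℝ}

theorem lawlorP_pos (ha : ∀ k, 0 < a k) (x : ℝ) : 0 < lawlorP a x := by
  have h0 := ha 0
  have h1 := ha 1
  have h2 := ha 2
  unfold lawlorP
  positivity

theorem one_add_sq_mul_lawlorP (a : Fin 3 → ℝ) (x : ℝ) :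
    1 + x ^ 2 * lawlorP a x = (1 + a 0 * x ^ 2) * (1 + a 1 * x ^ 2) * (1 + a 2 * x ^ 2) := by
  unfold lawlorP; ring

theorem one_add_mul_sq_pos (ha : ∀ k, 0 < a k) (k : Fin 3) (x : ℝ) : 0 < 1 + a k * x ^ 2 := by
  have := ha k
  positivity

/-- The integrand `1 / ((1 + a_k x²) √P(x))` of the angle functions. -/
def lawlorIntegrand (a : Fin 3 → ℝ) (k : Fin 3) (x : ℝ) : ℝ :=
  1 / ((1 + a k * x ^ 2) * √(lawlorP a x))

theorem lawlorIntegrand_pos (ha : ∀ k, 0 < a k) (k : Fin 3) (x : ℝ) :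
    0 < lawlorIntegrand a k x :=
  one_div_pos.2 (mul_pos (one_add_mul_sq_pos ha k x) (Real.sqrt_pos.2 (lawlorP_pos ha x)))

theorem contDiff_lawlorIntegrand (ha : ∀ k, 0 < a k) (k : Fin 3) :
    ContDiff ℝ ∞ (lawlorIntegrand a k) := by
  have hP : ContDiff ℝ ∞ (lawlorP a) := by unfold lawlorP; fun_prop
  unfold lawlorIntegrand
  refine contDiff_const.div (ContDiff.mul (by fun_prop)
    (hP.sqrt fun x => (lawlorP_pos ha x).ne')) fun x => ?_
  exact (mul_pos (one_add_mul_sq_pos ha k x) (Real.sqrt_pos.2 (lawlorP_pos ha x))).ne'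

theorem integrable_lawlorIntegrand (ha : ∀ k, 0 < a k) (k : Fin 3) :
    Integrable (lawlorIntegrand a k) := by
  have hs : 0 < √(a k) := Real.sqrt_pos.2 (ha k)
  have h1 : Integrable fun x : ℝ => (√(a 0 + a 1 + a 2))⁻¹ * (1 + (√(a k) * x) ^ 2)⁻¹ :=
    (integrable_inv_one_add_sq.comp_mul_left' hs.ne').const_mul _
  refine h1.mono' (contDiff_lawlorIntegrand ha k).continuous.aestronglyMeasurable
    (Eventually.of_forall fun x => ?_)
  rw [Real.norm_of_nonneg (lawlorIntegrand_pos ha k x).le, mul_pow, Real.sq_sqrt (ha k).le,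
    lawlorIntegrand, one_div, mul_inv, mul_comm]
  have h0 := ha 0
  have h1 := ha 1
  have h2 := ha 2
  refine mul_le_mul_of_nonneg_right (inv_anti₀ (Real.sqrt_pos.2 (by positivity))
    (Real.sqrt_le_sqrt ?_)) (inv_nonneg.2 (one_add_mul_sq_pos ha k x).le)
  unfold lawlorP
  have : 0 ≤ (a 0 * a 1 + a 1 * a 2 + a 2 * a 0) * x ^ 2 + a 0 * a 1 * a 2 * x ^ 4 := by positivity
  linarith

/-- The denominator 1 + x²P of the arctangent's derivative factors as ∏(1 + a_k x²), and the
right-hand side is its partial fraction decomposition. -/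
theorem hasDerivAt_arctan_lawlor (ha : ∀ k, 0 < a k) (x : ℝ) :
    HasDerivAt (fun x => Real.arctan (x * √(lawlorP a x)))
      (∑ k, a k * lawlorIntegrand a k x) x := by
  have hP := lawlorP_pos ha x
  have hP' : HasDerivAt (lawlorP a)
      ((a 0 * a 1 + a 1 * a 2 + a 2 * a 0) * (2 * x) + a 0 * a 1 * a 2 * (4 * x ^ 3)) x := by
    have h2 := ((hasDerivAt_pow 2 x).const_mul (a 0 * a 1 + a 1 * a 2 + a 2 * a 0)).const_add
      (a 0 + a 1 + a 2)
    have h4 := (hasDerivAt_pow 4 x).const_mul (a 0 * a 1 * a 2)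
    refine (h2.add h4).congr_deriv ?_
    norm_num
  refine ((hasDerivAt_id x).mul (hP'.sqrt hP.ne')).arctan.congr_deriv ?_
  have e : 1 + (x * √(lawlorP a x)) ^ 2 =
      (1 + a 0 * x ^ 2) * (1 + a 1 * x ^ 2) * (1 + a 2 * x ^ 2) := by
    rw [mul_pow, Real.sq_sqrt hP.le, one_add_sq_mul_lawlorP]
  simp only [id, lawlorIntegrand, Fin.sum_univ_three, Pi.mul_apply, e]
  have h0 := (one_add_mul_sq_pos ha 0 x).ne'
  have h1 := (one_add_mul_sq_pos ha 1 x).ne'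
  have h2 := (one_add_mul_sq_pos ha 2 x).ne'
  have hr : √(lawlorP a x) ≠ 0 := (Real.sqrt_pos.2 hP).ne'
  have hrr := Real.sq_sqrt hP.le
  generalize √(lawlorP a x) = r at *
  rw [lawlorP] at hrr
  clear e
  generalize hu : 1 + a 0 * x ^ 2 = u at *
  generalize hv : 1 + a 1 * x ^ 2 = v at *
  generalize hw : 1 + a 2 * x ^ 2 = w at *
  field_simp
  rw [hrr, ← hu, ← hv, ← hw]
  ring

theorem tendsto_mul_sqrt_lawlorP (ha : ∀ k, 0 < a k) :
    Tendsto (fun x => x * √(lawlorP a x)) atTop atTop := by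
  have h0 := ha 0
  have h1 := ha 1
  have h2 := ha 2
  have hs : 0 < √(a 0 + a 1 + a 2) := Real.sqrt_pos.2 (by positivity)
  refine tendsto_atTop_mono' _ ?_ (tendsto_id.atTop_mul_const hs)
  filter_upwards [eventually_ge_atTop 0] with x hx
  refine mul_le_mul_of_nonneg_left (Real.sqrt_le_sqrt ?_) hx
  unfold lawlorP
  have : 0 ≤ (a 0 * a 1 + a 1 * a 2 + a 2 * a 0) * x ^ 2 + a 0 * a 1 * a 2 * x ^ 4 := by positivity
  linarith

/-- The antiderivative arctan(x√P) runs from -π/2 to π/2, because P is even and bounded below by a₁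
+ a₂ + a₃ > 0. -/
theorem sum_lawlorAngle (ha : ∀ k, 0 < a k) : ∑ k, lawlorAngle a k = Real.pi := by
  have hint : ∀ k, Integrable fun x => a k * lawlorIntegrand a k x := fun k =>
    (integrable_lawlorIntegrand ha k).const_mul _
  have htop := tendsto_mul_sqrt_lawlorP ha
  have hbot : Tendsto (fun x => x * √(lawlorP a x)) atBot atBot := by
    have := tendsto_neg_atTop_atBot.comp (htop.comp tendsto_neg_atBot_atTop)
    refine this.congr fun x => ?_
    have hx : lawlorP a (-x) = lawlorP a x := by unfold lawlorP; ring
    simp [hx]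
  have h := integral_of_hasDerivAt_of_tendsto (hasDerivAt_arctan_lawlor ha)
    (integrable_finsetSum _ fun k _ => hint k)
    ((tendsto_nhds_of_tendsto_nhdsWithin Real.tendsto_arctan_atBot).comp hbot)
    ((tendsto_nhds_of_tendsto_nhdsWithin Real.tendsto_arctan_atTop).comp htop)
  rw [integral_finsetSum _ fun k _ => hint k] at h
  simp only [integral_const_mul] at h
  calc ∑ k, lawlorAngle a k = _ := h
    _ = Real.pi := by ring

theorem setIntegral_lawlorIntegrand_pos (ha : ∀ k, 0 < a k) (k : Fin 3) {s : Set ℝ}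
    (hs : volume s ≠ 0) : 0 < ∫ x in s, lawlorIntegrand a k x := by
  rw [setIntegral_pos_iff_support_of_nonneg_ae
    (Eventually.of_forall fun x => (lawlorIntegrand_pos ha k x).le)
    (integrable_lawlorIntegrand ha k).integrableOn]
  have : Function.support (lawlorIntegrand a k) = Set.univ :=
    Set.eq_univ_of_forall fun x => (lawlorIntegrand_pos ha k x).ne'
  rw [this, Set.univ_inter]
  exact pos_iff_ne_zero.2 hs

theorem lawlorAngle_pos (ha : ∀ k, 0 < a k) (k : Fin 3) : 0 < lawlorAngle a k := by
  have := setIntegral_lawlorIntegrand_pos ha k (s := Set.univ) (by simp)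
  rw [setIntegral_univ] at this
  exact mul_pos (ha k) this

theorem isAngleTriple_lawlorAngle (ha : ∀ k, 0 < a k) : IsAngleTriple (lawlorAngle a) := by
  have hs := sum_lawlorAngle ha
  refine ⟨fun k => ⟨lawlorAngle_pos ha k, ?_⟩, hs⟩
  rw [Fin.sum_univ_three] at hs
  have h0 := lawlorAngle_pos ha 0
  have h1 := lawlorAngle_pos ha 1
  have h2 := lawlorAngle_pos ha 2
  fin_cases k
  · change lawlorAngle a 0 < _; linarith
  · change lawlorAngle a 1 < _; linarith
  · change lawlorAngle a 2 < _; linarith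

theorem lawlorArea_pos (ha : ∀ k, 0 < a k) : 0 < lawlorArea a := by
  have h0 := ha 0
  have h1 := ha 1
  have h2 := ha 2
  have := Real.pi_pos
  unfold lawlorArea
  positivity

theorem hasDerivAt_lawlorPsi (ha : ∀ k, 0 < a k) (k : Fin 3) (y : ℝ) :
    HasDerivAt (lawlorPsi a k) (a k * lawlorIntegrand a k y) y := by
  have hint := integrable_lawlorIntegrand ha k
  have hc := (contDiff_lawlorIntegrand ha k).continuous
  have heq : lawlorPsi a k = fun y => a k * ((∫ x in (0 : ℝ)..y, lawlorIntegrand a k x) +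
      ∫ x in Set.Iic (0 : ℝ), lawlorIntegrand a k x) := by
    funext y
    rw [← intervalIntegral.integral_Iic_sub_Iic hint.integrableOn hint.integrableOn, sub_add_cancel]
    rfl
  rw [heq]
  exact ((intervalIntegral.integral_hasDerivAt_right (hc.intervalIntegrable _ _)
    (hc.stronglyMeasurableAtFilter _ _) hc.continuousAt).add_const _).const_mul _

theorem contDiff_lawlorPsi (ha : ∀ k, 0 < a k) (k : Fin 3) : ContDiff ℝ ∞ (lawlorPsi a k) := by
  refine contDiff_infty_iff_deriv.2 ⟨fun y => (hasDerivAt_lawlorPsi ha k y).differentiableAt, ?_⟩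
  rw [funext fun y => (hasDerivAt_lawlorPsi ha k y).deriv]
  exact contDiff_const.mul (contDiff_lawlorIntegrand ha k)

/-- The integral over the remaining half-line is positive, so ψ_k(y) < φ_k < π. -/
theorem lawlorPsi_mem_Ioo (ha : ∀ k, 0 < a k) (k : Fin 3) (y : ℝ) :
    lawlorPsi a k y ∈ Set.Ioo 0 Real.pi := by
  refine ⟨mul_pos (ha k) (setIntegral_lawlorIntegrand_pos ha k (by simp)), ?_⟩
  refine lt_trans ?_ ((isAngleTriple_lawlorAngle ha).1 k).2
  refine mul_lt_mul_of_pos_left ?_ (ha k)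
  have h1 := integral_add_compl (measurableSet_Iic (a := y)) (integrable_lawlorIntegrand ha k)
  have h2 := setIntegral_lawlorIntegrand_pos ha k (s := (Set.Iic y)ᶜ) (by simp)
  change ∫ x in Set.Iic y, lawlorIntegrand a k x < ∫ x, lawlorIntegrand a k x
  linarith

/-- The cotangent of the angle function `ψ_k`. -/
def lawlorCot (a : Fin 3 → ℝ) (k : Fin 3) (y : ℝ) : ℝ :=
  Real.cos (lawlorPsi a k y) / Real.sin (lawlorPsi a k y)

theorem sin_lawlorPsi_pos (ha : ∀ k, 0 < a k) (k : Fin 3) (y : ℝ) :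
    0 < Real.sin (lawlorPsi a k y) :=
  Real.sin_pos_of_mem_Ioo (lawlorPsi_mem_Ioo ha k y)

theorem contDiff_lawlorCot (ha : ∀ k, 0 < a k) (k : Fin 3) : ContDiff ℝ ∞ (lawlorCot a k) :=
  (Real.contDiff_cos.comp (contDiff_lawlorPsi ha k)).div
    (Real.contDiff_sin.comp (contDiff_lawlorPsi ha k)) fun y => (sin_lawlorPsi_pos ha k y).ne'

theorem exists_hasDerivAt_lawlorCot (ha : ∀ k, 0 < a k) (k : Fin 3) (y : ℝ) :
    ∃ c < 0, HasDerivAt (lawlorCot a k) c y := by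
  have hs := sin_lawlorPsi_pos ha k y
  refine ⟨_, ?_, ((hasDerivAt_lawlorPsi ha k y).cos).div ((hasDerivAt_lawlorPsi ha k y).sin) hs.ne'⟩
  refine div_neg_of_neg_of_pos ?_ (by positivity)
  have h1 := mul_pos (ha k) (lawlorIntegrand_pos ha k y)
  have h2 := Real.sin_sq_add_cos_sq (lawlorPsi a k y)
  nlinarith

theorem strictAnti_lawlorCot (ha : ∀ k, 0 < a k) (k : Fin 3) : StrictAnti (lawlorCot a k) := by
  refine strictAnti_of_deriv_neg fun y => ?_
  obtain ⟨c, hc, hd⟩ := exists_hasDerivAt_lawlorCot ha k y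
  rwa [hd.deriv]

theorem invFun_lawlorCot (ha : ∀ k, 0 < a k) (k : Fin 3) (y : ℝ) :
    Function.invFun (lawlorCot a k) (lawlorCot a k y) = y :=
  Function.leftInverse_invFun (strictAnti_lawlorCot ha k).injective y

/-- The derivative of the cotangent is nonzero, so the inverse function theorem gives a smooth local
inverse; injectivity forces the global inverse to agree with it nearby. -/
theorem contDiffAt_invFun_lawlorCot (ha : ∀ k, 0 < a k) (k : Fin 3) (y : ℝ) :
    ContDiffAt ℝ ∞ (Function.invFun (lawlorCot a k)) (lawlorCot a k y) := by
  obtain ⟨c, hc, hd⟩ := exists_hasDerivAt_lawlorCot ha k y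
  have hcd : ContDiffAt ℝ ∞ (lawlorCot a k) y := (contDiff_lawlorCot ha k).contDiffAt
  have hf' : HasFDerivAt (lawlorCot a k)
      ((ContinuousLinearEquiv.unitsEquivAut ℝ (Units.mk0 c hc.ne) : ℝ ≃L[ℝ] ℝ) : ℝ →L[ℝ] ℝ) y :=
    hd.hasFDerivAt_equiv hc.ne
  have hn : (∞ : WithTop ℕ∞) ≠ 0 := by simp
  refine (hcd.to_localInverse hf' hn).congr_of_eventuallyEq ?_
  have hright : ∀ᶠ w in 𝓝 (lawlorCot a k y),
      lawlorCot a k (hcd.localInverse hf' hn w) = w :=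
    (hcd.hasStrictFDerivAt' hf' hn).eventually_right_inverse
  filter_upwards [hright] with w hw
  conv_lhs => rw [← hw]
  rw [invFun_lawlorCot ha]

end LawlorAngles

/-! ### The diffeomorphism of Lawlor's neck with S² × ℝ. -/

section LawlorNeck

open Topology

variable {a : Fin 3 → ℝ}

theorem sqrt_inv_add_sq_pos (ha : ∀ k, 0 < a k) (k : Fin 3) (y : ℝ) :
    0 < √((a k)⁻¹ + y ^ 2) := by
  have := ha k
  exact Real.sqrt_pos.2 (by positivity)

theorem lawlorZ_re (a : Fin 3 → ℝ) (k : Fin 3) (y : ℝ) :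
    (lawlorZ a k y).re = Real.cos (lawlorPsi a k y) * √((a k)⁻¹ + y ^ 2) := by
  simp [lawlorZ, Complex.exp_ofReal_mul_I_re]

theorem lawlorZ_im (a : Fin 3 → ℝ) (k : Fin 3) (y : ℝ) :
    (lawlorZ a k y).im = Real.sin (lawlorPsi a k y) * √((a k)⁻¹ + y ^ 2) := by
  simp [lawlorZ, Complex.exp_ofReal_mul_I_im]

theorem lawlorZ_im_pos (ha : ∀ k, 0 < a k) (k : Fin 3) (y : ℝ) : 0 < (lawlorZ a k y).im := by
  rw [lawlorZ_im]
  exact mul_pos (sin_lawlorPsi_pos ha k y) (sqrt_inv_add_sq_pos ha k y)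

theorem lawlorZ_re_div_im (ha : ∀ k, 0 < a k) (k : Fin 3) (y : ℝ) :
    (lawlorZ a k y).re / (lawlorZ a k y).im = lawlorCot a k y := by
  rw [lawlorZ_im, lawlorZ_re, mul_div_mul_right _ _ (sqrt_inv_add_sq_pos ha k y).ne', lawlorCot]

/-- The parametrization of Lawlor's neck by `S² × ℝ`. -/
def neckMap (a : Fin 3 → ℝ) (p : EuclideanSpace ℝ (Fin 3) × ℝ) : EuclideanSpace ℂ (Fin 3) :=
  WithLp.toLp 2 fun k => lawlorZ a k p.2 * (p.1 k : ℂ)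

/-- The height function on Lawlor's neck, computed from the argument of a non-real coordinate. -/
def neckHeight (a : Fin 3 → ℝ) (z : EuclideanSpace ℂ (Fin 3)) : ℝ :=
  open Classical in
  if h : ∃ k, (z k).im ≠ 0 then
    Function.invFun (lawlorCot a h.choose) ((z h.choose).re / (z h.choose).im)
  else 0

/-- The inverse of `neckMap` on Lawlor's neck. -/
def neckInv (a : Fin 3 → ℝ) (z : EuclideanSpace ℂ (Fin 3)) : EuclideanSpace ℝ (Fin 3) × ℝ :=
  (WithLp.toLp 2 fun k =>
    (z k).im / (Real.sin (lawlorPsi a k (neckHeight a z)) * √((a k)⁻¹ + neckHeight a z ^ 2)),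
    neckHeight a z)

theorem contDiff_lawlorZ (ha : ∀ k, 0 < a k) (k : Fin 3) : ContDiff ℝ ∞ (lawlorZ a k) := by
  have h1 : ContDiff ℝ ∞ fun y => ((lawlorPsi a k y : ℝ) : ℂ) :=
    Complex.ofRealCLM.contDiff.comp (contDiff_lawlorPsi ha k)
  have h2 : ContDiff ℝ ∞ fun y : ℝ => √((a k)⁻¹ + y ^ 2) :=
    ContDiff.sqrt (by fun_prop) fun y => (Real.sqrt_pos.1 (sqrt_inv_add_sq_pos ha k y)).ne'
  have h3 : ContDiff ℝ ∞ fun y : ℝ => ((√((a k)⁻¹ + y ^ 2) : ℝ) : ℂ) :=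
    Complex.ofRealCLM.contDiff.comp h2
  exact (ContDiff.cexp (h1.mul contDiff_const)).mul h3

theorem contDiff_neckMap (ha : ∀ k, 0 < a k) : ContDiff ℝ ∞ (neckMap a) := by
  refine contDiff_piLp' 2 fun k => ?_
  refine ((contDiff_lawlorZ ha k).comp contDiff_snd).mul ?_
  exact Complex.ofRealCLM.contDiff.comp ((contDiff_piLp_apply 2).comp contDiff_fst)

theorem neckMap_im (a : Fin 3 → ℝ) (p : EuclideanSpace ℝ (Fin 3) × ℝ) (k : Fin 3) :
    (neckMap a p k).im = (lawlorZ a k p.2).im * p.1 k := by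
  simp [neckMap]

theorem neckMap_re (a : Fin 3 → ℝ) (p : EuclideanSpace ℝ (Fin 3) × ℝ) (k : Fin 3) :
    (neckMap a p k).re = (lawlorZ a k p.2).re * p.1 k := by
  simp [neckMap]

theorem neckMap_re_div_im (ha : ∀ k, 0 < a k) (p : EuclideanSpace ℝ (Fin 3) × ℝ)
    (k : Fin 3) (hk : (neckMap a p k).im ≠ 0) :
    (neckMap a p k).re / (neckMap a p k).im = lawlorCot a k p.2 := by
  rw [neckMap_im] at hk
  rw [neckMap_im, neckMap_re, mul_div_mul_right _ _ (right_ne_zero_of_mul hk),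
    lawlorZ_re_div_im ha]

/-- Each z_k(y) has positive imaginary part, so any nonzero coordinate of x gives a non-real
coordinate. This makes the height well defined on the neck. -/
theorem exists_neckMap_im_ne_zero (ha : ∀ k, 0 < a k) {p : EuclideanSpace ℝ (Fin 3) × ℝ}
    (hp : p.1 ≠ 0) : ∃ k, (neckMap a p k).im ≠ 0 := by
  by_contra! h
  refine hp ?_
  ext k
  have := h k
  rw [neckMap_im] at this
  exact (mul_eq_zero.1 this).resolve_left (lawlorZ_im_pos ha k _).ne'

theorem neckHeight_neckMap (ha : ∀ k, 0 < a k) {p : EuclideanSpace ℝ (Fin 3) × ℝ}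
    (hp : p.1 ≠ 0) : neckHeight a (neckMap a p) = p.2 := by
  have h := exists_neckMap_im_ne_zero ha hp
  rw [neckHeight, dif_pos h, neckMap_re_div_im ha p _ h.choose_spec, invFun_lawlorCot ha]

theorem neckInv_neckMap (ha : ∀ k, 0 < a k) {p : EuclideanSpace ℝ (Fin 3) × ℝ}
    (hp : p.1 ≠ 0) : neckInv a (neckMap a p) = p := by
  refine Prod.ext ?_ (neckHeight_neckMap ha hp)
  ext k
  simp only [neckInv, neckHeight_neckMap ha hp, neckMap_im, lawlorZ_im]
  rw [mul_comm, mul_div_assoc, div_self, mul_one]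
  exact (mul_pos (sin_lawlorPsi_pos ha k _) (sqrt_inv_add_sq_pos ha k _)).ne'

theorem ne_zero_of_mem_sphere_prod {p : EuclideanSpace ℝ (Fin 3) × ℝ}
    (hp : p ∈ Metric.sphere (0 : EuclideanSpace ℝ (Fin 3)) 1 ×ˢ (Set.univ : Set ℝ)) :
    p.1 ≠ 0 :=
  ne_zero_of_mem_unit_sphere ⟨p.1, hp.1⟩

theorem image_neckMap (a : Fin 3 → ℝ) :
    neckMap a '' (Metric.sphere (0 : EuclideanSpace ℝ (Fin 3)) 1 ×ˢ (Set.univ : Set ℝ)) =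
      lawlorNeck a := by
  have hs : ∀ x : EuclideanSpace ℝ (Fin 3), x ∈ Metric.sphere (0 : EuclideanSpace ℝ (Fin 3)) 1 ↔
      ∑ k, x k ^ 2 = 1 := fun x => by
    rw [mem_sphere_zero_iff_norm, ← sq_eq_sq₀ (norm_nonneg _) zero_le_one, one_pow,
      EuclideanSpace.real_norm_sq_eq]
  ext z
  constructor
  · rintro ⟨⟨x, y⟩, ⟨hx, -⟩, rfl⟩
    exact ⟨y, fun k => x k, (hs x).1 hx, fun k => rfl⟩
  · rintro ⟨y, x, hx, hz⟩
    refine ⟨(WithLp.toLp 2 x, y), ⟨(hs _).2 hx, trivial⟩, ?_⟩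
    ext k
    exact (hz k).symm

theorem contDiffOn_neckInv (ha : ∀ k, 0 < a k) : ContDiffOn ℝ ∞ (neckInv a) (lawlorNeck a) := by
  have hY : ContDiffOn ℝ ∞ (neckHeight a) (lawlorNeck a) := by
    rw [← image_neckMap]
    rintro _ ⟨p, hp, rfl⟩
    obtain ⟨k, hk⟩ := exists_neckMap_im_ne_zero ha (ne_zero_of_mem_sphere_prod hp)
    have hcoord : ContDiff ℝ ∞ fun z : EuclideanSpace ℂ (Fin 3) => z k := contDiff_piLp_apply 2
    have hre : ContDiff ℝ ∞ fun z : EuclideanSpace ℂ (Fin 3) => (z k).re :=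
      Complex.reCLM.contDiff.comp hcoord
    have him : ContDiff ℝ ∞ fun z : EuclideanSpace ℂ (Fin 3) => (z k).im :=
      Complex.imCLM.contDiff.comp hcoord
    have hq := hre.contDiffAt.div him.contDiffAt hk
    have hinv := contDiffAt_invFun_lawlorCot ha k p.2
    rw [← neckMap_re_div_im ha p k hk] at hinv
    -- The coordinate chosen in `neckHeight` may jump from point to point, but on the neck every
    -- non-real coordinate yields the same height. Near the given point the fixed coordinate k can
    -- be used throughout.
    refine (hinv.comp (neckMap a p) hq).contDiffWithinAt.congr_of_eventuallyEq_of_mem ?_ ⟨p, hp, rfl⟩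
    have hopen : {z : EuclideanSpace ℂ (Fin 3) | (z k).im ≠ 0} ∈ 𝓝 (neckMap a p) :=
      him.continuous.continuousAt.eventually_ne hk
    filter_upwards [self_mem_nhdsWithin, mem_nhdsWithin_of_mem_nhds hopen]
    rintro _ ⟨q, hq, rfl⟩ hqk
    rw [neckHeight_neckMap ha (ne_zero_of_mem_sphere_prod hq)]
    simp only [Function.comp_apply, Pi.div_apply]
    rw [neckMap_re_div_im ha q k hqk, invFun_lawlorCot ha]
  refine ContDiffOn.prodMk (contDiffOn_piLp' 2 fun k => ?_) hY
  have him : ContDiff ℝ ∞ fun z : EuclideanSpace ℂ (Fin 3) => (z k).im :=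
    Complex.imCLM.contDiff.comp (contDiff_piLp_apply 2)
  have h2 : ContDiff ℝ ∞ fun y : ℝ => √((a k)⁻¹ + y ^ 2) :=
    ContDiff.sqrt (by fun_prop) fun y => (Real.sqrt_pos.1 (sqrt_inv_add_sq_pos ha k y)).ne'
  have h3 : ContDiff ℝ ∞ fun y : ℝ => Real.sin (lawlorPsi a k y) * √((a k)⁻¹ + y ^ 2) :=
    (Real.contDiff_sin.comp (contDiff_lawlorPsi ha k)).mul h2
  exact him.contDiffOn.div (h3.comp_contDiffOn hY) fun z _ =>
    (mul_pos (sin_lawlorPsi_pos ha k _) (sqrt_inv_add_sq_pos ha k _)).ne'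

theorem areDiffeomorphic_lawlorNeck (ha : ∀ k, 0 < a k) :
    AreDiffeomorphic (Metric.sphere (0 : EuclideanSpace ℝ (Fin 3)) 1 ×ˢ (Set.univ : Set ℝ))
      (lawlorNeck a) := by
  have hl : Set.LeftInvOn (neckInv a) (neckMap a)
      (Metric.sphere (0 : EuclideanSpace ℝ (Fin 3)) 1 ×ˢ (Set.univ : Set ℝ)) := fun p hp =>
    neckInv_neckMap ha (ne_zero_of_mem_sphere_prod hp)
  refine ⟨neckMap a, neckInv a, (contDiff_neckMap ha).contDiffOn, contDiffOn_neckInv ha,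
    ?_, ?_, hl, ?_⟩
  · exact fun p hp => image_neckMap a ▸ Set.mem_image_of_mem _ hp
  · rw [← image_neckMap]
    rintro _ ⟨p, hp, rfl⟩
    rwa [hl hp]
  · rw [← image_neckMap]
    exact hl.rightInvOn_image

theorem AreDiffeomorphic.nonempty_homeomorph {E F : Type*} [NormedAddCommGroup E] [NormedSpace ℝ E]
    [NormedAddCommGroup F] [NormedSpace ℝ F] {S : Set E} {T : Set F} (h : AreDiffeomorphic S T) :
    Nonempty (S ≃ₜ T) := by
  obtain ⟨f, g, hf, hg, hfm, hgm, hl, hr⟩ := h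
  exact ⟨{ toFun := hfm.restrict f S T
           invFun := hgm.restrict g T S
           left_inv := fun x => Subtype.ext (hl x.2)
           right_inv := fun x => Subtype.ext (hr x.2)
           continuous_toFun := hf.continuousOn.mapsToRestrict hfm
           continuous_invFun := hg.continuousOn.mapsToRestrict hgm }⟩

end LawlorNeck

/-! ### Closed singular 1-cochains on a punctured vector space of dimension at least 3. -/

section PathClass

variable {V : Type*} [NormedAddCommGroup V] [NormedSpace ℝ V]
  {W : Type*} [AddCommGroup W] [Module ℝ W] [TopologicalSpace W] [IsTopologicalAddGroup W]
  [ContinuousSMul ℝ W] {W' : Type*} [AddCommGroup W'] [Module ℝ W'] [TopologicalSpace W']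
  [IsTopologicalAddGroup W'] [ContinuousSMul ℝ W'] {A : Type*} [AddCommGroup A]

/-- The `i`-th face of a singular `2`-simplex. -/
def simplexFace {X : Type*} [TopologicalSpace X] (τ : C(stdSimplex ℝ (Fin 3), X)) (i : Fin 3) :
    C(stdSimplex ℝ (Fin 2), X) :=
  τ.comp ⟨stdSimplex.map i.succAbove, stdSimplex.continuous_map _⟩

/-- A function on singular `1`-simplices which vanishes on boundaries of singular `2`-simplices. -/
def IsClosedCochain {X : Type*} [TopologicalSpace X] (c : C(stdSimplex ℝ (Fin 2), X) → A) : Prop :=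
  ∀ τ : C(stdSimplex ℝ (Fin 3), X),
    c (simplexFace τ 2) + c (simplexFace τ 0) = c (simplexFace τ 1)

/-- The value of `c` on the singular simplex in `V \ {0}` obtained by restricting `H` to the
segment from `P` to `Q`. -/
def pathClass (c : C(stdSimplex ℝ (Fin 2), {x : V // x ≠ 0}) → A) (H : W → V) (P Q : W) : A :=
  open Classical in
  if h : Continuous H ∧ ∀ p : stdSimplex ℝ (Fin 2), H (p 0 • P + p 1 • Q) ≠ 0 then
    c ⟨fun p => ⟨H (p 0 • P + p 1 • Q), h.2 p⟩, by
      refine Continuous.subtype_mk (h.1.comp ?_) _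
      have : ∀ i, Continuous fun p : stdSimplex ℝ (Fin 2) => p i := fun i =>
        (continuous_apply i).comp continuous_subtype_val
      exact ((this 0).smul continuous_const).add ((this 1).smul continuous_const)⟩
  else 0

theorem pathClass_congr (c : C(stdSimplex ℝ (Fin 2), {x : V // x ≠ 0}) → A) {H : W → V}
    {H' : W' → V} (hH : Continuous H) (hH' : Continuous H') {P Q : W} {P' Q' : W'}
    (h : ∀ p : stdSimplex ℝ (Fin 2), H (p 0 • P + p 1 • Q) = H' (p 0 • P' + p 1 • Q')) :
    pathClass c H P Q = pathClass c H' P' Q' := by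
  by_cases hne : ∀ p : stdSimplex ℝ (Fin 2), H' (p 0 • P' + p 1 • Q') ≠ 0
  · rw [pathClass, dif_pos ⟨hH, fun p => h p ▸ hne p⟩, pathClass, dif_pos ⟨hH', hne⟩]
    congr 1
    ext p
    exact h p
  · rw [pathClass, dif_neg, pathClass, dif_neg] <;> simp_all

theorem stdSimplex_map_apply {m n : ℕ} (f : Fin m → Fin n) (p : stdSimplex ℝ (Fin m)) (i : Fin n) :
    stdSimplex.map f p i = ∑ j with f j = i, p j := by
  rw [stdSimplex.map_coe, FunOnFinite.linearMap_apply_apply]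

/-- Closedness of c is applied to the singular triangle obtained by restricting H to P, Q, R. -/
theorem pathClass_add_of_forall {c : C(stdSimplex ℝ (Fin 2), {x : V // x ≠ 0}) → A}
    (hc : IsClosedCochain c) {H : W → V} (hH : Continuous H) {P Q R : W}
    (h : ∀ p : stdSimplex ℝ (Fin 3), H (p 0 • P + p 1 • Q + p 2 • R) ≠ 0) :
    pathClass c H P Q + pathClass c H Q R = pathClass c H P R := by
  have hcont : ∀ i, Continuous fun p : stdSimplex ℝ (Fin 3) => p i := fun i =>
    (continuous_apply i).comp continuous_subtype_val
  let τ : C(stdSimplex ℝ (Fin 3), {x : V // x ≠ 0}) :=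
    ⟨fun p => ⟨H (p 0 • P + p 1 • Q + p 2 • R), h p⟩, Continuous.subtype_mk (hH.comp
      ((((hcont 0).smul continuous_const).add ((hcont 1).smul continuous_const)).add
        ((hcont 2).smul continuous_const))) _⟩
  have h2 : ∀ p : stdSimplex ℝ (Fin 2),
      (simplexFace τ 2 p : V) = H (p 0 • P + p 1 • Q) := fun p => by
    have e0 : (2 : Fin 3).succAbove (0 : Fin 2) = 0 := rfl
    have e1 : (2 : Fin 3).succAbove (1 : Fin 2) = 1 := rfl
    simp [simplexFace, τ, stdSimplex_map_apply, Finset.sum_filter, Fin.sum_univ_two, e0, e1]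
  have h0 : ∀ p : stdSimplex ℝ (Fin 2),
      (simplexFace τ 0 p : V) = H (p 0 • Q + p 1 • R) := fun p => by
    have e0 : (0 : Fin 3).succAbove (0 : Fin 2) = 1 := rfl
    have e1 : (0 : Fin 3).succAbove (1 : Fin 2) = 2 := rfl
    simp only [simplexFace, τ, ContinuousMap.comp_apply, ContinuousMap.coe_mk, stdSimplex_map_apply,
      Finset.sum_filter, Fin.sum_univ_two, e0, e1]
    simp
  have h1 : ∀ p : stdSimplex ℝ (Fin 2),
      (simplexFace τ 1 p : V) = H (p 0 • P + p 1 • R) := fun p => by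
    have e0 : (1 : Fin 3).succAbove (0 : Fin 2) = 0 := rfl
    have e1 : (1 : Fin 3).succAbove (1 : Fin 2) = 2 := rfl
    simp [simplexFace, τ, stdSimplex_map_apply, Finset.sum_filter, Fin.sum_univ_two, e0, e1]
  have key : ∀ (σ : C(stdSimplex ℝ (Fin 2), {x : V // x ≠ 0})) (S T : W),
      (∀ p, (σ p : V) = H (p 0 • S + p 1 • T)) → pathClass c H S T = c σ := by
    intro σ S T hσ
    rw [pathClass, dif_pos ⟨hH, fun p => hσ p ▸ (σ p).2⟩]
    congr 1
    ext p
    exact (hσ p).symm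
  rw [key _ _ _ h2, key _ _ _ h0, key _ _ _ h1]
  exact hc τ

theorem pathClass_add {c : C(stdSimplex ℝ (Fin 2), {x : V // x ≠ 0}) → A}
    (hc : IsClosedCochain c) {H : W → V} (hH : Continuous H) {D : Set W} (hD : Convex ℝ D)
    (hne : ∀ x ∈ D, H x ≠ 0) {P Q R : W} (hP : P ∈ D) (hQ : Q ∈ D) (hR : R ∈ D) :
    pathClass c H P Q + pathClass c H Q R = pathClass c H P R := by
  refine pathClass_add_of_forall hc hH fun p => hne _ ?_
  have := hD.sum_mem (t := Finset.univ) (w := p) (z := ![P, Q, R]) (fun i _ => p.2.1 i)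
    (stdSimplex.sum_eq_one p) (fun i _ => by fin_cases i <;> assumption)
  simpa [Fin.sum_univ_three] using this

theorem pathClass_self {c : C(stdSimplex ℝ (Fin 2), {x : V // x ≠ 0}) → A}
    (hc : IsClosedCochain c) {H : W → V} (hH : Continuous H) {P : W} (hP : H P ≠ 0) :
    pathClass c H P P = 0 := by
  have := pathClass_add hc hH (convex_singleton P) (by simpa using hP) (Set.mem_singleton P)
    (Set.mem_singleton P) (Set.mem_singleton P)
  simpa using this

theorem pathClass_eq_of_mem_convex {c : C(stdSimplex ℝ (Fin 2), {x : V // x ≠ 0}) → A}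
    (hc : IsClosedCochain c) {f : ℝ → V} (hf : Continuous f) {B : Set V} (hB : Convex ℝ B)
    (h0 : (0 : V) ∉ B) {u v : ℝ} (huv : ∀ t ∈ Set.uIcc u v, f t ∈ B) :
    pathClass c f u v = pathClass c (id : V → V) (f u) (f v) := by
  -- Straight-line homotopy from f on [u, v] to the segment from f u to f v. It stays in B, its two
  -- lateral sides are constant, and the diagonal splits the square into two triangles.
  let H : ℝ × ℝ → V := fun p =>
    (1 - p.1) • f (u + p.2 * (v - u)) + p.1 • ((1 - p.2) • f u + p.2 • f v)
  have hH : Continuous H := by fun_prop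
  have hu : f u ∈ B := huv u Set.left_mem_uIcc
  have hv : f v ∈ B := huv v Set.right_mem_uIcc
  have hD : Convex ℝ (Set.Icc (0 : ℝ) 1 ×ˢ Set.Icc (0 : ℝ) 1) :=
    (convex_Icc 0 1).prod (convex_Icc 0 1)
  have hne : ∀ p ∈ Set.Icc (0 : ℝ) 1 ×ˢ Set.Icc (0 : ℝ) 1, H p ≠ 0 := by
    rintro ⟨s, t⟩ ⟨hs, ht⟩ h
    refine h0 (h ▸ hB (huv _ ?_) (hB hu hv ?_ ?_ ?_) ?_ ?_ ?_)
    · have := (convex_uIcc u v) Set.left_mem_uIcc Set.right_mem_uIcc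
        (sub_nonneg.2 ht.2) ht.1 (sub_add_cancel 1 t)
      convert this using 1
      simp only [smul_eq_mul]; ring
    all_goals first | exact hs.1 | exact ht.1 | exact sub_nonneg.2 hs.2 | exact sub_nonneg.2 ht.2 |
      exact sub_add_cancel 1 _
  have m00 : ((0, 0) : ℝ × ℝ) ∈ Set.Icc (0 : ℝ) 1 ×ˢ Set.Icc (0 : ℝ) 1 := by simp
  have m01 : ((0, 1) : ℝ × ℝ) ∈ Set.Icc (0 : ℝ) 1 ×ˢ Set.Icc (0 : ℝ) 1 := by simp
  have m10 : ((1, 0) : ℝ × ℝ) ∈ Set.Icc (0 : ℝ) 1 ×ˢ Set.Icc (0 : ℝ) 1 := by simp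
  have m11 : ((1, 1) : ℝ × ℝ) ∈ Set.Icc (0 : ℝ) 1 ×ˢ Set.Icc (0 : ℝ) 1 := by simp
  have a1 := pathClass_add hc hH hD hne m00 m01 m11
  have a2 := pathClass_add hc hH hD hne m00 m10 m11
  have hp : ∀ p : stdSimplex ℝ (Fin 2), p 0 = 1 - p 1 := fun p =>
    eq_sub_of_add_eq (stdSimplex.add_eq_one p)
  have e1 : pathClass c H (0, 0) (0, 1) = pathClass c f u v := by
    refine pathClass_congr c hH hf fun p => ?_
    simp only [H, Prod.smul_mk, Prod.mk_add_mk, smul_eq_mul, hp]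
    simp only [mul_zero, mul_one, zero_add, sub_zero, one_smul, zero_smul, add_zero]
    congr 1; ring
  have e2 : pathClass c H (1, 0) (1, 1) = pathClass c (id : V → V) (f u) (f v) := by
    refine pathClass_congr c hH continuous_id fun p => ?_
    simp only [H, Prod.smul_mk, Prod.mk_add_mk, smul_eq_mul, hp]
    simp
  have e3 : pathClass c H (0, 1) (1, 1) = 0 := by
    rw [← pathClass_self hc continuous_id (P := f v) fun h => h0 (by rwa [id, ← h] at *)]
    refine pathClass_congr c hH continuous_id fun p => ?_
    simp only [H, Prod.smul_mk, Prod.mk_add_mk, smul_eq_mul, hp]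
    simp [← add_smul]
  have e4 : pathClass c H (0, 0) (1, 0) = 0 := by
    rw [← pathClass_self hc continuous_id (P := f u) fun h => h0 (by rwa [id, ← h] at *)]
    refine pathClass_congr c hH continuous_id fun p => ?_
    simp only [H, Prod.smul_mk, Prod.mk_add_mk, smul_eq_mul, hp]
    simp [← add_smul]
  rw [e1, e3, add_zero] at a1
  rw [e2, e4, zero_add] at a2
  rw [a1, a2]

/-- Two vectors span a proper subspace, and a real vector space is not a finite union of proper
subspaces. -/
theorem exists_notMem_span_pair (hV : 2 < Module.finrank ℝ V) (s : Finset (V × V)) :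
    ∃ q : V, ∀ p ∈ s, q ∉ Submodule.span ℝ {p.1, p.2} := by
  classical
  have h : ⊤ ∉ s.image fun p => Submodule.span ℝ {p.1, p.2} := by
    intro h
    obtain ⟨p, -, hp⟩ := Finset.mem_image.1 h
    have h1 := finrank_span_finset_le_card (R := ℝ) ({p.1, p.2} : Finset V)
    rw [Set.finrank, Finset.coe_pair, hp, finrank_top] at h1
    have := Finset.card_le_two (a := p.1) (b := p.2)
    omega
  have := Subspace.biUnion_ne_univ_of_top_notMem h
  rw [Set.ne_univ_iff_exists_notMem] at this
  obtain ⟨q, hq⟩ := this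
  refine ⟨q, fun p hp hqp => hq ?_⟩
  simp only [Set.mem_iUnion]
  exact ⟨_, Finset.mem_image_of_mem _ hp, hqp⟩

/-- A convex combination of q, a, b that vanishes must have q-coefficient zero, so the triangle
could meet the origin only on the edge from a to b. -/
theorem pathClass_add_of_notMem_span {c : C(stdSimplex ℝ (Fin 2), {x : V // x ≠ 0}) → A}
    (hc : IsClosedCochain c) {q a b : V} (hq : q ∉ Submodule.span ℝ {a, b})
    (hab : ∀ p : stdSimplex ℝ (Fin 2), p 0 • a + p 1 • b ≠ 0) :
    pathClass c (id : V → V) q a + pathClass c id a b = pathClass c id q b := by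
  refine pathClass_add_of_forall hc continuous_id fun p h => ?_
  rw [id, add_assoc] at h
  have hs := stdSimplex.sum_eq_one p
  rw [Fin.sum_univ_three] at hs
  by_cases h0 : p 0 = 0
  · refine hab ⟨![p 1, p 2], fun i => by fin_cases i <;> exact p.2.1 _, ?_⟩ ?_
    · simpa [h0] using hs
    · change p 1 • a + p 2 • b = 0
      rwa [h0, zero_smul, zero_add] at h
  · refine hq ?_
    have hm : p 0 • q ∈ Submodule.span ℝ {a, b} := by
      rw [eq_neg_of_add_eq_zero_left h]
      exact Submodule.neg_mem _ (Submodule.mem_span_pair.2 ⟨_, _, rfl⟩)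
    simpa [smul_smul, inv_mul_cancel₀ h0] using Submodule.smul_mem _ (p 0)⁻¹ hm

theorem segment_ne_zero_of_notMem_span {a b x : V} (hb : b ∉ Submodule.span ℝ {a, x}) (ha : a ≠ 0)
    (p : stdSimplex ℝ (Fin 2)) : p 0 • a + p 1 • b ≠ 0 := by
  intro h
  have hs := stdSimplex.add_eq_one p
  by_cases h1 : p 1 = 0
  · rw [h1, add_zero] at hs
    simp [h1, hs, ha] at h
  · refine hb ?_
    have hm : p 1 • b ∈ Submodule.span ℝ {a, x} := by
      rw [eq_neg_of_add_eq_zero_right h]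
      exact Submodule.neg_mem _ (Submodule.smul_mem _ _ (Submodule.subset_span (by simp)))
    simpa [smul_smul, inv_mul_cancel₀ h1] using Submodule.smul_mem _ (p 1)⁻¹ hm

/-- A curve in `V \ {0}` can be cut into finitely many pieces, each of which lies in a convex set
which does not contain the origin. -/
theorem exists_convex_partition {f : ℝ → V} (hf : Continuous f) (hne : ∀ t, f t ≠ 0) :
    ∃ (N : ℕ) (u : ℕ → ℝ), u 0 = 0 ∧ u N = 1 ∧ ∀ i < N, ∃ B : Set V, Convex ℝ B ∧ (0 : V) ∉ B ∧
      ∀ t ∈ Set.uIcc (u i) (u (i + 1)), f t ∈ B := by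
  obtain ⟨t₀, -, ht₀⟩ := (isCompact_Icc (a := (0 : ℝ)) (b := 1)).exists_isMinOn ⟨0, by simp⟩
    hf.norm.continuousOn
  have hr : 0 < ‖f t₀‖ := norm_pos_iff.2 (hne t₀)
  have huc := (isCompact_Icc (a := (0 : ℝ)) (b := 1)).uniformContinuousOn_of_continuous
    hf.continuousOn
  obtain ⟨δ, hδ, hδf⟩ := Metric.uniformContinuousOn_iff.1 huc _ hr
  obtain ⟨N, hN⟩ := exists_nat_one_div_lt hδ
  have hN0 : (0 : ℝ) < (N : ℝ) + 1 := by positivity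
  -- The balls have radius min |f| over [0, 1] and centre f(u i), so they cannot contain the origin.
  refine ⟨N + 1, fun i => i / ((N : ℝ) + 1), by simp, by push_cast; exact div_self hN0.ne',
    fun i hi => ⟨Metric.ball (f (i / ((N : ℝ) + 1))) ‖f t₀‖, convex_ball _ _, ?_, ?_⟩⟩
  · have hi' : (i : ℝ) ≤ (N : ℝ) + 1 := by exact_mod_cast hi.le
    have hm : (i / ((N : ℝ) + 1)) ∈ Set.Icc (0 : ℝ) 1 := ⟨by positivity, (div_le_one hN0).2 hi'⟩
    rw [mem_ball_iff_norm, zero_sub, norm_neg, not_lt]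
    exact ht₀ hm
  · intro t ht
    have hi' : ((i + 1 : ℕ) : ℝ) ≤ (N : ℝ) + 1 := by exact_mod_cast hi
    have hle : (i : ℝ) / ((N : ℝ) + 1) ≤ ((i + 1 : ℕ) : ℝ) / ((N : ℝ) + 1) := by
      gcongr; simp
    have h1 : ((i + 1 : ℕ) : ℝ) / ((N : ℝ) + 1) ≤ 1 := (div_le_one hN0).2 hi'
    have h0 : 0 ≤ (i : ℝ) / ((N : ℝ) + 1) := by positivity
    rw [Set.uIcc_of_le hle] at ht
    refine hδf _ ⟨h0.trans ht.1, ht.2.trans h1⟩ _ ⟨h0, hle.trans h1⟩ ?_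
    rw [Real.dist_eq, abs_of_nonneg (sub_nonneg.2 ht.1)]
    refine lt_of_le_of_lt ?_ hN
    have : ((i + 1 : ℕ) : ℝ) / ((N : ℝ) + 1) = i / ((N : ℝ) + 1) + 1 / ((N : ℝ) + 1) := by
      push_cast; ring
    linarith [ht.2]

/-- Every closed singular `1`-cochain on the complement of the origin in a real vector space of
dimension at least three is the coboundary of a function. -/
theorem exists_potential (hV : 2 < Module.finrank ℝ V)
    {c : C(stdSimplex ℝ (Fin 2), {x : V // x ≠ 0}) → A} (hc : IsClosedCochain c) :
    ∃ g : V → A, ∀ σ : C(stdSimplex ℝ (Fin 2), {x : V // x ≠ 0}),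
      c σ = g (σ (stdSimplex.vertex 1)) - g (σ (stdSimplex.vertex 0)) := by
  classical
  have : Nontrivial V := Module.nontrivial_of_finrank_pos (R := ℝ) (by omega)
  obtain ⟨e, he⟩ := exists_ne (0 : V)
  -- The potential at a is the value of c along e → w a → a. The detour is needed because the
  -- segment from e to a may meet the origin.
  choose w hw using fun a : V => exists_notMem_span_pair hV {(a, e)}
  simp only [Finset.mem_singleton, forall_eq] at hw
  refine ⟨fun a => pathClass c (id : V → V) e (w a) - pathClass c id a (w a), fun σ => ?_⟩
  let f : ℝ → V := fun t => σ (stdSimplexHomeomorphUnitInterval.symm (Set.projIcc 0 1 zero_le_one t))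
  have hf : Continuous f := by
    refine continuous_subtype_val.comp (σ.continuous.comp ?_)
    exact stdSimplexHomeomorphUnitInterval.symm.continuous.comp continuous_projIcc
  have hne : ∀ t, f t ≠ 0 := fun t => (σ _).2
  have hσ : ∀ p, f (p 1) = σ p := fun p => by
    have : stdSimplexHomeomorphUnitInterval.symm (Set.projIcc 0 1 zero_le_one (p 1)) = p := by
      rw [Homeomorph.symm_apply_eq]
      ext
      exact congrArg Subtype.val (Set.projIcc_of_mem zero_le_one
        (show p 1 ∈ Set.Icc (0 : ℝ) 1 from ⟨p.2.1 1, stdSimplex.le_one p 1⟩))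
    simp only [f, this]
  have hcσ : c σ = pathClass c f 0 1 := by
    have : ∀ p : stdSimplex ℝ (Fin 2), f (p 0 • 0 + p 1 • 1) = σ p := fun p => by
      simpa using hσ p
    rw [pathClass, dif_pos ⟨hf, fun p => hne _⟩]
    congr 1
    ext p
    exact (this p).symm
  obtain ⟨N, u, hu0, huN, hB⟩ := exists_convex_partition hf hne
  -- These are all the edges to be coned off from q: the polygon inscribed in the path, and the
  -- detours that define the potential at its two endpoints.
  let s : Finset (V × V) := insert (f 0, w (f 0)) (insert (e, w (f 0)) (insert (f 1, w (f 1))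
    (insert (e, w (f 1)) ((Finset.range N).image fun i => (f (u i), f (u (i + 1)))))))
  obtain ⟨q, hq⟩ := exists_notMem_span_pair hV s
  have hstep : ∀ n ≤ N, pathClass c f (u 0) (u n) =
      pathClass c (id : V → V) q (f (u n)) - pathClass c id q (f (u 0)) := by
    intro n
    induction n with
    | zero => intro _; rw [sub_self, pathClass_self hc hf (hne _)]
    | succ n ih =>
      intro hn
      obtain ⟨B, hB1, hB2, hB3⟩ := hB n hn
      rw [← pathClass_add hc hf convex_univ (fun t _ => hne t) (Set.mem_univ _)
        (Set.mem_univ (u n)) (Set.mem_univ _), ih (by omega),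
        pathClass_eq_of_mem_convex hc hf hB1 hB2 hB3, ← pathClass_add_of_notMem_span hc
        (hq (f (u n), f (u (n + 1))) ?_) fun p h => hB2 ?_]
      · abel
      · simp only [s, Finset.mem_insert, Finset.mem_image, Finset.mem_range]
        exact Or.inr <| Or.inr <| Or.inr <| Or.inr ⟨n, hn, rfl⟩
      · rw [← h]
        exact hB1 (hB3 _ Set.left_mem_uIcc) (hB3 _ Set.right_mem_uIcc) (p.2.1 0) (p.2.1 1)
          (stdSimplex.add_eq_one p)
  -- Seen from the generic point q, the potential at a is the value of c from q to a, up to a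
  -- constant independent of a.
  have hw_eq : ∀ a : V, a ≠ 0 → (a, w a) ∈ s → (e, w a) ∈ s →
      pathClass c (id : V → V) e (w a) - pathClass c id a (w a) =
        pathClass c id q a - pathClass c id q e := by
    intro a ha h1 h2
    have k1 := pathClass_add_of_notMem_span hc (hq _ h1) (segment_ne_zero_of_notMem_span (hw a) ha)
    have k2 := pathClass_add_of_notMem_span hc (hq _ h2)
      (segment_ne_zero_of_notMem_span (Set.pair_comm a e ▸ hw a) he)
    rw [eq_sub_of_add_eq' k1, eq_sub_of_add_eq' k2]
    abel
  have hv1 : (σ (stdSimplex.vertex 1) : V) = f 1 := by rw [← hσ]; simp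
  have hv0 : (σ (stdSimplex.vertex 0) : V) = f 0 := by rw [← hσ]; simp
  rw [hv1, hv0, hcσ]
  beta_reduce
  rw [hw_eq _ (hne _) (by simp [s]) (by simp [s]), hw_eq _ (hne _) (by simp [s])
    (by simp [s])]
  have := hstep N le_rfl
  rw [hu0, huN] at this
  rw [this]
  abel

end PathClass

/-! ### From exactness of cochains to the vanishing of the first Betti number. -/

section FirstHomology

open CategoryTheory Limits Opposite Simplicial

variable {C : Type*} [Category.{0} C] [Abelian C] [HasCoproducts.{0} C]

/-- If every closed singular `1`-cochain is the coboundary of a function, then the first singular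
homology vanishes. -/
theorem isZero_singularHomology_one (X : TopCat.{0}) (R : C)
    (h : ∀ (Q : C) (c : C(stdSimplex ℝ (Fin 2), X) → (R ⟶ Q)), IsClosedCochain c →
      ∃ g : X → (R ⟶ Q), ∀ σ : C(stdSimplex ℝ (Fin 2), X),
        c σ = g (σ (stdSimplex.vertex 1)) - g (σ (stdSimplex.vertex 0))) :
    IsZero (((AlgebraicTopology.singularHomologyFunctor C 1).obj R).obj X) := by
  let S : SSet := TopCat.toSSet.obj X
  let K := S.chainComplex R
  change IsZero (K.homology 1)
  refine HomologicalComplex.ExactAt.isZero_homology ?_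
  rw [K.exactAt_iff' 2 1 0 (by simp) (by simp),
    ShortComplex.exact_iff_kernel_ι_comp_cokernel_π_zero]
  -- The tautological cochain sends a simplex to its class modulo boundaries, with values in
  -- morphisms from R to the cokernel. It is closed because d ≫ π = 0, and its potential is a map G
  -- on 0-chains with d ≫ G = π; hence π kills all cycles.
  let π : K.X 1 ⟶ cokernel (K.d 2 1) := cokernel.π (K.d 2 1)
  have hπ : K.d 2 1 ≫ π = 0 := cokernel.condition _
  obtain ⟨g, hg⟩ := h _ (fun σ => S.ιChainComplex ((X.toSSetObjEquiv (op ⦋1⦌)).symm σ) ≫ π) (by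
    intro τ
    have h1 := S.ιChainComplex_d_assoc (R := R) ((X.toSSetObjEquiv (op ⦋2⦌)).symm τ) π
    have hδ : ∀ i, S.δ i ((X.toSSetObjEquiv (op ⦋2⦌)).symm τ) =
      (X.toSSetObjEquiv (op ⦋1⦌)).symm (simplexFace τ i) := fun _ => rfl
    rw [hπ, comp_zero, Fin.sum_univ_three, hδ, hδ, hδ] at h1
    simp only [Fin.val_zero, Fin.val_one, Fin.val_two, pow_zero, one_smul, pow_one, neg_smul,
      even_two, Even.neg_pow, one_pow, Preadditive.add_comp, Preadditive.neg_comp] at h1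
    rw [← sub_eq_zero]
    refine Eq.trans ?_ h1.symm
    abel)
  let G : K.X 0 ⟶ cokernel (K.d 2 1) :=
    Cofan.IsColimit.desc (S.isColimitChainComplexXCofan R 0)
      fun x => g (X.toSSetObjEquiv (op ⦋0⦌) x (stdSimplex.vertex 0))
  have hG : ∀ x, S.ιChainComplex x ≫ G =
    g (X.toSSetObjEquiv (op ⦋0⦌) x (stdSimplex.vertex 0)) := fun x =>
      Cofan.IsColimit.fac (S.isColimitChainComplexXCofan R 0) _ x
  have hdG : K.d 1 0 ≫ G = π := by
    refine SSet.chainComplex_hom_ext fun x => ?_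
    rw [SSet.ιChainComplex_d_assoc]
    obtain ⟨σ, rfl⟩ := (X.toSSetObjEquiv (op ⦋1⦌)).symm.surjective x
    rw [hg σ]
    have hδ0 : X.toSSetObjEquiv (op ⦋0⦌) (S.δ 0 ((X.toSSetObjEquiv (op ⦋1⦌)).symm σ))
        (stdSimplex.vertex 0) = σ (stdSimplex.vertex 1) :=
      congrArg σ (stdSimplex.map_vertex _ _)
    have hδ1 : X.toSSetObjEquiv (op ⦋0⦌) (S.δ 1 ((X.toSSetObjEquiv (op ⦋1⦌)).symm σ))
        (stdSimplex.vertex 0) = σ (stdSimplex.vertex 0) :=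
      congrArg σ (stdSimplex.map_vertex _ _)
    rw [Fin.sum_univ_two, Preadditive.add_comp, Preadditive.zsmul_comp, Preadditive.zsmul_comp, hG,
      hG, hδ0, hδ1]
    simp [sub_eq_add_neg]
  change kernel.ι (K.d 1 0) ≫ π = 0
  rw [← hdG, kernel.condition_assoc, zero_comp]

/-- The first Betti number of a space homeomorphic to the product of the unit sphere in a real
vector space of dimension at least three and the real line is zero. -/
theorem firstBetti_eq_zero {V : Type} [NormedAddCommGroup V] [NormedSpace ℝ V]
    (hV : 2 < Module.finrank ℝ V) {Y : Type} [TopologicalSpace Y]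
    (e : Y ≃ₜ Metric.sphere (0 : V) 1 × ℝ) : firstBetti Y = 0 := by
  have hz : IsZero (((AlgebraicTopology.singularHomologyFunctor (ModuleCat.{0} ℝ) 1).obj
      (ModuleCat.of ℝ ℝ)).obj (TopCat.of {x : V // x ≠ 0})) :=
    isZero_singularHomology_one _ _ fun Q c hc => by
      obtain ⟨g, hg⟩ := exists_potential hV hc
      exact ⟨fun x => g x.1, hg⟩
  -- The exponential turns the line into the positive radii, and polar coordinates do the rest.
  let e' : Y ≃ₜ ({0}ᶜ : Set V) :=
    (e.trans ((Homeomorph.refl _).prodCongr Real.expOrderIso.toHomeomorph)).trans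
      (homeomorphUnitSphereProd V).symm
  let i : TopCat.of Y ≅ TopCat.of {x : V // x ≠ 0} := TopCat.isoOfHomeo e'
  have hz' := hz.of_iso ((((AlgebraicTopology.singularHomologyFunctor (ModuleCat.{0} ℝ) 1).obj
      (ModuleCat.of ℝ ℝ)).mapIso i))
  have := ModuleCat.subsingleton_of_isZero hz'
  rw [firstBetti, rank_subsingleton']
  simp

theorem firstBetti_lawlorNeck {a : Fin 3 → ℝ} (ha : ∀ k, 0 < a k) :
    firstBetti (lawlorNeck a) = 0 := by
  obtain ⟨e⟩ := (areDiffeomorphic_lawlorNeck ha).nonempty_homeomorph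
  exact firstBetti_eq_zero (V := EuclideanSpace ℝ (Fin 3)) (by simp)
    ((e.symm.trans (Homeomorph.Set.prod _ _)).trans
      ((Homeomorph.refl _).prodCongr (Homeomorph.Set.univ ℝ)))

end FirstHomology

end SLCone

end

/-! ### Assembly of both parts. -/

theorem lemma5p2 :
    (∀ φ : Fin 3 → ℝ, SLCone.IsAngleTriple φ →
      SLCone.components (SLCone.link (SLCone.planePair φ)) =
        {SLCone.link (SLCone.slPlane 0), SLCone.link (SLCone.slPlane φ)} ∧
      SLCone.numEnds (SLCone.planePair φ) = 2 ∧
      (∀ S ∈ SLCone.components (SLCone.link (SLCone.planePair φ)),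
        Nonempty (S ≃ᵢ Metric.sphere (0 : EuclideanSpace ℝ (Fin 3)) 1) ∧
        (∀ c ∈ Set.Ioo (0 : ℝ) 6, SLCone.IsEigenvalue S c ↔ c = 2) ∧
        SLCone.multiplicity S 2 = 3 ∧
        SLCone.multiplicity S 6 = 5 ∧
        Nonempty (SLCone.stabilizerSU S ≃ₜ* Matrix.specialOrthogonalGroup (Fin 3) ℝ) ∧
        SLCone.dimStabilizerSU S = 3) ∧
      SLCone.dimSU 3 = 8 ∧
      SLCone.legendrianIndex (SLCone.planePair φ) = 6 ∧
      SLCone.IsRigid (SLCone.planePair φ)) ∧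
    (∀ a : Fin 3 → ℝ, (∀ k, 0 < a k) →
      SLCone.IsAngleTriple (SLCone.lawlorAngle a) ∧
      0 < SLCone.lawlorArea a ∧
      SLCone.AreDiffeomorphic
        (Metric.sphere (0 : EuclideanSpace ℝ (Fin 3)) 1 ×ˢ (Set.univ : Set ℝ))
        (SLCone.lawlorNeck a) ∧
      SLCone.firstBetti (SLCone.lawlorNeck a) = 0) := by
  refine ⟨fun φ hφ => ?_, fun a ha => ⟨SLCone.isAngleTriple_lawlorAngle ha,
    SLCone.lawlorArea_pos ha, SLCone.areDiffeomorphic_lawlorNeck ha,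
    SLCone.firstBetti_lawlorNeck ha⟩⟩
  have hcomp := SLCone.components_planePair hφ.1
  have hex : ∀ S ∈ SLCone.components (SLCone.link (SLCone.planePair φ)),
      ∃ ψ : Fin 3 → ℝ, S = SLCone.sphereImage (SLCone.planeEmbedding ψ) := by
    rw [hcomp]
    rintro S (rfl | rfl)
    · exact ⟨0, rfl⟩
    · exact ⟨φ, rfl⟩
  refine ⟨?_, SLCone.numEnds_planePair hφ.1, fun S hS => ?_, SLCone.dimSU_three,
    SLCone.legendrianIndex_planePair hφ.1, fun S hS => ?_⟩
  · rw [hcomp, SLCone.link_slPlane, SLCone.link_slPlane]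
  · obtain ⟨ψ, rfl⟩ := hex S hS
    exact ⟨SLCone.nonempty_isometryEquiv_sphereImage _, fun c hc => SLCone.isEigenvalue_iff _ hc,
      SLCone.multiplicity_two _, SLCone.multiplicity_six _, SLCone.nonempty_stabilizer_equiv ψ,
      SLCone.dimStabilizerSU_sphereImage ψ⟩
  · obtain ⟨ψ, rfl⟩ := hex S hS
    have h6 : (2 * ((3 : ℕ) : ℝ)) = 6 := by norm_num
    rw [h6, SLCone.multiplicity_six, SLCone.dimStabilizerSU_sphereImage, SLCone.dimSU_three]
    norm_num
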